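/- **Setting.** Let $n\ge 1$ and $\ell\ge 2$ be integers and let $G$ be a subgroup of the symmetric group $S_n$ of $[n]=\{1,\dots,n\}$. Write $\deg(\sigma)$ for the number of points moved by $\sigma$, and $\mathrm{supp}(\sigma)$ for the set of these points. The group $G$ is *$\ell$-local* if for every $\sigma\in G$ and all $i,j\in[n]$ with $\sigma(i)=j$ there is $\tau\in G$ with $\mathrm{supp}(\tau)\subset\mathrm{supp}(\sigma)$, $\deg(\tau)\le\ell$ and $\tau(i)=j$. For $j\in[n]$ let $G_j=\{\sigma\in G:\sigma(k)=k\text{ for all }k>j\}$ and $O_j=\{\sigma(j):\sigma\in G_j\}$, and let $K_n=\#\{j\in\{2,\dots,n\}:O_j\ne\{j\}\}$. An *$\ell$-local base* of $G$ is a family $\mathcal T=(t_{i,j})_{2\le j\le n,\ i\in O_j}$ in $G$ with $t_{j,j}=\mathrm{id}$ and, for $i\neq j$, $t_{i,j}\in G_j$, $t_{i,j}(i)=j$ and $\deg(t_{i,j})\le \ell$. Let $U_{\mathcal T}:O_2\times\cdots\times O_n\to G$, $U_{\mathcal T}(i_2,\dots,i_n)=t_{i_2,2}t_{i_3,3}\cdots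 t_{i_n,n}$ (composition of maps), and let $\mathcal M_{\mathcal T}$ be the set of all push-forwards by $U_{\mathcal T}$ of product probability measures $\hat\nu_2\otimes\cdots\otimes\hat\nu_n$ with $\hat\nu_j\in\mathcal P(O_j)$. For $\sigma,\tau\in G$ let $d_H(\sigma,\tau)=\#\{i:\sigma(i)\ne\tau(i)\}$ and let $d_T(\sigma,\tau)$ be the least $k$ such that $\sigma t_1\cdots t_k=\tau$ for some $t_1,\dots,t_k\in G$ of degree at most $\ell$. Let $\Pi(\nu_1,\nu_2)$ be the set of probability measures on $G\times G$ with marginals $\nu_1,\nu_2$, and for $\pi\in\Pi(\nu_1,\nu_2)$ write $\pi(\sigma,\tau)=\nu_1(\sigma)p_\sigma(\tau)$ with $p_\sigma$ a probability measure on $G$. For $d\in\{d_H,d_T\}$ put $$W_1(\nu_1,\nu_2)=\inf_{\pi\in\Pi(\nu_1,\nu_2)}\iint d\,d\pi,\qquad \widetilde T_2(\nu_2|\nu_1)=\inf_{\pi\in\Pi(\nu_1,\nu_2)}\int\Big(\int d(\sigma,\tau)\,dp_\sigma(\tau)\Big)^2d\nu_1(\sigma),$$ $$\widehat T_2(\nu_2|\nu_1)=\inf_{\pi\in\Pi(\nu_1,\nu_2)}\int\sum_{i=1}^n\Big(\int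 \mathbf 1_{\sigma(i)\ne\tau(i)}\,dp_\sigma(\tau)\Big)^2d\nu_1(\sigma).$$ Let $H(\nu|\mu)=\int\log\frac{d\nu}{d\mu}\,d\nu$ if $\nu\ll\mu$ and $H(\nu|\mu)=+\infty$ otherwise. Consider the inequalities, for all probability measures $\nu_1,\nu_2$ on $G$, $$\frac{2}{c(\ell)^2}W_1^2(\nu_1,\nu_2)\le K_n\Big(\sqrt{H(\nu_1|\mu)}+\sqrt{H(\nu_2|\mu)}\Big)^2,\tag{1}$$ $$\frac{1}{2c(\ell)^2}\widetilde T_2(\nu_2|\nu_1)\le K_n\Big(\sqrt{H(\nu_1|\mu)}+\sqrt{H(\nu_2|\mu)}\Big)^2,\tag{2}$$ $$\frac{1}{2c(\ell)^2}\widehat T_2(\nu_2|\nu_1)\le \Big(\sqrt{H(\nu_1|\mu)}+\sqrt{H(\nu_2|\mu)}\Big)^2.\tag{3}$$ **Theorem.** (a) If $\mathcal T$ is an $\ell$-local base of $G$ and $\mu\in\mathcal M_{\mathcal T}$, then (1) and (2) hold with $c(\ell)=\min(2\ell-1,n)$ if $d=d_H$ and with $c(\ell)=2$ if $d=d_T$.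 If $G$ is $\ell$-local and $\mu$ is the uniform law on $G$, then (1) and (2) hold with $c(\ell)=\ell$ if $d=d_H$ and with $c(\ell)=1$ if $d=d_T$. (b) If $G$ is $\ell$-local and $\mu$ is the uniform law on $G$, then (3) holds with $c(\ell)^2=2(\ell-1)^2+2$. If $\mathcal T$ is an $\ell$-local base of $G$, $\mu\in\mathcal M_{\mathcal T}$, $G$ is a normal subgroup of $S_n$, and $\mu(\sigma)=\mu(\sigma^{-1})$ and $\mu(\sigma)=\mu(t^{-1}\sigma t)$ for all $\sigma\in G$, $t\in S_n$, then (3) holds with $c(\ell)^2=8(\ell-1)^2+2$. -/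

import Mathlib

open MeasureTheory ProbabilityTheory
open scoped ENNReal

noncomputable section

namespace PermTransport

/-- Every subset of a finite set of permutations is measurable. -/
instance permMeasurableSpace (n : ℕ) : MeasurableSpace (Equiv.Perm (Fin n)) := ⊤

instance permDiscreteMeasurableSpace (n : ℕ) :
    DiscreteMeasurableSpace (Equiv.Perm (Fin n)) := ⟨fun _ => trivial⟩

variable {n : ℕ}

/-- The degree of a permutation: the number of points that it moves. -/
def deg (σ : Equiv.Perm (Fin n)) : ℕ := σ.support.card

/-- `ℓ`-local groups of permutations. -/
def IsLocal (ℓ : ℕ) (G : Subgroup (Equiv.Perm (Fin n))) : Prop :=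
  ∀ σ ∈ G, ∀ i j : Fin n, σ i = j →
    ∃ τ ∈ G, τ.support ⊆ σ.support ∧ deg τ ≤ ℓ ∧ τ i = j

/-- The subgroup `G_j` of the elements of `G` that fix every `k > j`. -/
def tailStab (G : Subgroup (Equiv.Perm (Fin n))) (j : Fin n) :
    Subgroup (Equiv.Perm (Fin n)) where
  carrier := {σ | σ ∈ G ∧ ∀ k, j < k → σ k = k}
  one_mem' := ⟨G.one_mem, fun _ _ => rfl⟩
  mul_mem' := by
    rintro a b ⟨ha, ha'⟩ ⟨hb, hb'⟩
    refine ⟨G.mul_mem ha hb, fun k hk => ?_⟩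
    rw [Equiv.Perm.mul_apply, hb' k hk, ha' k hk]
  inv_mem' := by
    rintro a ⟨ha, ha'⟩
    refine ⟨G.inv_mem ha, fun k hk => ?_⟩
    rw [Equiv.Perm.inv_eq_iff_eq, ha' k hk]

/-- The orbit `O_j` of `j` under `G_j`. -/
def orb (G : Subgroup (Equiv.Perm (Fin n))) (j : Fin n) : Set (Fin n) :=
  {i | ∃ σ ∈ tailStab G j, σ j = i}

/-- `K_n`, the number of `j` with `O_j ≠ {j}`. (The first point never counts: `G_j` is trivial
for the first `j`.) -/
def numNontrivialOrb (G : Subgroup (Equiv.Perm (Fin n))) : ℕ :=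
  Set.ncard {j : Fin n | orb G j ≠ {j}}

/-- `t` is an `ℓ`-local base of `G`; here `t j i` is `t_{i,j}`, with `i ∈ O_j`. The family is also
indexed by the first point `j` of `Fin n`, for which `O_j = {j}` and `t j j = 1` is forced, so that
this index adds nothing. -/
def IsLocalBase (ℓ : ℕ) (G : Subgroup (Equiv.Perm (Fin n)))
    (t : (j : Fin n) → orb G j → G) : Prop :=
  ∀ (j : Fin n) (i : orb G j),
    ((i : Fin n) = j → t j i = 1) ∧
    ((i : Fin n) ≠ j →
      (t j i : Equiv.Perm (Fin n)) ∈ tailStab G j ∧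
      (t j i : Equiv.Perm (Fin n)) i = j ∧
      deg (t j i : Equiv.Perm (Fin n)) ≤ ℓ)

/-- The map `(i_2, …, i_n) ↦ t_{i_2,2} t_{i_3,3} ⋯ t_{i_n,n}`
(the factor of the first point of `Fin n` is the identity for a local base). -/
def baseMap {G : Subgroup (Equiv.Perm (Fin n))} (t : (j : Fin n) → orb G j → G)
    (i : (j : Fin n) → orb G j) : G :=
  (List.ofFn fun j => t j (i j)).prod

/-- The class of measures on `G` that are push-forwards under `baseMap t` of products of
probability measures on the sets `O_j`. -/
def measureClass {G : Subgroup (Equiv.Perm (Fin n))} (t : (j : Fin n) → orb G j → G) :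
    Set (Measure G) :=
  {μ | ∃ ν : (j : Fin n) → Measure (orb G j),
    (∀ j, IsProbabilityMeasure (ν j)) ∧ μ = (Measure.pi ν).map (baseMap t)}

/-- The uniform law on `G`. -/
def uniformLaw (G : Subgroup (Equiv.Perm (Fin n))) : Measure G :=
  uniformOn (Set.univ : Set G)

/-- The Hamming distance on `G`. -/
def dH (G : Subgroup (Equiv.Perm (Fin n))) (σ τ : G) : ℝ≥0∞ :=
  (hammingDist (σ : Equiv.Perm (Fin n)) (τ : Equiv.Perm (Fin n)) : ℕ)

/-- The distance `d_T`: the least number of factors `t_1, …, t_k` in `G`, of degree at most `ℓ`,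
with `σ t_1 ⋯ t_k = τ` (it would be `∞` if there were none). -/
def dT (ℓ : ℕ) (G : Subgroup (Equiv.Perm (Fin n))) (σ τ : G) : ℝ≥0∞ :=
  ⨅ (l : List G) (_ : ∀ t ∈ l, deg (t : Equiv.Perm (Fin n)) ≤ ℓ) (_ : σ * l.prod = τ),
    (l.length : ℝ≥0∞)

variable {G : Subgroup (Equiv.Perm (Fin n))}

/-- Couplings: measures on `G × G` with first marginal `ν₁` and second marginal `ν₂`. -/
def couplings (ν₁ ν₂ : Measure G) : Set (Measure (G × G)) :=
  {π | π.fst = ν₁ ∧ π.snd = ν₂}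

/-- The Wasserstein distance `W_1(ν₁, ν₂)` for the cost `d`. -/
def W₁ (d : G → G → ℝ≥0∞) (ν₁ ν₂ : Measure G) : ℝ≥0∞ :=
  ⨅ π ∈ couplings ν₁ ν₂, ∫⁻ x, d x.1 x.2 ∂π

/-- The weak transport cost `T̃_2(ν₂ | ν₁)` for the cost `d`. The infimum runs over the couplings
`π` and their disintegrations `π(σ, τ) = ν₁(σ) p_σ(τ)`. -/
def Ttilde (d : G → G → ℝ≥0∞) (ν₂ ν₁ : Measure G) : ℝ≥0∞ :=
  ⨅ (π ∈ couplings ν₁ ν₂) (p : Kernel G G) (_ : IsMarkovKernel p) (_ : π = ν₁ ⊗ₘ p),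
    ∫⁻ σ, (∫⁻ τ, d σ τ ∂(p σ)) ^ 2 ∂ν₁

/-- The weak transport cost `T̂_2(ν₂ | ν₁)`:
the integral `∫ 1_{σ(i) ≠ τ(i)} dp_σ(τ)` is the mass that `p_σ` gives to `{τ | σ(i) ≠ τ(i)}`. -/
def That (ν₂ ν₁ : Measure G) : ℝ≥0∞ :=
  ⨅ (π ∈ couplings ν₁ ν₂) (p : Kernel G G) (_ : IsMarkovKernel p) (_ : π = ν₁ ⊗ₘ p),
    ∫⁻ σ, ∑ i : Fin n,
      (p σ {τ : G | (σ : Equiv.Perm (Fin n)) i ≠ (τ : Equiv.Perm (Fin n)) i}) ^ 2 ∂ν₁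

/-- `(√H(ν₁|μ) + √H(ν₂|μ))²`, where `H(ν|μ)` is the relative entropy, with value `∞` if `ν` is not
absolutely continuous with respect to `μ`. -/
def entropyBound (μ ν₁ ν₂ : Measure G) : ℝ≥0∞ :=
  (InformationTheory.klDiv ν₁ μ ^ (1 / 2 : ℝ) + InformationTheory.klDiv ν₂ μ ^ (1 / 2 : ℝ)) ^ 2

/-- `(2 / c²) W_1² ≤ K_n (√H(ν₁|μ) + √H(ν₂|μ))²` for all probability measures `ν₁, ν₂` on `G`. -/
def W₁EntropyIneq (d : G → G → ℝ≥0∞) (c : ℕ) (μ : Measure G) : Prop :=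
  ∀ ν₁ ν₂ : Measure G, IsProbabilityMeasure ν₁ → IsProbabilityMeasure ν₂ →
    2 / (c : ℝ≥0∞) ^ 2 * W₁ d ν₁ ν₂ ^ 2 ≤ (numNontrivialOrb G : ℝ≥0∞) * entropyBound μ ν₁ ν₂

/-- `(1 / (2c²)) T̃_2(ν₂|ν₁) ≤ K_n (√H(ν₁|μ) + √H(ν₂|μ))²` for all probability measures
`ν₁, ν₂` on `G`. -/
def TtildeEntropyIneq (d : G → G → ℝ≥0∞) (c : ℕ) (μ : Measure G) : Prop :=
  ∀ ν₁ ν₂ : Measure G, IsProbabilityMeasure ν₁ → IsProbabilityMeasure ν₂ →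
    1 / (2 * (c : ℝ≥0∞) ^ 2) * Ttilde d ν₂ ν₁ ≤
      (numNontrivialOrb G : ℝ≥0∞) * entropyBound μ ν₁ ν₂

/-- `(1 / (2 c²)) T̂_2(ν₂|ν₁) ≤ (√H(ν₁|μ) + √H(ν₂|μ))²` for all probability measures
`ν₁, ν₂` on `G`; the argument `csq` is `c²`. -/
def ThatEntropyIneq (csq : ℕ) (μ : Measure G) : Prop :=
  ∀ ν₁ ν₂ : Measure G, IsProbabilityMeasure ν₁ → IsProbabilityMeasure ν₂ →
    1 / (2 * (csq : ℝ≥0∞)) * That ν₂ ν₁ ≤ entropyBound μ ν₁ ν₂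

end PermTransport

end

/-
Order the elements of `G` along the chain of subgroups `G_j`. The `j`-th label of an element
partitions each coset into fibres, and locality provides a bijection between any two fibres that
preserves `μ` up to a factor and moves every point by an element of small degree. To transport `ν₁`
to `ν₂`, first transport the law of the label, at a cost controlled by its entropy relative to the
law of the label under `μ` (Pinsker's inequality for `W₁`, Marton's inequality for the weak costs),
then use the fibre bijections to reduce to conditional laws on a single fibre, and recurse. The
chain rule for the relative entropy adds up the contributions. A label that takes only one value
costs nothing, which is where `K_n` comes from.

For `T̂₂` the labels may be used in any order. A shift of the fibres also disturbs other points, and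
the transport on the fibre has to absorb this as a penalty added to its move probabilities. Choosing
the next label at random, with weights proportional to the penalties, keeps the total penalty under
control, and the inversion of the group exchanges the values of a permutation with their positions.
-/

open InformationTheory Finset
open scoped Matrix

noncomputable section

namespace PermTransport

section Scalar

lemma two_mul_sub_one_le_add_one_mul_log {x : ℝ} (hx : 1 ≤ x) :
    2 * (x - 1) ≤ (x + 1) * Real.log x := by
  have h := Real.le_log_one_add_of_nonneg (sub_nonneg.2 hx)
  rw [add_sub_cancel, div_le_iff₀ (by linarith)] at h
  linarith

lemma add_one_mul_log_le_two_mul_sub_one {x : ℝ} (hx : 0 < x) (hx1 : x ≤ 1) :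
    (x + 1) * Real.log x ≤ 2 * (x - 1) := by
  have h := mul_le_mul_of_nonneg_left
    (two_mul_sub_one_le_add_one_mul_log ((one_le_inv₀ hx).2 hx1)) hx.le
  rw [Real.log_inv] at h
  have hinv : x * x⁻¹ = 1 := mul_inv_cancel₀ hx.ne'
  linear_combination h - (2 + Real.log x) * hinv

lemma three_mul_sub_one_sq_le_mul_klFun {x : ℝ} (hx : 0 ≤ x) :
    3 * (x - 1) ^ 2 ≤ (2 * x + 4) * klFun x := by
  let g : ℝ → ℝ := fun x ↦ (2 * x + 4) * klFun x - 3 * (x - 1) ^ 2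
  have hg_cont : Continuous g := by
    have := continuous_klFun
    fun_prop
  have hg_deriv {y : ℝ} (hy : 0 < y) :
      HasDerivAt g (4 * ((y + 1) * Real.log y - 2 * (y - 1))) y := by
    have h₁ := (((hasDerivAt_id y).const_mul 2).add_const 4).mul (hasDerivAt_klFun hy.ne')
    have h₂ := (((hasDerivAt_id y).sub_const 1).pow 2).const_mul 3
    refine (h₁.sub h₂).congr_deriv ?_
    simp only [klFun_apply, id_eq]
    ring
  have hg_one : g 1 = 0 := by simp [g, klFun_one]
  suffices 0 ≤ g x from sub_nonneg.1 this
  rw [← hg_one]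
  rcases le_total x 1 with hx1 | hx1
  · refine antitoneOn_of_hasDerivWithinAt_nonpos (convex_Icc 0 1) hg_cont.continuousOn
      (fun y hy ↦ (hg_deriv (interior_Icc (a := (0 : ℝ)) ▸ hy).1).hasDerivWithinAt)
      (fun y hy ↦ ?_) ⟨hx, hx1⟩ ⟨zero_le_one, le_rfl⟩ hx1
    rw [interior_Icc] at hy
    linarith [add_one_mul_log_le_two_mul_sub_one hy.1 hy.2.le]
  · have hpos {y : ℝ} (hy : y ∈ interior (Set.Ici 1)) : 1 < y := by rwa [interior_Ici] at hy
    refine monotoneOn_of_hasDerivWithinAt_nonneg (convex_Ici 1) hg_cont.continuousOn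
      (fun y hy ↦ (hg_deriv (zero_lt_one.trans (hpos hy))).hasDerivWithinAt)
      (fun y hy ↦ ?_) (Set.mem_Ici.2 le_rfl) hx1 hx1
    linarith [two_mul_sub_one_le_add_one_mul_log (hpos hy).le]

lemma sub_one_sq_le_mul_klFun {x : ℝ} (hx : 1 ≤ x) : (x - 1) ^ 2 ≤ x * (2 * klFun x) := by
  have hlog := two_mul_sub_one_le_add_one_mul_log hx
  have hkl := klFun_nonneg (zero_le_one.trans hx)
  rw [klFun_apply] at hkl ⊢
  have : (x - 1) ^ 2 ≤ (x + 1) * (x * Real.log x + 1 - x) := by nlinarith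
  nlinarith

lemma one_sub_sq_le_klFun {x : ℝ} (hx : 0 ≤ x) (hx1 : x ≤ 1) : (1 - x) ^ 2 ≤ 2 * klFun x := by
  nlinarith [three_mul_sub_one_sq_le_mul_klFun hx, klFun_nonneg hx]

lemma add_sq_le_of_holderConjugate {a b : ℝ} (hab : a.HolderConjugate b) (x y : ℝ) :
    (x + y) ^ 2 ≤ a * x ^ 2 + b * y ^ 2 := by
  have h := (even_two.convexOn_pow (𝕜 := ℝ)).2 (Set.mem_univ (a * x)) (Set.mem_univ (b * y))
    hab.inv_nonneg hab.symm.inv_nonneg hab.inv_add_inv_eq_one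
  have ha := hab.ne_zero
  have hb := hab.symm.ne_zero
  simp only [smul_eq_mul, mul_pow] at h
  field_simp at h
  linarith

lemma posPart_sub_sq_le {a b : ℝ} (hab : a.HolderConjugate b) {x y : ℝ} (hx : 0 ≤ x)
    (hy : 0 ≤ y) : ((x - y)⁺) ^ 2 ≤ x * (2 * (a * klFun x + b * klFun y)) := by
  have hx_mul : 0 ≤ x * klFun x := mul_nonneg hx (klFun_nonneg hx)
  have hy_mul : 0 ≤ x * klFun y := mul_nonneg hx (klFun_nonneg hy)
  have ha := hab.lt
  have hb := hab.symm.lt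
  suffices y ≤ x → (x - y) ^ 2 ≤ x * (2 * (a * klFun x + b * klFun y)) by
    rcases le_total x y with h | h
    · rw [posPart_of_nonpos (sub_nonpos.2 h)]
      nlinarith
    · rw [posPart_of_nonneg (sub_nonneg.2 h)]
      exact this h
  intro hyx
  rcases le_total 1 y with hy1 | hy1
  · have hsq : (x - y) ^ 2 ≤ (x - 1) ^ 2 := by nlinarith
    nlinarith [sub_one_sq_le_mul_klFun (hy1.trans hyx)]
  have hky := one_sub_sq_le_klFun hy hy1
  rcases le_total x 1 with hx1 | hx1
  · have hsq : (x - y) ^ 2 ≤ x * (1 - y) ^ 2 := by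
      nlinarith [mul_le_mul (show x - y ≤ x * (1 - y) by nlinarith)
        (show x - y ≤ 1 - y by linarith) (sub_nonneg.2 hyx)
        (mul_nonneg hx (sub_nonneg.2 hy1))]
    nlinarith
  · have hsq := add_sq_le_of_holderConjugate hab (x - 1) (1 - y)
    have hky' : (1 - y) ^ 2 ≤ x * (2 * klFun y) := by nlinarith
    rw [sub_add_sub_cancel] at hsq
    nlinarith [sub_one_sq_le_mul_klFun hx1]

lemma posPart_sub_sq_le_of_pos {a b : ℝ} (hab : a.HolderConjugate b) {x y w : ℝ} (hx : 0 ≤ x)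
    (hy : 0 ≤ y) (hw : 0 < w) :
    ((x - y)⁺) ^ 2 ≤ x * (2 * (a * (w * klFun (x / w)) + b * (w * klFun (y / w)))) := by
  have h := mul_le_mul_of_nonneg_left
    (posPart_sub_sq_le hab (div_nonneg hx hw.le) (div_nonneg hy hw.le)) (sq_nonneg w)
  rw [← mul_pow, ← sub_div, posPart_def, ← zero_div w, max_div_div_right hw.le,
    mul_div_cancel₀ _ hw.ne', ← posPart_def] at h
  refine h.trans_eq ?_
  field_simp

lemma posPart_sub_div_le_one {x y : ℝ} (hx : 0 ≤ x) (hy : 0 ≤ y) : (x - y)⁺ / x ≤ 1 :=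
  div_le_one_of_le₀ (sup_le (sub_le_self x hy) hx) hx

lemma mul_posPart_sub_div {x y : ℝ} (hy : 0 ≤ y) : x * ((x - y)⁺ / x) = (x - y)⁺ :=
  mul_div_cancel_of_imp' fun h ↦ by rw [h, zero_sub, posPart_of_nonpos (neg_nonpos.2 hy)]

end Scalar

section Entropy

variable {α β : Type*} [Fintype α] [Fintype β] {ν ν₁ ν₂ μ : α → ℝ} {a b : ℝ}

/-- The relative entropy of a probability vector `ν` with respect to the normalization of the
nonnegative weight `μ`. -/
def relEnt (ν μ : α → ℝ) : ℝ := ∑ x, ν x * Real.log (ν x / μ x) + Real.log (∑ x, μ x)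

/-- The weighted sum of two relative entropies. For conjugate exponents `a` and `b` its infimum is
`(√(relEnt ν₁ μ) + √(relEnt ν₂ μ))²`, so it serves as a smooth substitute for this quantity. -/
def entSum (a b : ℝ) (ν₁ ν₂ μ : α → ℝ) : ℝ := a * relEnt ν₁ μ + b * relEnt ν₂ μ

lemma sum_pos_of_support_subset (hν : ν ∈ stdSimplex ℝ α) (hμ : 0 ≤ μ)
    (hac : ν.support ⊆ μ.support) : 0 < ∑ x, μ x := by
  obtain ⟨x, -, hx⟩ := exists_ne_zero_of_sum_ne_zero (hν.2.trans_ne one_ne_zero)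
  exact sum_pos' (fun y _ ↦ hμ y) ⟨x, mem_univ x, (hμ x).lt_of_ne' (hac hx)⟩

lemma relEnt_eq_sum_klFun (hν : ν ∈ stdSimplex ℝ α) (hμ : 0 ≤ μ) (hac : ν.support ⊆ μ.support) :
    relEnt ν μ = ∑ x, μ x / (∑ y, μ y) * klFun (ν x / (μ x / ∑ y, μ y)) := by
  have hs := sum_pos_of_support_subset hν hμ hac
  set s := ∑ y, μ y with hs_def
  have hterm (x : α) : μ x / s * klFun (ν x / (μ x / s)) =
      ν x * Real.log (ν x / μ x) + ν x * Real.log s + μ x / s - ν x := by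
    by_cases hx : ν x = 0
    · simp [hx, klFun_zero]
    · have hμx : μ x ≠ 0 := hac hx
      rw [klFun_apply, ← div_mul, Real.log_mul (div_ne_zero hx hμx) hs.ne']
      field_simp
  simp only [hterm, sum_sub_distrib, sum_add_distrib, ← sum_mul, ← sum_div]
  rw [hν.2, ← hs_def, div_self hs.ne', relEnt]
  ring

lemma relEnt_nonneg (hν : ν ∈ stdSimplex ℝ α) (hμ : 0 ≤ μ) (hac : ν.support ⊆ μ.support) :
    0 ≤ relEnt ν μ := by
  rw [relEnt_eq_sum_klFun hν hμ hac]
  have hw (x : α) : 0 ≤ μ x / ∑ y, μ y := div_nonneg (hμ x) (sum_nonneg fun y _ ↦ hμ y)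
  exact sum_nonneg fun x _ ↦ mul_nonneg (hw x) (klFun_nonneg (div_nonneg (hν.1 x) (hw x)))

lemma entSum_nonneg (hab : a.HolderConjugate b) (h₁ : ν₁ ∈ stdSimplex ℝ α)
    (h₂ : ν₂ ∈ stdSimplex ℝ α) (hμ : 0 ≤ μ) (hac₁ : ν₁.support ⊆ μ.support)
    (hac₂ : ν₂.support ⊆ μ.support) : 0 ≤ entSum a b ν₁ ν₂ μ :=
  add_nonneg (mul_nonneg hab.nonneg (relEnt_nonneg h₁ hμ hac₁))
    (mul_nonneg hab.symm.nonneg (relEnt_nonneg h₂ hμ hac₂))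

lemma relEnt_comp_equiv (e : β ≃ α) (ν μ : α → ℝ) : relEnt (ν ∘ e) (μ ∘ e) = relEnt ν μ := by
  simp only [relEnt, Function.comp_apply, e.sum_comp μ,
    e.sum_comp fun x ↦ ν x * Real.log (ν x / μ x)]

lemma pinsker (hν : ν ∈ stdSimplex ℝ α) (hμ : 0 ≤ μ) (hac : ν.support ⊆ μ.support) :
    (∑ x, |ν x - μ x / ∑ y, μ y|) ^ 2 ≤ 2 * relEnt ν μ := by
  have hs := sum_pos_of_support_subset hν hμ hac
  rw [relEnt_eq_sum_klFun hν hμ hac]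
  set s := ∑ y, μ y with hs_def
  have hw (x : α) : 0 ≤ μ x / s := div_nonneg (hμ x) hs.le
  have hr (x : α) : 0 ≤ ν x / (μ x / s) := div_nonneg (hν.1 x) (hw x)
  have hcancel (x : α) : μ x / s * (ν x / (μ x / s)) = ν x :=
    mul_div_cancel_of_imp' fun h ↦ of_not_not fun hx ↦ div_ne_zero (hac hx) hs.ne' h
  have hcs := sum_sq_le_sum_mul_sum_of_sq_le_mul univ (r := fun x ↦ |ν x - μ x / s|)
    (f := fun x ↦ μ x / s * ((2 * (ν x / (μ x / s)) + 4) / 3))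
    (g := fun x ↦ μ x / s * klFun (ν x / (μ x / s)))
    (fun x _ ↦ mul_nonneg (hw x) (by linarith [hr x]))
    (fun x _ ↦ mul_nonneg (hw x) (klFun_nonneg (hr x)))
    (fun x _ ↦ by
      have h := mul_le_mul_of_nonneg_left (three_mul_sub_one_sq_le_mul_klFun (hr x))
        (mul_nonneg (hw x) (hw x))
      have hfac : ν x - μ x / s = μ x / s * (ν x / (μ x / s) - 1) := by
        rw [mul_sub, hcancel, mul_one]
      rw [sq_abs, hfac, mul_pow]
      linarith)
  have hweight (x : α) :
      μ x / s * ((2 * (ν x / (μ x / s)) + 4) / 3) = 2 / 3 * ν x + 4 / 3 * (μ x / s) := by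
    linear_combination (2 / 3) * hcancel x
  refine hcs.trans_eq ?_
  simp only [hweight, sum_add_distrib, ← mul_sum, ← sum_div]
  rw [hν.2, ← hs_def, div_self hs.ne']
  norm_num

lemma sum_posPart_sub_eq_sum_negPart_sub {f g : α → ℝ} (h : ∑ x, f x = ∑ x, g x) :
    ∑ x, (f x - g x)⁺ = ∑ x, (f x - g x)⁻ := by
  rw [← sub_eq_zero, ← sum_sub_distrib]
  simp only [posPart_sub_negPart, sum_sub_distrib, h, sub_self]

lemma two_mul_sum_posPart_sub {f g : α → ℝ} (h : ∑ x, f x = ∑ x, g x) :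
    2 * ∑ x, (f x - g x)⁺ = ∑ x, |f x - g x| := by
  simp only [← posPart_add_negPart, sum_add_distrib]
  rw [← sum_posPart_sub_eq_sum_negPart_sub h, two_mul]

lemma sq_sum_posPart_sub_le (hab : a.HolderConjugate b) (h₁ : ν₁ ∈ stdSimplex ℝ α)
    (h₂ : ν₂ ∈ stdSimplex ℝ α) (hμ : 0 ≤ μ) (hac₁ : ν₁.support ⊆ μ.support)
    (hac₂ : ν₂.support ⊆ μ.support) :
    (∑ x, (ν₁ x - ν₂ x)⁺) ^ 2 ≤ entSum a b ν₁ ν₂ μ / 2 := by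
  have hnorm := two_mul_sum_posPart_sub (h₁.2.trans h₂.2.symm)
  set w : α → ℝ := fun x ↦ μ x / ∑ y, μ y
  have htri : ∑ x, |ν₁ x - ν₂ x| ≤ ∑ x, |ν₁ x - w x| + ∑ x, |ν₂ x - w x| := by
    rw [← sum_add_distrib]
    gcongr with x
    rw [abs_sub_comm (ν₂ x)]
    exact abs_sub_le _ _ _
  have hsq := (pow_le_pow_left₀ (sum_nonneg fun x _ ↦ abs_nonneg _) htri 2).trans
    (add_sq_le_of_holderConjugate hab _ _)
  rw [← hnorm] at hsq
  rw [entSum]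
  linarith [mul_le_mul_of_nonneg_left (pinsker h₁ hμ hac₁) hab.nonneg,
    mul_le_mul_of_nonneg_left (pinsker h₂ hμ hac₂) hab.symm.nonneg]

lemma sum_posPart_sub_sq_div_le (hab : a.HolderConjugate b) (h₁ : ν₁ ∈ stdSimplex ℝ α)
    (h₂ : ν₂ ∈ stdSimplex ℝ α) (hμ : 0 ≤ μ) (hac₁ : ν₁.support ⊆ μ.support)
    (hac₂ : ν₂.support ⊆ μ.support) :
    ∑ x, ((ν₁ x - ν₂ x)⁺) ^ 2 / ν₁ x ≤ 2 * entSum a b ν₁ ν₂ μ := by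
  have hs := sum_pos_of_support_subset h₁ hμ hac₁
  rw [entSum, relEnt_eq_sum_klFun h₁ hμ hac₁, relEnt_eq_sum_klFun h₂ hμ hac₂, mul_sum, mul_sum,
    ← sum_add_distrib, mul_sum]
  refine sum_le_sum fun x _ ↦ ?_
  rcases (h₁.1 x).eq_or_lt with hx | hx
  · have hw := div_nonneg (hμ x) hs.le
    rw [← hx, div_zero]
    have := mul_nonneg hw (klFun_nonneg (div_nonneg le_rfl hw))
    have := mul_nonneg hw (klFun_nonneg (div_nonneg (h₂.1 x) hw))
    have := hab.pos
    have := hab.symm.pos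
    positivity
  · rw [div_le_iff₀' hx]
    exact posPart_sub_sq_le_of_pos hab (h₁.1 x) (h₂.1 x)
      (div_pos ((hμ x).lt_of_ne' (hac₁ hx.ne')) hs)

lemma posPart_eq_zero_of_sum_negPart_eq_zero (h₁ : ν₁ ∈ stdSimplex ℝ α)
    (h₂ : ν₂ ∈ stdSimplex ℝ α) (h : ∑ z, (ν₁ z - ν₂ z)⁻ = 0) (x : α) : (ν₁ x - ν₂ x)⁺ = 0 := by
  rw [← sum_posPart_sub_eq_sum_negPart_sub (h₁.2.trans h₂.2.symm)] at h
  exact (sum_eq_zero_iff_of_nonneg fun z _ ↦ posPart_nonneg _).1 h x (mem_univ x)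

end Entropy

section Transport

variable {α : Type*} [Fintype α] [DecidableEq α] {ν ν₁ ν₂ μ : α → ℝ} {p : Matrix α α ℝ}

/-- The matrix `p` is a Markov kernel that transports the probability vector `ν₁` to `ν₂`. -/
def IsTransport (p : Matrix α α ℝ) (ν₁ ν₂ : α → ℝ) : Prop :=
  p ∈ Matrix.rowStochastic ℝ α ∧ ν₁ ᵥ* p = ν₂

namespace IsTransport

lemma nonneg (hp : IsTransport p ν₁ ν₂) (x y : α) : 0 ≤ p x y := hp.1.1 x y

lemma sum_row (hp : IsTransport p ν₁ ν₂) (x : α) : ∑ y, p x y = 1 :=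
  Matrix.sum_row_of_mem_rowStochastic hp.1 x

lemma row_mem_stdSimplex (hp : IsTransport p ν₁ ν₂) (x : α) : p x ∈ stdSimplex ℝ α :=
  ⟨hp.nonneg x, hp.sum_row x⟩

lemma sum_mul_eq (hp : IsTransport p ν₁ ν₂) (y : α) : ∑ x, ν₁ x * p x y = ν₂ y :=
  congrFun hp.2 y

lemma apply_ne_zero (hp : IsTransport p ν₁ ν₂) (h₁ : 0 ≤ ν₁) {x y : α} (hx : ν₁ x ≠ 0)
    (hxy : p x y ≠ 0) : ν₂ y ≠ 0 := by
  rw [← hp.sum_mul_eq]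
  exact fun h ↦ mul_ne_zero hx hxy ((sum_eq_zero_iff_of_nonneg fun z _ ↦
    mul_nonneg (h₁ z) (hp.nonneg z y)).1 h x (mem_univ x))

lemma apply_self_le_one (hp : IsTransport p ν₁ ν₂) (x : α) : p x x ≤ 1 :=
  Matrix.le_one_of_mem_rowStochastic hp.1

end IsTransport

lemma isTransport_one (ν : α → ℝ) : IsTransport 1 ν ν := ⟨one_mem _, Matrix.vecMul_one ν⟩

/-- The transport kernel from `ν₁` to `ν₂` that moves as little mass as possible: mass moves only
out of points with `ν₁ x > ν₂ x`, with probability `(ν₁ x - ν₂ x) / ν₁ x`, and is distributed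
proportionally to `(ν₂ - ν₁)⁺`. At points with `ν₁ x = 0` the division by zero makes it the
identity. -/
def maximalCoupling (ν₁ ν₂ : α → ℝ) : Matrix α α ℝ :=
  fun x y ↦ (1 - (ν₁ x - ν₂ x)⁺ / ν₁ x) * (1 : Matrix α α ℝ) x y +
    (ν₁ x - ν₂ x)⁺ / ν₁ x * ((ν₁ y - ν₂ y)⁻ / ∑ z, (ν₁ z - ν₂ z)⁻)

lemma isTransport_maximalCoupling (h₁ : ν₁ ∈ stdSimplex ℝ α) (h₂ : ν₂ ∈ stdSimplex ℝ α) :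
    IsTransport (maximalCoupling ν₁ ν₂) ν₁ ν₂ := by
  have hsum := sum_posPart_sub_eq_sum_negPart_sub (h₁.2.trans h₂.2.symm)
  set D := ∑ z, (ν₁ z - ν₂ z)⁻ with hD
  have hmul (x : α) := mul_posPart_sub_div (x := ν₁ x) (h₂.1 x)
  refine ⟨Matrix.mem_rowStochastic_iff_sum.2 ⟨fun x y ↦ ?_, fun x ↦ ?_⟩, funext fun y ↦ ?_⟩
  · have hone : 0 ≤ (1 : Matrix α α ℝ) x y := (one_mem (Matrix.rowStochastic ℝ α)).1 x y
    have := sub_nonneg.2 (posPart_sub_div_le_one (h₁.1 x) (h₂.1 x))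
    have := h₁.1 x
    unfold maximalCoupling
    positivity
  · simp only [maximalCoupling, sum_add_distrib, ← mul_sum, ← sum_div, ← hD]
    rw [Matrix.sum_row_of_mem_rowStochastic (one_mem _)]
    by_cases hD0 : D = 0
    · simp [posPart_eq_zero_of_sum_negPart_eq_zero h₁ h₂ hD0 x]
    · rw [div_self hD0]
      ring
  · have hD_cancel : D * ((ν₁ y - ν₂ y)⁻ / D) = (ν₁ y - ν₂ y)⁻ :=
      mul_div_cancel_of_imp' fun h ↦
        (sum_eq_zero_iff_of_nonneg fun z _ ↦ negPart_nonneg _).1 (hD.symm.trans h) y (mem_univ y)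
    simp only [Matrix.vecMul, dotProduct, maximalCoupling, mul_add, sum_add_distrib,
      ← mul_assoc, hmul, ← sum_mul, hsum, mul_sub, mul_one, ← hD]
    simp only [Matrix.one_apply, mul_ite, mul_one, mul_zero, sum_ite_eq', mem_univ, if_true,
      hD_cancel]
    linear_combination -posPart_sub_negPart (ν₁ y - ν₂ y)

lemma one_sub_maximalCoupling_self (x : α) :
    1 - maximalCoupling ν₁ ν₂ x x = (ν₁ x - ν₂ x)⁺ / ν₁ x := by
  have h : (ν₁ x - ν₂ x)⁺ * (ν₁ x - ν₂ x)⁻ = 0 := by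
    rcases le_total (ν₁ x) (ν₂ x) with h | h
    · rw [posPart_of_nonpos (sub_nonpos.2 h), zero_mul]
    · rw [negPart_of_nonneg (sub_nonneg.2 h), mul_zero]
  rw [maximalCoupling, Matrix.one_apply_eq, mul_one, div_mul_div_comm, h, zero_div]
  ring

variable {a b : ℝ}

lemma sum_mul_one_sub_maximalCoupling_sq_le (hab : a.HolderConjugate b)
    (h₁ : ν₁ ∈ stdSimplex ℝ α) (h₂ : ν₂ ∈ stdSimplex ℝ α) (hμ : 0 ≤ μ)
    (hac₁ : ν₁.support ⊆ μ.support) (hac₂ : ν₂.support ⊆ μ.support) :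
    ∑ x, ν₁ x * (1 - maximalCoupling ν₁ ν₂ x x) ^ 2 ≤ 2 * entSum a b ν₁ ν₂ μ := by
  simp only [one_sub_maximalCoupling_self, sq, ← mul_assoc, mul_posPart_sub_div (h₂.1 _)]
  simpa only [sq, mul_div_assoc] using sum_posPart_sub_sq_div_le hab h₁ h₂ hμ hac₁ hac₂

lemma sq_sum_mul_one_sub_maximalCoupling_le (hab : a.HolderConjugate b)
    (h₁ : ν₁ ∈ stdSimplex ℝ α) (h₂ : ν₂ ∈ stdSimplex ℝ α) (hμ : 0 ≤ μ)
    (hac₁ : ν₁.support ⊆ μ.support) (hac₂ : ν₂.support ⊆ μ.support) :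
    (∑ x, ν₁ x * (1 - maximalCoupling ν₁ ν₂ x x)) ^ 2 ≤ entSum a b ν₁ ν₂ μ / 2 := by
  simp only [one_sub_maximalCoupling_self, mul_posPart_sub_div (h₂.1 _)]
  exact sq_sum_posPart_sub_le hab h₁ h₂ hμ hac₁ hac₂

end Transport

section Disintegration

variable {α ι : Type*} {x : α → ι} {ν μ : α → ℝ} {i : ι} {σ : α}

/-- The restriction of a vector to the fibre of the labelling `x` over `i`. -/
def fiberPart (x : α → ι) (ν : α → ℝ) (i : ι) : α → ℝ := (x ⁻¹' {i}).indicator ν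

lemma fiberPart_nonneg (hν : 0 ≤ ν) (i : ι) : 0 ≤ fiberPart x ν i :=
  Set.indicator_nonneg fun σ _ ↦ hν σ

lemma fiberPart_ne_zero_iff : fiberPart x ν i σ ≠ 0 ↔ x σ = i ∧ ν σ ≠ 0 :=
  Set.indicator_apply_ne_zero

lemma fiberPart_apply [DecidableEq ι] (i : ι) (σ : α) :
    fiberPart x ν i σ = if x σ = i then ν σ else 0 := by
  by_cases h : x σ = i <;> simp [fiberPart, h]

variable [Fintype α]

/-- The push-forward of a vector by the labelling `x`. -/
def label (x : α → ι) (ν : α → ℝ) (i : ι) : ℝ := ∑ σ, fiberPart x ν i σ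

/-- The conditional law of `ν` on the fibre of the labelling `x` over `i`; it is `0` when the fibre
has no mass. -/
def fiberCond (x : α → ι) (ν : α → ℝ) (i : ι) : α → ℝ := fun σ ↦ fiberPart x ν i σ / label x ν i

lemma label_nonneg (hν : 0 ≤ ν) : 0 ≤ label x ν :=
  fun i ↦ sum_nonneg fun σ _ ↦ fiberPart_nonneg hν i σ

lemma fiberPart_eq_zero_of_label_eq_zero (hν : 0 ≤ ν) (h : label x ν i = 0) (σ : α) :
    fiberPart x ν i σ = 0 :=
  (sum_eq_zero_iff_of_nonneg fun τ _ ↦ fiberPart_nonneg hν i τ).1 h σ (mem_univ σ)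

lemma exists_of_label_ne_zero (h : label x ν i ≠ 0) : ∃ σ, x σ = i ∧ ν σ ≠ 0 :=
  let ⟨σ, _, hσ⟩ := exists_ne_zero_of_sum_ne_zero h
  ⟨σ, fiberPart_ne_zero_iff.1 hσ⟩

lemma label_ne_zero (hν : 0 ≤ ν) (h : ν σ ≠ 0) : label x ν (x σ) ≠ 0 :=
  fun h₀ ↦ fiberPart_ne_zero_iff.2 ⟨rfl, h⟩ (fiberPart_eq_zero_of_label_eq_zero hν h₀ σ)

lemma support_label_subset (hμ : 0 ≤ μ) (hac : ν.support ⊆ μ.support) :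
    (label x ν).support ⊆ (label x μ).support := by
  rintro i hi
  obtain ⟨σ, rfl, hσ⟩ := exists_of_label_ne_zero hi
  exact label_ne_zero hμ (hac hσ)

lemma support_fiberCond_subset (hac : ν.support ⊆ μ.support) (i : ι) :
    (fiberCond x ν i).support ⊆ (fiberPart x μ i).support := fun _ hσ ↦
  let ⟨hx, hν⟩ := fiberPart_ne_zero_iff.1 (div_ne_zero_iff.1 hσ).1
  fiberPart_ne_zero_iff.2 ⟨hx, hac hν⟩

lemma label_mul_fiberCond (hν : 0 ≤ ν) (i : ι) (σ : α) :
    label x ν i * fiberCond x ν i σ = fiberPart x ν i σ :=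
  mul_div_cancel_of_imp' fun h ↦ fiberPart_eq_zero_of_label_eq_zero hν h σ

lemma fiberCond_mem_stdSimplex (hν : 0 ≤ ν) (hi : label x ν i ≠ 0) :
    fiberCond x ν i ∈ stdSimplex ℝ α :=
  ⟨fun σ ↦ div_nonneg (fiberPart_nonneg hν i σ) (label_nonneg hν i), by
    simp only [fiberCond, ← sum_div]
    exact div_self hi⟩

lemma mul_sum_div_mul_log {ν μ : α → ℝ} {c : ℝ} (hc : c ≠ 0) (hac : ν.support ⊆ μ.support) :
    c * ∑ x, ν x / c * Real.log (ν x / c / μ x) =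
      ∑ x, ν x * Real.log (ν x / μ x) - (∑ x, ν x) * Real.log c := by
  rw [mul_sum, sum_mul, ← sum_sub_distrib]
  refine sum_congr rfl fun x _ ↦ ?_
  by_cases hx : ν x = 0
  · simp [hx]
  · rw [div_right_comm, Real.log_div (div_ne_zero hx (hac hx)) hc]
    field_simp

lemma label_mul_relEnt_fiberCond (hν : 0 ≤ ν) (hμ : 0 ≤ μ) (hac : ν.support ⊆ μ.support) (i : ι) :
    label x ν i * relEnt (fiberCond x ν i) (fiberPart x μ i) =
      ∑ σ, fiberPart x ν i σ * Real.log (ν σ / μ σ) -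
        label x ν i * Real.log (label x ν i / label x μ i) := by
  by_cases hi : label x ν i = 0
  · simp [hi, fiberPart_eq_zero_of_label_eq_zero hν hi]
  have hac_fiber : (fiberPart x ν i).support ⊆ (fiberPart x μ i).support := fun σ hσ ↦
    fiberPart_ne_zero_iff.2 ((fiberPart_ne_zero_iff.1 hσ).imp_right fun h ↦ hac h)
  have hlog (σ : α) : fiberPart x ν i σ * Real.log (fiberPart x ν i σ / fiberPart x μ i σ) =
      fiberPart x ν i σ * Real.log (ν σ / μ σ) := by
    by_cases hσ : x σ = i <;> simp [fiberPart, hσ]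
  simp only [relEnt, fiberCond, mul_add, mul_sum_div_mul_log hi hac_fiber, hlog]
  rw [Real.log_div hi (support_label_subset hμ hac hi), ← label, ← label]
  ring

lemma relEnt_const_mul (hν : ν ∈ stdSimplex ℝ α) (hμ : 0 ≤ μ) (hac : ν.support ⊆ μ.support)
    {κ : ℝ} (hκ : 0 < κ) : relEnt ν (fun σ ↦ κ * μ σ) = relEnt ν μ := by
  have h := mul_sum_div_mul_log hκ.ne' hac
  rw [hν.2, one_mul, mul_sum] at h
  simp only [← mul_assoc, mul_div_cancel₀ _ hκ.ne', div_div] at h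
  simp only [relEnt, ← mul_sum, Real.log_mul hκ.ne' (sum_pos_of_support_subset hν hμ hac).ne', h]
  ring

/-- The family `Θ i k` of bijections shifts the fibre of `μ` over `i` to the one over `k`, up to a
positive factor, whenever both fibres have mass. -/
def ShiftCompatible (x : α → ι) (Θ : ι → ι → α ≃ α) (μ : α → ℝ) : Prop :=
  ∀ i k, label x μ i ≠ 0 → label x μ k ≠ 0 →
    ∃ κ : ℝ, 0 < κ ∧ ∀ σ, fiberPart x μ k (Θ i k σ) = κ * fiberPart x μ i σ

/-- The conditional law of `ν` on the fibre over `i`, shifted by `Θ i k` to the fibre over `k`. -/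
def shiftCond (x : α → ι) (Θ : ι → ι → α ≃ α) (ν : α → ℝ) (i k : ι) : α → ℝ :=
  fiberCond x ν i ∘ (Θ i k).symm

variable {Θ : ι → ι → α ≃ α} {k : ι}

lemma shiftCond_mem_stdSimplex (hν : 0 ≤ ν) (hi : label x ν i ≠ 0) (k : ι) :
    shiftCond x Θ ν i k ∈ stdSimplex ℝ α :=
  ⟨fun _ ↦ (fiberCond_mem_stdSimplex hν hi).1 _,
    ((Θ i k).symm.sum_comp _).trans (fiberCond_mem_stdSimplex hν hi).2⟩

lemma support_shiftCond_subset (hΘ : ShiftCompatible x Θ μ) (hac : ν.support ⊆ μ.support)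
    (hi : label x μ i ≠ 0) (hk : label x μ k ≠ 0) :
    (shiftCond x Θ ν i k).support ⊆ (fiberPart x μ k).support := by
  intro σ hσ
  obtain ⟨κ, hκ, h⟩ := hΘ i k hi hk
  rw [Function.mem_support, ← (Θ i k).apply_symm_apply σ, h]
  exact mul_ne_zero hκ.ne' (support_fiberCond_subset hac i hσ)

lemma relEnt_shiftCond (hΘ : ShiftCompatible x Θ μ) (hν : 0 ≤ ν) (hμ : 0 ≤ μ)
    (hac : ν.support ⊆ μ.support) (hi : label x ν i ≠ 0) (hk : label x μ k ≠ 0) :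
    relEnt (shiftCond x Θ ν i k) (fiberPart x μ k) =
      relEnt (fiberCond x ν i) (fiberPart x μ i) := by
  obtain ⟨κ, hκ, h⟩ := hΘ i k (support_label_subset hμ hac hi) hk
  rw [← relEnt_comp_equiv (Θ i k), shiftCond, Function.comp_assoc, Equiv.symm_comp_self,
    Function.comp_id, ← relEnt_const_mul (fiberCond_mem_stdSimplex hν hi) (fiberPart_nonneg hμ i)
      (support_fiberCond_subset hac i) hκ]
  exact congrArg _ (funext h)

lemma shiftCond_apply_ne_zero (h₁ : 0 ≤ ν) (hσ : ν σ ≠ 0) (k : ι) :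
    shiftCond x Θ ν (x σ) k (Θ (x σ) k σ) ≠ 0 := by
  rw [shiftCond, Function.comp_apply, Equiv.symm_apply_apply]
  exact div_ne_zero (fiberPart_ne_zero_iff.2 ⟨rfl, hσ⟩) (label_ne_zero h₁ hσ)

variable [Fintype ι]

lemma sum_fiberPart_mul (f : ι → α → ℝ) :
    ∑ i, ∑ σ, fiberPart x ν i σ * f i σ = ∑ σ, ν σ * f (x σ) σ := by
  classical
  rw [sum_comm]
  simp only [fiberPart_apply, ite_mul, zero_mul, sum_ite_eq, mem_univ, if_true]

lemma sum_mul_comp_label (f : ι → ℝ) : ∑ σ, ν σ * f (x σ) = ∑ i, label x ν i * f i := by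
  rw [← sum_fiberPart_mul fun i _ ↦ f i]
  simp only [label, sum_mul]

lemma sum_label : ∑ i, label x ν i = ∑ σ, ν σ := by
  simpa using (sum_mul_comp_label (x := x) (ν := ν) 1).symm

lemma label_mem_stdSimplex (hν : ν ∈ stdSimplex ℝ α) : label x ν ∈ stdSimplex ℝ ι :=
  ⟨label_nonneg hν.1, sum_label.trans hν.2⟩

lemma relEnt_eq_relEnt_label_add (hν : 0 ≤ ν) (hμ : 0 ≤ μ) (hac : ν.support ⊆ μ.support) :
    relEnt ν μ = relEnt (label x ν) (label x μ) +
      ∑ i, label x ν i * relEnt (fiberCond x ν i) (fiberPart x μ i) := by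
  simp only [label_mul_relEnt_fiberCond hν hμ hac, sum_sub_distrib, sum_fiberPart_mul]
  rw [relEnt, relEnt, sum_label]
  ring

lemma sum_mul_sum_shift (hν : 0 ≤ ν) (q : Matrix ι ι ℝ) (f : ι → ι → α → ℝ) :
    ∑ σ, ν σ * ∑ k, q (x σ) k * f (x σ) k (Θ (x σ) k σ) =
      ∑ i, ∑ k, label x ν i * q i k * ∑ σ, shiftCond x Θ ν i k σ * f i k σ := by
  rw [← sum_fiberPart_mul fun i σ ↦ ∑ k, q i k * f i k (Θ i k σ)]
  simp only [mul_sum]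
  refine sum_congr rfl fun i _ ↦ sum_comm.trans (sum_congr rfl fun k _ ↦ ?_)
  rw [← (Θ i k).sum_comp fun σ ↦ label x ν i * q i k * (shiftCond x Θ ν i k σ * f i k σ)]
  refine sum_congr rfl fun σ _ ↦ ?_
  rw [shiftCond, Function.comp_apply, Equiv.symm_apply_apply, ← label_mul_fiberCond hν i σ]
  ring

variable [DecidableEq ι] {ν₁ ν₂ : α → ℝ} {q : Matrix ι ι ℝ}

lemma entSum_label_add_eq (a b : ℝ) (h₁ : 0 ≤ ν₁) (h₂ : 0 ≤ ν₂) (hμ : 0 ≤ μ)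
    (hac₁ : ν₁.support ⊆ μ.support) (hac₂ : ν₂.support ⊆ μ.support)
    (hΘ : ShiftCompatible x Θ μ) (hq : IsTransport q (label x ν₁) (label x ν₂)) :
    entSum a b (label x ν₁) (label x ν₂) (label x μ) +
      ∑ i, ∑ k, label x ν₁ i * q i k *
        entSum a b (shiftCond x Θ ν₁ i k) (fiberCond x ν₂ k) (fiberPart x μ k) =
      entSum a b ν₁ ν₂ μ := by
  have hterm (i k : ι) : label x ν₁ i * q i k *
        entSum a b (shiftCond x Θ ν₁ i k) (fiberCond x ν₂ k) (fiberPart x μ k) =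
      q i k * (a * (label x ν₁ i * relEnt (fiberCond x ν₁ i) (fiberPart x μ i))) +
        label x ν₁ i * q i k * (b * relEnt (fiberCond x ν₂ k) (fiberPart x μ k)) := by
    by_cases hi : label x ν₁ i = 0
    · simp [hi]
    by_cases hk : q i k = 0
    · simp [hk]
    rw [entSum, relEnt_shiftCond hΘ h₁ hμ hac₁ hi
      (support_label_subset hμ hac₂ (hq.apply_ne_zero (label_nonneg h₁) hi hk))]
    ring
  have hcomm : ∑ i, ∑ k, label x ν₁ i * q i k *
      (b * relEnt (fiberCond x ν₂ k) (fiberPart x μ k)) =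
      b * ∑ k, label x ν₂ k * relEnt (fiberCond x ν₂ k) (fiberPart x μ k) := by
    rw [sum_comm, mul_sum]
    refine sum_congr rfl fun k _ ↦ ?_
    rw [← sum_mul, hq.sum_mul_eq]
    ring
  simp only [hterm, sum_add_distrib]
  simp only [hcomm, ← sum_mul, hq.sum_row, one_mul, ← mul_sum]
  rw [entSum, entSum, relEnt_eq_relEnt_label_add (x := x) h₁ hμ hac₁,
    relEnt_eq_relEnt_label_add (x := x) h₂ hμ hac₂]
  ring

lemma sum_mul_entSum_nonneg {a b : ℝ} (hab : a.HolderConjugate b) (h₁ : ν₁ ∈ stdSimplex ℝ α)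
    (h₂ : ν₂ ∈ stdSimplex ℝ α) (hμ : 0 ≤ μ) (hac₁ : ν₁.support ⊆ μ.support)
    (hac₂ : ν₂.support ⊆ μ.support) (hΘ : ShiftCompatible x Θ μ)
    (hq : IsTransport q (label x ν₁) (label x ν₂)) :
    0 ≤ ∑ i, ∑ k, label x ν₁ i * q i k *
      entSum a b (shiftCond x Θ ν₁ i k) (fiberCond x ν₂ k) (fiberPart x μ k) := by
  refine sum_nonneg fun i _ ↦ sum_nonneg fun k _ ↦ ?_
  by_cases hi : label x ν₁ i = 0
  · simp [hi]
  by_cases hk : q i k = 0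
  · simp [hk]
  have hk₂ := hq.apply_ne_zero (label_nonneg h₁.1) hi hk
  have hkμ := support_label_subset hμ hac₂ hk₂
  exact mul_nonneg (mul_nonneg (label_nonneg h₁.1 i) (hq.nonneg i k)) <|
    entSum_nonneg hab (shiftCond_mem_stdSimplex h₁.1 hi k) (fiberCond_mem_stdSimplex h₂.1 hk₂)
      (fiberPart_nonneg hμ k)
      (support_shiftCond_subset hΘ hac₁ (support_label_subset hμ hac₁ hi) hkμ)
      (support_fiberCond_subset hac₂ k)

/-- The transport assembled from a transport `q` of the labels, the shifts `Θ i k` of the fibres and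
transports `P i k` within the fibres. -/
def glue (x : α → ι) (Θ : ι → ι → α ≃ α) (q : Matrix ι ι ℝ) (P : ι → ι → Matrix α α ℝ) :
    Matrix α α ℝ :=
  fun σ τ ↦ ∑ k, q (x σ) k * P (x σ) k (Θ (x σ) k σ) τ

lemma isTransport_glue [DecidableEq α] (h₁ : 0 ≤ ν₁) (h₂ : 0 ≤ ν₂)
    (hq : IsTransport q (label x ν₁) (label x ν₂)) {P : ι → ι → Matrix α α ℝ}
    (hP : ∀ i k, P i k ∈ Matrix.rowStochastic ℝ α)
    (hPt : ∀ i k, label x ν₁ i ≠ 0 → q i k ≠ 0 →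
      IsTransport (P i k) (shiftCond x Θ ν₁ i k) (fiberCond x ν₂ k)) :
    IsTransport (glue x Θ q P) ν₁ ν₂ := by
  refine ⟨Matrix.mem_rowStochastic_iff_sum.2 ⟨fun σ τ ↦ ?_, fun σ ↦ ?_⟩, funext fun τ ↦ ?_⟩
  · exact sum_nonneg fun k _ ↦ mul_nonneg (hq.nonneg _ k) ((hP _ k).1 _ τ)
  · simp only [glue]
    rw [sum_comm]
    simp only [← mul_sum, Matrix.sum_row_of_mem_rowStochastic (hP _ _), mul_one, hq.sum_row]
  · have hterm (i k : ι) : label x ν₁ i * q i k * ∑ σ, shiftCond x Θ ν₁ i k σ * P i k σ τ =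
        label x ν₁ i * q i k * fiberCond x ν₂ k τ := by
      by_cases hi : label x ν₁ i = 0
      · simp [hi]
      by_cases hk : q i k = 0
      · simp [hk]
      rw [(hPt i k hi hk).sum_mul_eq]
    refine (sum_mul_sum_shift h₁ q fun i k σ ↦ P i k σ τ).trans ?_
    simp only [hterm]
    rw [sum_comm]
    simp only [← sum_mul, hq.sum_mul_eq, label_mul_fiberCond h₂]
    simp only [fiberPart_apply, sum_ite_eq, mem_univ, if_true]

end Disintegration

section GlueCost

variable {α ι : Type*} [Fintype α]

lemma sq_sum_mul_le {w : α → ℝ} (hw : w ∈ stdSimplex ℝ α) (f : α → ℝ) :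
    (∑ x, w x * f x) ^ 2 ≤ ∑ x, w x * f x ^ 2 :=
  Real.pow_arith_mean_le_arith_mean_pow_of_even univ w f (fun x _ ↦ hw.1 x) hw.2 even_two

lemma sum_mul_add_sq_le {w f g : α → ℝ} (hw : 0 ≤ w) {K X Y : ℝ} (hK : 0 ≤ K) (hX : 0 ≤ X)
    (hf : ∑ x, w x * f x ^ 2 ≤ K * X) (hg : ∑ x, w x * g x ^ 2 ≤ Y) :
    ∑ x, w x * (f x + g x) ^ 2 ≤ (K + 1) * (X + Y) := by
  have hg₀ : 0 ≤ ∑ x, w x * g x ^ 2 := sum_nonneg fun x _ ↦ mul_nonneg (hw x) (sq_nonneg _)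
  have hcs : (∑ x, w x * (f x * g x)) ^ 2 ≤ K * X * Y :=
    (sum_sq_le_sum_mul_sum_of_sq_le_mul univ (fun x _ ↦ mul_nonneg (hw x) (sq_nonneg (f x)))
      (fun x _ ↦ mul_nonneg (hw x) (sq_nonneg (g x))) fun x _ ↦ (by ring : _ = _).le).trans
      (mul_le_mul hf hg hg₀ (mul_nonneg hK hX))
  have hmean : 2 * ∑ x, w x * (f x * g x) ≤ X + K * Y :=
    le_of_sq_le_sq (by nlinarith [sq_nonneg (X - K * Y)])
      (add_nonneg hX (mul_nonneg hK (hg₀.trans hg)))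
  have hexpand (x : α) : w x * (f x + g x) ^ 2 =
      w x * f x ^ 2 + 2 * (w x * (f x * g x)) + w x * g x ^ 2 := by ring
  simp only [hexpand, sum_add_distrib, ← mul_sum]
  linarith

lemma add_sq_le_of_sq_le {x y K X Y : ℝ} (hK : 0 ≤ K) (hX : 0 ≤ X) (hx : x ^ 2 ≤ K * X)
    (hy : y ^ 2 ≤ Y) : (x + y) ^ 2 ≤ (K + 1) * (X + Y) := by
  simpa using sum_mul_add_sq_le (w := fun _ : Unit ↦ 1) (f := fun _ ↦ x) (g := fun _ ↦ y)
    (fun _ ↦ zero_le_one) hK hX (by simpa using hx) (by simpa using hy)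

/-- The mean of the cost `d` under the vector `p` of probabilities. -/
def meanCost (d : α → ℝ≥0∞) (p : α → ℝ) : ℝ≥0∞ := ∑ τ, ENNReal.ofReal (p τ) * d τ

variable {d : α → α → ℝ≥0∞} {c : ℝ≥0∞} {μ ν₁ ν₂ : α → ℝ} {x : α → ι} {Θ : ι → ι → α ≃ α}

lemma meanCost_le_add (htri : ∀ σ τ ρ, d σ ρ ≤ d σ τ + d τ ρ) {p : α → ℝ}
    (hp : p ∈ stdSimplex ℝ α) (σ τ : α) : meanCost (d σ) p ≤ d σ τ + meanCost (d τ) p := by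
  have hone : ∑ ρ, ENNReal.ofReal (p ρ) = 1 := by
    rw [← ENNReal.ofReal_sum_of_nonneg fun ρ _ ↦ hp.1 ρ, hp.2, ENNReal.ofReal_one]
  calc meanCost (d σ) p ≤ ∑ ρ, ENNReal.ofReal (p ρ) * (d σ τ + d τ ρ) := by
        unfold meanCost
        gcongr
        exact htri _ _ _
    _ = d σ τ + meanCost (d τ) p := by
        simp only [mul_add, sum_add_distrib, ← sum_mul, hone, one_mul, meanCost]

variable [Fintype ι]

lemma meanCost_sum_mul_le {d : α → ℝ≥0∞} {w : ι → ℝ} (hw : 0 ≤ w) {P : ι → α → ℝ}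
    (hP : ∀ k, 0 ≤ P k) {u : ι → ℝ} (hu : 0 ≤ u)
    (h : ∀ k, w k ≠ 0 → meanCost d (P k) ≤ c * ENNReal.ofReal (u k)) :
    meanCost d (fun τ ↦ ∑ k, w k * P k τ) ≤ c * ENNReal.ofReal (∑ k, w k * u k) := by
  calc meanCost d (fun τ ↦ ∑ k, w k * P k τ)
      = ∑ k, ENNReal.ofReal (w k) * meanCost d (P k) := by
        simp only [meanCost, mul_sum]
        rw [sum_comm]
        refine sum_congr rfl fun τ _ ↦ ?_
        rw [ENNReal.ofReal_sum_of_nonneg fun k _ ↦ mul_nonneg (hw k) (hP k τ), sum_mul]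
        simp only [ENNReal.ofReal_mul (hw _), mul_assoc]
    _ ≤ ∑ k, ENNReal.ofReal (w k) * (c * ENNReal.ofReal (u k)) := by
        refine sum_le_sum fun k _ ↦ ?_
        by_cases hk : w k = 0
        · simp [hk]
        · gcongr
          exact h k hk
    _ = c * ENNReal.ofReal (∑ k, w k * u k) := by
        rw [ENNReal.ofReal_sum_of_nonneg fun k _ ↦ mul_nonneg (hw k) (hu k), mul_sum]
        simp only [ENNReal.ofReal_mul (hw _), mul_left_comm]

variable [DecidableEq ι] {q : Matrix ι ι ℝ}

lemma sum_mul_ite_ne (hq : q ∈ Matrix.rowStochastic ℝ ι) (i : ι) (z : ℝ) :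
    ∑ k, q i k * (if k = i then 0 else z) = (1 - q i i) * z := by
  rw [← Matrix.sum_row_of_mem_rowStochastic hq i, ← add_sum_erase univ (q i) (mem_univ i),
    add_sub_cancel_left, ← add_sum_erase univ _ (mem_univ i), if_pos rfl, mul_zero, zero_add,
    sum_mul]
  exact sum_congr rfl fun k hk ↦ by rw [if_neg (ne_of_mem_erase hk)]

/-- The bound for the cost of `glue x Θ q P` from `σ`, if `v i k` bounds the cost of `P i k`: a
change of label costs `1`. -/
def glueCost (x : α → ι) (Θ : ι → ι → α ≃ α) (q : Matrix ι ι ℝ) (v : ι → ι → α → ℝ) (σ : α) : ℝ :=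
  ∑ k, q (x σ) k * v (x σ) k (Θ (x σ) k σ) + (1 - q (x σ) (x σ))

variable {v : ι → ι → α → ℝ} {K a b : ℝ}

lemma meanCost_glue_le [DecidableEq α] (hd : ∀ σ, d σ σ = 0)
    (htri : ∀ σ τ ρ, d σ ρ ≤ d σ τ + d τ ρ) (hq : q ∈ Matrix.rowStochastic ℝ ι)
    {P : ι → ι → Matrix α α ℝ} (hP : ∀ i k, P i k ∈ Matrix.rowStochastic ℝ α)
    (hv : ∀ i k, 0 ≤ v i k) (hrefl : ∀ i, Θ i i = Equiv.refl α) {σ : α}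
    (hcost : ∀ k, q (x σ) k ≠ 0 → x σ ≠ k → d σ (Θ (x σ) k σ) ≤ c)
    (hPcost : ∀ k, q (x σ) k ≠ 0 → meanCost (d (Θ (x σ) k σ)) (P (x σ) k (Θ (x σ) k σ)) ≤
      c * ENNReal.ofReal (v (x σ) k (Θ (x σ) k σ))) :
    meanCost (d σ) (glue x Θ q P σ) ≤ c * ENNReal.ofReal (glueCost x Θ q v σ) := by
  have hrow (k : ι) (τ : α) : P (x σ) k τ ∈ stdSimplex ℝ α :=
    ⟨(hP _ k).1 τ, Matrix.sum_row_of_mem_rowStochastic (hP _ k) τ⟩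
  have hone (k : ι) : (0 : ℝ) ≤ if k = x σ then 0 else 1 := by positivity
  have hglue : glueCost x Θ q v σ =
      ∑ k, q (x σ) k * ((if k = x σ then 0 else 1) + v (x σ) k (Θ (x σ) k σ)) := by
    simp only [glueCost, mul_add, sum_add_distrib, sum_mul_ite_ne hq]
    ring
  rw [hglue]
  refine meanCost_sum_mul_le (hq.1 _) (fun k ↦ (hrow k _).1)
    (fun k ↦ add_nonneg (hone k) (hv _ _ _)) fun k hk ↦ ?_
  refine (meanCost_le_add htri (hrow k _) σ (Θ (x σ) k σ)).trans ?_
  rw [ENNReal.ofReal_add (hone k) (hv _ _ _), mul_add]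
  refine add_le_add ?_ (hPcost k hk)
  split_ifs with h
  · simp [h, hrefl, hd]
  · simpa using hcost k hk (Ne.symm h)

lemma sum_mul_sum_shift_le (h₁ : 0 ≤ ν₁) (hq : q ∈ Matrix.rowStochastic ℝ ι)
    {f : ι → ι → α → ℝ} {A : ι → ι → ℝ} (hf : ∀ i k, label x ν₁ i ≠ 0 → q i k ≠ 0 →
      ∑ σ, shiftCond x Θ ν₁ i k σ * f i k σ ≤ A i k) :
    ∑ σ, ν₁ σ * ∑ k, q (x σ) k * f (x σ) k (Θ (x σ) k σ) ≤
      ∑ i, ∑ k, label x ν₁ i * q i k * A i k := by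
  rw [sum_mul_sum_shift h₁]
  refine sum_le_sum fun i _ ↦ sum_le_sum fun k _ ↦ ?_
  by_cases hi : label x ν₁ i = 0
  · simp [hi]
  by_cases hk : q i k = 0
  · simp [hk]
  exact mul_le_mul_of_nonneg_left (hf i k hi hk) (mul_nonneg (label_nonneg h₁ i) (hq.1 i k))

lemma sq_sum_mul_sum_shift_le (h₁ : ν₁ ∈ stdSimplex ℝ α) (hq : q ∈ Matrix.rowStochastic ℝ ι)
    {f : ι → ι → α → ℝ} {A : ι → ι → ℝ} (hf : ∀ i k, label x ν₁ i ≠ 0 → q i k ≠ 0 →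
      (∑ σ, shiftCond x Θ ν₁ i k σ * f i k σ) ^ 2 ≤ A i k) :
    (∑ σ, ν₁ σ * ∑ k, q (x σ) k * f (x σ) k (Θ (x σ) k σ)) ^ 2 ≤
      ∑ i, ∑ k, label x ν₁ i * q i k * A i k := by
  rw [sum_mul_sum_shift h₁.1]
  simp only [mul_assoc, ← mul_sum]
  refine (sq_sum_mul_le (label_mem_stdSimplex h₁) _).trans (sum_le_sum fun i _ ↦ ?_)
  by_cases hi : label x ν₁ i = 0
  · simp [hi]
  refine mul_le_mul_of_nonneg_left ?_ (label_nonneg h₁.1 i)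
  refine (sq_sum_mul_le ⟨hq.1 i, Matrix.sum_row_of_mem_rowStochastic hq i⟩ _).trans
    (sum_le_sum fun k _ ↦ ?_)
  by_cases hk : q i k = 0
  · simp [hk]
  exact mul_le_mul_of_nonneg_left (hf i k hi hk) (hq.1 i k)

/-- The transport `p` from `ν₁` to `ν₂` costs at most `c * v σ` from `σ`, and `E` controls the first
two moments of `v` under `ν₁`. -/
structure IsCostTransport [DecidableEq α] (d : α → α → ℝ≥0∞) (c : ℝ≥0∞) (E : ℝ) (ν₁ ν₂ : α → ℝ)
    (p : Matrix α α ℝ) (v : α → ℝ) : Prop where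
  isTransport : IsTransport p ν₁ ν₂
  nonneg : 0 ≤ v
  meanCost_le : ∀ σ, ν₁ σ ≠ 0 → meanCost (d σ) (p σ) ≤ c * ENNReal.ofReal (v σ)
  sum_mul_sq_le : ∑ σ, ν₁ σ * v σ ^ 2 ≤ 2 * E
  sq_sum_mul_le : (∑ σ, ν₁ σ * v σ) ^ 2 ≤ E / 2

lemma sum_mul_sq_glueCost_le (hab : a.HolderConjugate b) (h₁ : ν₁ ∈ stdSimplex ℝ α)
    (h₂ : ν₂ ∈ stdSimplex ℝ α) (hμ : 0 ≤ μ) (hac₁ : ν₁.support ⊆ μ.support)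
    (hac₂ : ν₂.support ⊆ μ.support) (hΘ : ShiftCompatible x Θ μ)
    (hq : q = maximalCoupling (label x ν₁) (label x ν₂)) (hK : 0 ≤ K)
    (hrec : ∀ i k, label x ν₁ i ≠ 0 → q i k ≠ 0 → ∑ σ, shiftCond x Θ ν₁ i k σ * v i k σ ^ 2 ≤
      2 * (K * entSum a b (shiftCond x Θ ν₁ i k) (fiberCond x ν₂ k) (fiberPart x μ k))) :
    ∑ σ, ν₁ σ * glueCost x Θ q v σ ^ 2 ≤ 2 * ((K + 1) * entSum a b ν₁ ν₂ μ) := by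
  have hl₁ := label_mem_stdSimplex (x := x) h₁
  have hl₂ := label_mem_stdSimplex (x := x) h₂
  have hqt : IsTransport q _ _ := hq ▸ isTransport_maximalCoupling hl₁ hl₂
  have hX := sum_mul_entSum_nonneg hab h₁ h₂ hμ hac₁ hac₂ hΘ hqt
  have hlabel : ∑ σ, ν₁ σ * (1 - q (x σ) (x σ)) ^ 2 ≤
      2 * entSum a b (label x ν₁) (label x ν₂) (label x μ) := by
    rw [sum_mul_comp_label fun i ↦ (1 - q i i) ^ 2, hq]
    exact sum_mul_one_sub_maximalCoupling_sq_le hab hl₁ hl₂ (label_nonneg hμ)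
      (support_label_subset hμ hac₁) (support_label_subset hμ hac₂)
  have hfiber : ∑ σ, ν₁ σ * (∑ k, q (x σ) k * v (x σ) k (Θ (x σ) k σ)) ^ 2 ≤
      K * (2 * ∑ i, ∑ k, label x ν₁ i * q i k *
        entSum a b (shiftCond x Θ ν₁ i k) (fiberCond x ν₂ k) (fiberPart x μ k)) := by
    calc _ ≤ ∑ σ, ν₁ σ * ∑ k, q (x σ) k * v (x σ) k (Θ (x σ) k σ) ^ 2 :=
          sum_le_sum fun σ _ ↦
            mul_le_mul_of_nonneg_left (sq_sum_mul_le (hqt.row_mem_stdSimplex _) _) (h₁.1 σ)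
      _ ≤ _ := sum_mul_sum_shift_le (f := fun i k σ ↦ v i k σ ^ 2) h₁.1 hqt.1 hrec
      _ = _ := by
          simp only [mul_sum]
          refine sum_congr rfl fun i _ ↦ sum_congr rfl fun k _ ↦ by ring
  refine (sum_mul_add_sq_le h₁.1 hK (by positivity) hfiber hlabel).trans_eq ?_
  rw [← entSum_label_add_eq a b h₁.1 h₂.1 hμ hac₁ hac₂ hΘ hqt]
  ring

lemma sq_sum_mul_glueCost_le (hab : a.HolderConjugate b) (h₁ : ν₁ ∈ stdSimplex ℝ α)
    (h₂ : ν₂ ∈ stdSimplex ℝ α) (hμ : 0 ≤ μ) (hac₁ : ν₁.support ⊆ μ.support)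
    (hac₂ : ν₂.support ⊆ μ.support) (hΘ : ShiftCompatible x Θ μ)
    (hq : q = maximalCoupling (label x ν₁) (label x ν₂)) (hK : 0 ≤ K)
    (hrec : ∀ i k, label x ν₁ i ≠ 0 → q i k ≠ 0 → (∑ σ, shiftCond x Θ ν₁ i k σ * v i k σ) ^ 2 ≤
      K * entSum a b (shiftCond x Θ ν₁ i k) (fiberCond x ν₂ k) (fiberPart x μ k) / 2) :
    (∑ σ, ν₁ σ * glueCost x Θ q v σ) ^ 2 ≤ (K + 1) * entSum a b ν₁ ν₂ μ / 2 := by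
  have hl₁ := label_mem_stdSimplex (x := x) h₁
  have hl₂ := label_mem_stdSimplex (x := x) h₂
  have hqt : IsTransport q _ _ := hq ▸ isTransport_maximalCoupling hl₁ hl₂
  have hX := sum_mul_entSum_nonneg hab h₁ h₂ hμ hac₁ hac₂ hΘ hqt
  have hlabel : (∑ σ, ν₁ σ * (1 - q (x σ) (x σ))) ^ 2 ≤
      entSum a b (label x ν₁) (label x ν₂) (label x μ) / 2 := by
    rw [sum_mul_comp_label fun i ↦ 1 - q i i, hq]
    exact sq_sum_mul_one_sub_maximalCoupling_le hab hl₁ hl₂ (label_nonneg hμ)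
      (support_label_subset hμ hac₁) (support_label_subset hμ hac₂)
  have hfiber : (∑ σ, ν₁ σ * ∑ k, q (x σ) k * v (x σ) k (Θ (x σ) k σ)) ^ 2 ≤
      K * ((∑ i, ∑ k, label x ν₁ i * q i k *
        entSum a b (shiftCond x Θ ν₁ i k) (fiberCond x ν₂ k) (fiberPart x μ k)) / 2) := by
    refine (sq_sum_mul_sum_shift_le h₁ hqt.1 hrec).trans_eq ?_
    simp only [sum_div, mul_sum]
    exact sum_congr rfl fun i _ ↦ sum_congr rfl fun k _ ↦ by ring
  simp only [glueCost, mul_add, sum_add_distrib]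
  refine (add_sq_le_of_sq_le hK (by positivity) hfiber hlabel).trans_eq ?_
  rw [← entSum_label_add_eq a b h₁.1 h₂.1 hμ hac₁ hac₂ hΘ hqt]
  ring

lemma IsCostTransport.glue [DecidableEq α] (hd : ∀ σ, d σ σ = 0)
    (htri : ∀ σ τ ρ, d σ ρ ≤ d σ τ + d τ ρ) (hab : a.HolderConjugate b)
    (h₁ : ν₁ ∈ stdSimplex ℝ α) (h₂ : ν₂ ∈ stdSimplex ℝ α) (hμ : 0 ≤ μ)
    (hac₁ : ν₁.support ⊆ μ.support) (hac₂ : ν₂.support ⊆ μ.support)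
    (hΘ : ShiftCompatible x Θ μ) (hrefl : ∀ i, Θ i i = Equiv.refl α)
    (hcost : ∀ i k, i ≠ k → label x μ i ≠ 0 → label x μ k ≠ 0 → ∀ σ, d σ (Θ i k σ) ≤ c)
    (hq : q = maximalCoupling (label x ν₁) (label x ν₂)) {P : ι → ι → Matrix α α ℝ}
    (hP : ∀ i k, P i k ∈ Matrix.rowStochastic ℝ α) (hv : ∀ i k, 0 ≤ v i k) (hK : 0 ≤ K)
    (hrec : ∀ i k, label x ν₁ i ≠ 0 → q i k ≠ 0 → IsCostTransport d c
      (K * entSum a b (shiftCond x Θ ν₁ i k) (fiberCond x ν₂ k) (fiberPart x μ k))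
      (shiftCond x Θ ν₁ i k) (fiberCond x ν₂ k) (P i k) (v i k)) :
    IsCostTransport d c ((K + 1) * entSum a b ν₁ ν₂ μ) ν₁ ν₂ (glue x Θ q P)
      (glueCost x Θ q v) := by
  have hqt : IsTransport q (label x ν₁) (label x ν₂) :=
    hq ▸ isTransport_maximalCoupling (label_mem_stdSimplex h₁) (label_mem_stdSimplex h₂)
  refine ⟨isTransport_glue h₁.1 h₂.1 hqt hP fun i k hi hk ↦ (hrec i k hi hk).isTransport,
    fun σ ↦ ?_, fun σ hσ ↦ ?_,
    sum_mul_sq_glueCost_le hab h₁ h₂ hμ hac₁ hac₂ hΘ hq hK fun i k hi hk ↦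
      (hrec i k hi hk).sum_mul_sq_le,
    sq_sum_mul_glueCost_le hab h₁ h₂ hμ hac₁ hac₂ hΘ hq hK fun i k hi hk ↦
      (hrec i k hi hk).sq_sum_mul_le⟩
  · exact add_nonneg (sum_nonneg fun k _ ↦ mul_nonneg (hqt.nonneg _ k) (hv _ k _))
      (sub_nonneg.2 (hqt.apply_self_le_one _))
  · have hi : label x ν₁ (x σ) ≠ 0 := label_ne_zero h₁.1 hσ
    exact meanCost_glue_le hd htri hqt.1 hP hv hrefl
      (fun k hk hne ↦ hcost _ k hne (support_label_subset hμ hac₁ hi)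
        (support_label_subset hμ hac₂ (hqt.apply_ne_zero (label_nonneg h₁.1) hi hk)) σ)
      fun k hk ↦ (hrec _ k hi hk).meanCost_le _ (shiftCond_apply_ne_zero h₁.1 hσ k)

end GlueCost

section ShiftTower

variable {α ι : Type*} [Fintype α] {d : α → α → ℝ≥0∞} {c : ℝ≥0∞} {μ ν₁ ν₂ : α → ℝ} {a b : ℝ}

/-- The weight `μ` can be disintegrated `K` times, until all of its mass is at one point, in such a
way that the fibres of each step are shifts of each other at a cost of at most `c`. -/
inductive ShiftTower (ι : Type*) (d : α → α → ℝ≥0∞) (c : ℝ≥0∞) : ℕ → (α → ℝ) → Prop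
  | of_subsingleton {μ : α → ℝ} (h : μ.support.Subsingleton) : ShiftTower ι d c 0 μ
  | step {K : ℕ} {μ : α → ℝ} (x : α → ι) (Θ : ι → ι → α ≃ α) (hΘ : ShiftCompatible x Θ μ)
      (hrefl : ∀ i, Θ i i = Equiv.refl α)
      (hcost : ∀ i k, i ≠ k → label x μ i ≠ 0 → label x μ k ≠ 0 → ∀ σ, d σ (Θ i k σ) ≤ c)
      (hfiber : ∀ k, label x μ k ≠ 0 → ShiftTower ι d c K (fiberPart x μ k)) :
      ShiftTower ι d c (K + 1) μ

lemma eq_of_support_subsingleton (h₁ : ν₁ ∈ stdSimplex ℝ α) (h₂ : ν₂ ∈ stdSimplex ℝ α)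
    (hac₁ : ν₁.support ⊆ μ.support) (hac₂ : ν₂.support ⊆ μ.support)
    (hμ : μ.support.Subsingleton) : ν₁ = ν₂ := by
  obtain ⟨ρ, -, hρ⟩ := exists_ne_zero_of_sum_ne_zero (h₁.2.trans_ne one_ne_zero)
  have hzero {ν : α → ℝ} (hac : ν.support ⊆ μ.support) {σ : α} (hσ : σ ≠ ρ) : ν σ = 0 :=
    of_not_not fun h ↦ hσ (hμ (hac h) (hac₁ hρ))
  have hval {ν : α → ℝ} (h : ν ∈ stdSimplex ℝ α) (hac : ν.support ⊆ μ.support) : ν ρ = 1 :=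
    (Fintype.sum_eq_single ρ fun σ hσ ↦ hzero hac hσ).symm.trans h.2
  funext σ
  by_cases hσ : σ = ρ
  · rw [hσ, hval h₁ hac₁, hval h₂ hac₂]
  · rw [hzero hac₁ hσ, hzero hac₂ hσ]

lemma meanCost_one [DecidableEq α] (hd : ∀ σ, d σ σ = 0) (σ : α) :
    meanCost (d σ) ((1 : Matrix α α ℝ) σ) = 0 :=
  sum_eq_zero fun τ _ ↦ by
    by_cases h : σ = τ
    · rw [← h, hd, mul_zero]
    · rw [Matrix.one_apply_ne h, ENNReal.ofReal_zero, zero_mul]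

lemma ShiftTower.exists_isCostTransport [DecidableEq α] [Finite ι] (hd : ∀ σ, d σ σ = 0)
    (htri : ∀ σ τ ρ, d σ ρ ≤ d σ τ + d τ ρ) (hab : a.HolderConjugate b) {K : ℕ} {μ : α → ℝ}
    (hT : ShiftTower ι d c K μ) (hμ : 0 ≤ μ) {ν₁ ν₂ : α → ℝ}
    (h₁ : ν₁ ∈ stdSimplex ℝ α) (h₂ : ν₂ ∈ stdSimplex ℝ α) (hac₁ : ν₁.support ⊆ μ.support)
    (hac₂ : ν₂.support ⊆ μ.support) :
    ∃ p v, IsCostTransport d c (K * entSum a b ν₁ ν₂ μ) ν₁ ν₂ p v := by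
  classical
  have := Fintype.ofFinite ι
  induction hT generalizing ν₁ ν₂ with
  | of_subsingleton h =>
    obtain rfl := eq_of_support_subsingleton h₁ h₂ hac₁ hac₂ h
    exact ⟨1, 0, isTransport_one _, le_rfl, fun σ _ ↦ (meanCost_one hd σ).trans_le zero_le,
      by simp, by simp⟩
  | @step K μ x Θ hΘ hrefl hcost _ ih =>
    set q := maximalCoupling (label x ν₁) (label x ν₂) with hq
    have hqt : IsTransport q (label x ν₁) (label x ν₂) :=
      isTransport_maximalCoupling (label_mem_stdSimplex h₁) (label_mem_stdSimplex h₂)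
    have hrec (i k : ι) : ∃ (P : Matrix α α ℝ) (v : α → ℝ), P ∈ Matrix.rowStochastic ℝ α ∧ 0 ≤ v ∧
        (label x ν₁ i ≠ 0 → q i k ≠ 0 → IsCostTransport d c
          (K * entSum a b (shiftCond x Θ ν₁ i k) (fiberCond x ν₂ k) (fiberPart x μ k))
          (shiftCond x Θ ν₁ i k) (fiberCond x ν₂ k) P v) := by
      by_cases hik : label x ν₁ i ≠ 0 ∧ q i k ≠ 0
      · obtain ⟨hi, hk⟩ := hik
        have hk₂ := hqt.apply_ne_zero (label_nonneg h₁.1) hi hk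
        have hkμ := support_label_subset hμ hac₂ hk₂
        obtain ⟨P, v, hP⟩ := ih k hkμ (fiberPart_nonneg hμ k)
          (shiftCond_mem_stdSimplex h₁.1 hi k) (fiberCond_mem_stdSimplex h₂.1 hk₂)
          (support_shiftCond_subset hΘ hac₁ (support_label_subset hμ hac₁ hi) hkμ)
          (support_fiberCond_subset hac₂ k)
        exact ⟨P, v, hP.isTransport.1, hP.nonneg, fun _ _ ↦ hP⟩
      · exact ⟨1, 0, one_mem _, le_rfl, fun hi hk ↦ absurd ⟨hi, hk⟩ hik⟩
    choose P v hP hv hrec using hrec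
    rw [Nat.cast_add_one]
    exact ⟨_, _, .glue hd htri hab h₁ h₂ hμ hac₁ hac₂ hΘ hrefl hcost hq hP hv
      (Nat.cast_nonneg K) hrec⟩

end ShiftTower

section FiberShift

variable {Γ Ω : Type*} [Group Γ] [MulAction Γ Ω] {J : Finset Ω} {j : Ω} {μ : Γ → ℝ}
  {ρ ρ' σ σ₁ σ₂ τ : Γ} {Q Q' : Γ → Prop}

/-- The values in `J` have the same positions in `σ` and in `τ`, where the position of the value `k`
in `σ` is the point `σ⁻¹ • k` that `σ` maps to `k`. -/
def Agree (J : Finset Ω) (σ τ : Γ) : Prop := ∀ k ∈ J, σ⁻¹ • k = τ⁻¹ • k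

lemma Agree.symm (h : Agree J σ τ) : Agree J τ σ := fun k hk ↦ (h k hk).symm

lemma Agree.trans (h : Agree J ρ σ) (h' : Agree J σ τ) : Agree J ρ τ :=
  fun k hk ↦ (h k hk).trans (h' k hk)

lemma agree_mul_right_iff (θ : Γ) : Agree J (σ * θ) (τ * θ) ↔ Agree J σ τ := by
  simp only [Agree, mul_inv_rev, mul_smul, smul_left_cancel_iff]

lemma Agree.mul_right_iff {θ : Γ} (h : Agree J (σ₁ * θ) σ₂) :
    Agree J (σ * θ) σ₂ ↔ Agree J σ σ₁ :=
  ⟨fun h' ↦ (agree_mul_right_iff θ).1 (h'.trans h.symm),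
    fun h' ↦ ((agree_mul_right_iff θ).2 h').trans h⟩

/-- The restriction of `μ` to `{σ | Agree J σ ρ}`. -/
def restr (μ : Γ → ℝ) (J : Finset Ω) (ρ : Γ) : Γ → ℝ := {σ | Agree J σ ρ}.indicator μ

lemma restr_ne_zero_iff : restr μ J ρ σ ≠ 0 ↔ Agree J σ ρ ∧ μ σ ≠ 0 :=
  Set.indicator_apply_ne_zero

lemma restr_apply_of_agree (h : Agree J σ ρ) : restr μ J ρ σ = μ σ := Set.indicator_of_mem h μ

lemma restr_apply_of_not_agree (h : ¬Agree J σ ρ) : restr μ J ρ σ = 0 :=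
  Set.indicator_of_notMem h μ

lemma restr_nonneg (hμ : 0 ≤ μ) (J : Finset Ω) (ρ : Γ) : 0 ≤ restr μ J ρ :=
  Set.indicator_nonneg fun σ _ ↦ hμ σ

lemma Agree.restr_eq (h : Agree J ρ ρ') : restr μ J ρ = restr μ J ρ' :=
  congrArg (Set.indicator · μ) (Set.ext fun _ ↦ ⟨fun h' ↦ h'.trans h, fun h' ↦ h'.trans h.symm⟩)

lemma restr_empty (μ : Γ → ℝ) (ρ : Γ) : restr μ (∅ : Finset Ω) ρ = μ :=
  funext fun _ ↦ restr_apply_of_agree fun k hk ↦ absurd hk (notMem_empty k)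

lemma Agree.eq [Fintype Ω] [FaithfulSMul Γ Ω] (h : Agree (univ : Finset Ω) σ τ) : σ = τ :=
  inv_injective (FaithfulSMul.eq_of_smul_eq_smul fun k ↦ h k (mem_univ k))

lemma support_restr_univ_subsingleton [Fintype Ω] [FaithfulSMul Γ Ω] (μ : Γ → ℝ) (ρ : Γ) :
    (restr μ (univ : Finset Ω) ρ).support.Subsingleton := fun _ hσ _ hτ ↦
  ((restr_ne_zero_iff.1 hσ).1.trans (restr_ne_zero_iff.1 hτ).1.symm).eq

lemma restr_mul_right {θ : Γ} {κ : ℝ} (hθ : Agree J (σ₁ * θ) σ₂)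
    (hμ : ∀ σ, Agree J σ σ₁ → μ (σ * θ) = κ * μ σ) (σ : Γ) :
    restr μ J σ₂ (σ * θ) = κ * restr μ J σ₁ σ := by
  by_cases hσ : Agree J σ σ₁
  · rw [restr_apply_of_agree hσ, restr_apply_of_agree (hθ.mul_right_iff.2 hσ), hμ σ hσ]
  · rw [restr_apply_of_not_agree hσ, restr_apply_of_not_agree (mt hθ.mul_right_iff.1 hσ), mul_zero]

lemma exists_agree_of_label_ne_zero [Fintype Γ] {k : Ω}
    (h : label (·⁻¹ • j) (restr μ J ρ) k ≠ 0) : ∃ ρ', Agree J ρ' ρ ∧ ρ'⁻¹ • j = k :=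
  let ⟨ρ', hk, hρ'⟩ := exists_of_label_ne_zero h
  ⟨ρ', (restr_ne_zero_iff.1 hρ').1, hk⟩

variable [DecidableEq Ω]

lemma agree_insert : Agree (insert j J) σ τ ↔ σ⁻¹ • j = τ⁻¹ • j ∧ Agree J σ τ :=
  forall_mem_insert ..

lemma restr_inv (μ : Γ → ℝ) (J : Finset Ω) (ρ : Γ) :
    restr (μ ∘ Equiv.inv Γ) (J.image (ρ⁻¹ • ·)) ρ⁻¹ = restr μ J ρ ∘ Equiv.inv Γ := by
  refine (congrArg (Set.indicator · _) (Set.ext fun σ ↦ ?_)).trans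
    (funext fun _ ↦ Set.indicator_comp_right _)
  refine forall_mem_image.trans (forall₂_congr fun k _ ↦ ?_)
  rw [Equiv.inv_apply, inv_inv, smul_inv_smul, inv_inv, inv_smul_eq_iff, eq_comm]

lemma fiberPart_restr (μ : Γ → ℝ) (j : Ω) (h : Agree J ρ' ρ) :
    fiberPart (·⁻¹ • j) (restr μ J ρ) (ρ'⁻¹ • j) = restr μ (insert j J) ρ' := by
  rw [← h.restr_eq, fiberPart, restr, Set.indicator_indicator, restr]
  exact congrArg (Set.indicator · μ) (Set.ext fun σ ↦ agree_insert.symm)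

/-- Among the `σ` at which the positions of the values in `J` are given, the fibres of `μ` over two
positions of the value `j` are, up to a factor, right translates of each other by some `θ` with
`Q θ`. -/
def FiberShift (Q : Γ → Prop) (μ : Γ → ℝ) (J : Finset Ω) (j : Ω) : Prop :=
  ∀ σ₁ σ₂ : Γ, Agree J σ₁ σ₂ → μ σ₁ ≠ 0 → μ σ₂ ≠ 0 →
    ∃ θ : Γ, Q θ ∧ Agree (insert j J) (σ₁ * θ) σ₂ ∧
      ∃ κ : ℝ, 0 < κ ∧ ∀ σ, Agree (insert j J) σ σ₁ → μ (σ * θ) = κ * μ σ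

lemma FiberShift.mono (h : FiberShift Q μ J j) (hQ : ∀ θ, Q θ → Q' θ) : FiberShift Q' μ J j :=
  fun σ₁ σ₂ hag h₁ h₂ ↦ (h σ₁ σ₂ hag h₁ h₂).imp fun _ ↦ And.imp_left (hQ _)

variable [Fintype Γ]

lemma FiberShift.exists_translation (h : FiberShift Q μ J j) (ρ : Γ) {i k : Ω}
    (hi : label (·⁻¹ • j) (restr μ J ρ) i ≠ 0) (hk : label (·⁻¹ • j) (restr μ J ρ) k ≠ 0) :
    ∃ θ : Γ, (Q θ ∧ θ • k = i ∧ ∀ l ∈ J, θ • ρ⁻¹ • l = ρ⁻¹ • l) ∧ ∃ κ : ℝ, 0 < κ ∧ ∀ σ,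
      fiberPart (·⁻¹ • j) (restr μ J ρ) k (σ * θ) =
        κ * fiberPart (·⁻¹ • j) (restr μ J ρ) i σ := by
  obtain ⟨σ₁, rfl, hσ₁⟩ := exists_of_label_ne_zero hi
  obtain ⟨σ₂, rfl, hσ₂⟩ := exists_of_label_ne_zero hk
  obtain ⟨hρ₁, hμ₁⟩ := restr_ne_zero_iff.1 hσ₁
  obtain ⟨hρ₂, hμ₂⟩ := restr_ne_zero_iff.1 hσ₂
  obtain ⟨θ, hQ, hθ, κ, hκ, hμ⟩ := h σ₁ σ₂ (hρ₁.trans hρ₂.symm) hμ₁ hμ₂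
  obtain ⟨hj, hJ⟩ := agree_insert.1 hθ
  refine ⟨θ, ⟨hQ, ?_, fun l hl ↦ ?_⟩, κ, hκ, ?_⟩
  · simp only [← hj, mul_inv_rev, mul_smul, smul_inv_smul]
  · have hl' := hJ l hl
    rw [mul_inv_rev, mul_smul, hρ₁ l hl, hρ₂ l hl, inv_smul_eq_iff] at hl'
    exact hl'.symm
  · simp only [fiberPart_restr μ j hρ₁, fiberPart_restr μ j hρ₂]
    exact restr_mul_right hθ hμ

lemma FiberShift.exists_shift (h : FiberShift Q μ J j) (ρ : Γ) :
    ∃ θ : Ω → Ω → Γ, (∀ i, θ i i = 1) ∧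
      ShiftCompatible (·⁻¹ • j) (fun i k ↦ Equiv.mulRight (θ i k)) (restr μ J ρ) ∧
      ∀ i k, i ≠ k → label (·⁻¹ • j) (restr μ J ρ) i ≠ 0 →
        label (·⁻¹ • j) (restr μ J ρ) k ≠ 0 →
          Q (θ i k) ∧ θ i k • k = i ∧ ∀ l ∈ J, θ i k • ρ⁻¹ • l = ρ⁻¹ • l := by
  have htranslation (i k : Ω) : ∃ θ : Γ, (i = k → θ = 1) ∧ (i ≠ k →
      label (·⁻¹ • j) (restr μ J ρ) i ≠ 0 → label (·⁻¹ • j) (restr μ J ρ) k ≠ 0 →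
        (Q θ ∧ θ • k = i ∧ ∀ l ∈ J, θ • ρ⁻¹ • l = ρ⁻¹ • l) ∧ ∃ κ : ℝ, 0 < κ ∧ ∀ σ,
          fiberPart (·⁻¹ • j) (restr μ J ρ) k (σ * θ) =
            κ * fiberPart (·⁻¹ • j) (restr μ J ρ) i σ) := by
    by_cases hik : i ≠ k ∧ label (·⁻¹ • j) (restr μ J ρ) i ≠ 0 ∧
        label (·⁻¹ • j) (restr μ J ρ) k ≠ 0
    · obtain ⟨hne, hi, hk⟩ := hik
      obtain ⟨θ, hθ⟩ := h.exists_translation ρ hi hk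
      exact ⟨θ, fun hik ↦ absurd hik hne, fun _ _ _ ↦ hθ⟩
    · exact ⟨1, fun _ ↦ rfl, fun hne hi hk ↦ absurd ⟨hne, hi, hk⟩ hik⟩
  choose θ hone hθ using htranslation
  refine ⟨θ, fun i ↦ hone i i rfl, fun i k hi hk ↦ ?_, fun i k hne hi hk ↦ (hθ i k hne hi hk).1⟩
  obtain rfl | hne := eq_or_ne i k
  · exact ⟨1, one_pos, fun σ ↦ by simp [hone]⟩
  · exact (hθ i k hne hi hk).2

lemma FiberShift.shiftTower_step {d : Γ → Γ → ℝ≥0∞} {c : ℝ≥0∞} {K : ℕ}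
    (h : FiberShift (fun θ ↦ ∀ σ, d σ (σ * θ) ≤ c) μ J j)
    (hT : ∀ ρ, ShiftTower Ω d c K (restr μ (insert j J) ρ)) (ρ : Γ) :
    ShiftTower Ω d c (K + 1) (restr μ J ρ) := by
  obtain ⟨θ, hone, hΘ, hθ⟩ := h.exists_shift ρ
  refine .step _ _ hΘ (fun i ↦ by rw [hone]; exact Equiv.ext mul_one)
    (fun i k hne hi hk ↦ (hθ i k hne hi hk).1) fun k hk ↦ ?_
  obtain ⟨ρ', hρ', rfl⟩ := exists_agree_of_label_ne_zero hk
  exact (fiberPart_restr μ j hρ').symm ▸ hT ρ'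

end FiberShift

section TailStab

variable {n : ℕ} {G : Subgroup (Equiv.Perm (Fin n))}

lemma inv_smul_eq_of_orb_eq {j : Fin n} (h : orb G j = {j}) {σ τ : G} (hag : Agree (Ioi j) σ τ) :
    σ⁻¹ • j = τ⁻¹ • j := by
  have hmem : ((σ * τ⁻¹ : G) : Equiv.Perm (Fin n)) ∈ tailStab G j :=
    ⟨(σ * τ⁻¹).2, fun k hk ↦ by
      change σ • τ⁻¹ • k = k
      rw [← hag k (mem_Ioi.2 hk), smul_inv_smul]⟩
  have horb : σ • τ⁻¹ • j ∈ orb G j := ⟨_, hmem, rfl⟩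
  rw [h, Set.mem_singleton_iff] at horb
  rw [inv_smul_eq_iff, horb]

lemma restr_insert_of_orb_eq {j : Fin n} (h : orb G j = {j}) (μ : G → ℝ) (ρ : G) :
    restr μ (insert j (Ioi j)) ρ = restr μ (Ioi j) ρ :=
  congrArg (Set.indicator · μ) <| Set.ext fun _ ↦
    agree_insert.trans (and_iff_right_of_imp (inv_smul_eq_of_orb_eq h))

open Classical in
lemma shiftTower_restr [Fintype G] {d : G → G → ℝ≥0∞} {c : ℝ≥0∞} {μ : G → ℝ}
    (h : ∀ j : Fin n, FiberShift (fun θ ↦ ∀ σ, d σ (σ * θ) ≤ c) μ (Ioi j) j) {S : Finset (Fin n)}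
    (hS : IsLowerSet (S : Set (Fin n))) (ρ : G) :
    ShiftTower (Fin n) d c #{j ∈ S | orb G j ≠ {j}} (restr μ Sᶜ ρ) := by
  induction S using induction_on_max generalizing ρ with
  | empty =>
    rw [filter_empty, card_empty, compl_empty]
    exact .of_subsingleton (support_restr_univ_subsingleton μ ρ)
  | insert j S hj ih =>
    have hmem (k : Fin n) : k ∈ S ↔ k < j :=
      ⟨hj k, fun hk ↦ mem_of_mem_insert_of_ne (hS hk.le (mem_insert_self j S)) hk.ne⟩
    have hIoi : (insert j S)ᶜ = Ioi j := by
      ext k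
      rw [mem_compl, mem_insert, hmem, mem_Ioi, ← le_iff_eq_or_lt, not_le]
    have hinsert : Sᶜ = insert j (Ioi j) := by
      ext k
      rw [mem_compl, hmem, not_lt, mem_insert, mem_Ioi, le_iff_eq_or_lt, eq_comm]
    have hlower : IsLowerSet (S : Set (Fin n)) := fun k l hl hk ↦
      (hmem l).2 (hl.trans_lt ((hmem k).1 hk))
    rw [hinsert] at ih
    rw [hIoi, filter_insert]
    split_ifs with hne
    · rw [card_insert_of_notMem fun hjS ↦ lt_irrefl j (hj j (mem_filter.1 hjS).1)]
      exact (h j).shiftTower_step (ih hlower) ρ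
    · rw [← restr_insert_of_orb_eq (not_not.1 hne)]
      exact ih hlower ρ

lemma shiftTower_numNontrivialOrb [Fintype G] {d : G → G → ℝ≥0∞} {c : ℝ≥0∞} {μ : G → ℝ}
    (h : ∀ j : Fin n, FiberShift (fun θ ↦ ∀ σ, d σ (σ * θ) ≤ c) μ (Ioi j) j) :
    ShiftTower (Fin n) d c (numNontrivialOrb G) μ := by
  classical
  have hcard : numNontrivialOrb G = #{j | orb G j ≠ {j}} := by
    rw [numNontrivialOrb, Set.ncard_eq_toFinset_card', Set.toFinset_ofPred]
  rw [hcard, ← restr_empty (Ω := Fin n) μ 1, ← compl_univ]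
  exact shiftTower_restr h (by simp [isLowerSet_univ]) 1

end TailStab

section MoveProb

variable {Γ Ω ι κ : Type*} [Fintype Γ] [DecidableEq Ω] {f : Γ → Ω} {p : Matrix Γ Γ ℝ}

/-- The probability that a step of the kernel `p` from `σ` changes the value of `f`. -/
def moveProb (f : Γ → Ω) (p : Matrix Γ Γ ℝ) (σ : Γ) : ℝ := ∑ τ with f τ ≠ f σ, p σ τ

/-- The sum over `v` of the squared probabilities that a step of the kernel `p` from `σ` changes the
value of `f v`, each increased by the penalty `y v` before it is squared. -/
def penalizedCost [Fintype κ] (f : κ → Γ → Ω) (y : κ → ℝ) (p : Matrix Γ Γ ℝ) (σ : Γ) : ℝ :=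
  ∑ v, (moveProb (f v) p σ + y v) ^ 2

lemma moveProb_glue {x : Γ → ι} {Θ : ι → ι → Γ ≃ Γ} [Fintype ι] {q : Matrix ι ι ℝ}
    {P : ι → ι → Matrix Γ Γ ℝ} (σ : Γ) : moveProb f (glue x Θ q P) σ =
      ∑ k, q (x σ) k * ∑ τ with f τ ≠ f σ, P (x σ) k (Θ (x σ) k σ) τ := by
  simp only [moveProb, glue, mul_sum]
  exact sum_comm

lemma moveProb_sum_smul [Fintype κ] (ω : κ → ℝ) (p : κ → Matrix Γ Γ ℝ) (σ : Γ) :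
    moveProb f (∑ u, ω u • p u) σ = ∑ u, ω u * moveProb f (p u) σ := by
  simp only [moveProb, Matrix.sum_apply, Matrix.smul_apply, smul_eq_mul, mul_sum]
  exact sum_comm

lemma penalizedCost_sum_smul_le [Fintype κ] [DecidableEq κ] {f : κ → Γ → Ω} {ω y : κ → ℝ} {Y : ℝ}
    (hω : ω ∈ stdSimplex ℝ κ) (hy : ∀ v, y v = ω v * Y) (p : κ → Matrix Γ Γ ℝ) (σ : Γ) :
    penalizedCost f y (∑ u, ω u • p u) σ ≤ ∑ u, ω u * penalizedCost f (Pi.single u Y) (p u) σ := by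
  simp only [penalizedCost, mul_sum]
  rw [sum_comm]
  refine sum_le_sum fun v _ ↦ ?_
  have hmean : moveProb (f v) (∑ u, ω u • p u) σ + y v =
      ∑ u, ω u * (moveProb (f v) (p u) σ + Pi.single (M := fun _ ↦ ℝ) u Y v) := by
    simp only [moveProb_sum_smul, hy, mul_add, sum_add_distrib, Pi.single_apply, mul_ite, mul_zero,
      sum_ite_eq, mem_univ, if_true]
  rw [hmean]
  exact sq_sum_mul_le hω _

lemma moveProb_submatrix_inv [Group Γ] (f : Γ → Ω) (p : Matrix Γ Γ ℝ) (σ : Γ) :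
    moveProb f (p.submatrix (Equiv.inv Γ) (Equiv.inv Γ)) σ = moveProb (f ·⁻¹) p σ⁻¹ := by
  simp only [moveProb, sum_filter]
  rw [← Equiv.sum_comp (Equiv.inv Γ) fun τ ↦ if f τ⁻¹ ≠ f σ⁻¹⁻¹ then p σ⁻¹ τ else 0]
  simp only [Equiv.inv_apply, inv_inv, Matrix.submatrix_apply]

lemma moveProb_smul_inv_smul [Group Γ] [MulAction Γ Ω] (p : Matrix Γ Γ ℝ) (σ : Γ) (v : Ω) :
    moveProb (· • σ⁻¹ • v) p σ = moveProb (·⁻¹ • v) p σ := by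
  refine sum_congr (filter_congr fun τ _ ↦ not_congr ?_) fun _ _ ↦ rfl
  beta_reduce
  rw [smul_inv_smul, ← eq_inv_smul_iff, eq_comm]

variable [DecidableEq Γ]

lemma moveProb_one (σ : Γ) : moveProb f 1 σ = 0 :=
  sum_eq_zero fun _ hτ ↦ Matrix.one_apply_ne fun h ↦ (mem_filter.1 hτ).2 (congrArg f h.symm)

lemma moveProb_nonneg (hp : p ∈ Matrix.rowStochastic ℝ Γ) (σ : Γ) : 0 ≤ moveProb f p σ :=
  sum_nonneg fun τ _ ↦ hp.1 σ τ

lemma sum_filter_le_one (hp : p ∈ Matrix.rowStochastic ℝ Γ) (σ : Γ) (A : Γ → Prop)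
    [DecidablePred A] : ∑ τ with A τ, p σ τ ≤ 1 :=
  (sum_le_univ_sum_of_nonneg (hp.1 σ)).trans_eq (Matrix.sum_row_of_mem_rowStochastic hp σ)

end MoveProb

section Disturbance

variable {Γ Ω : Type*} [Fintype Ω] [DecidableEq Ω] [Group Γ] [MulAction Γ Ω]
  {q : Matrix Ω Ω ℝ} {θ : Ω → Ω → Γ} {i l : Ω}

/-- The probability that the point `l ≠ i` is moved by the shift `θ i k`, where `k` has the law
`q i`; the point `i` itself does not count as disturbed. -/
def disturbance (q : Matrix Ω Ω ℝ) (θ : Ω → Ω → Γ) (i l : Ω) : ℝ :=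
  ∑ k with l ≠ i ∧ θ i k • l ≠ l, q i k

lemma disturbance_nonneg (hq : q ∈ Matrix.rowStochastic ℝ Ω) (θ : Ω → Ω → Γ) (i l : Ω) :
    0 ≤ disturbance q θ i l :=
  sum_nonneg fun k _ ↦ hq.1 i k

lemma disturbance_eq_zero (h : l = i ∨ ∀ k, q i k ≠ 0 → θ i k • l = l) :
    disturbance q θ i l = 0 :=
  sum_eq_zero fun k hk ↦ by_contra fun hq ↦
    let ⟨hl, hθ⟩ := (mem_filter.1 hk).2
    h.elim hl fun h ↦ hθ (h k hq)

lemma sum_disturbance_le {s : ℕ} (hq : q ∈ Matrix.rowStochastic ℝ Ω) (hone : θ i i = 1)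
    (hθ : ∀ k, k ≠ i → q i k ≠ 0 → #{l : Ω | θ i k • l ≠ l} ≤ s + 1 ∧ θ i k • k = i) :
    ∑ l, disturbance q θ i l ≤ s * (1 - q i i) := by
  have hcard (k : Ω) (hk : q i k ≠ 0) :
      #{l : Ω | l ≠ i ∧ θ i k • l ≠ l} ≤ if k = i then 0 else s := by
    split_ifs with hki
    · simp [hki, hone]
    · obtain ⟨hs, hki'⟩ := hθ k hki hk
      have hi : i ∈ univ.filter fun l ↦ θ i k • l ≠ l :=
        mem_filter.2 ⟨mem_univ i, fun h ↦ hki (smul_left_cancel (θ i k) (hki'.trans h.symm))⟩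
      have herase : (univ.filter fun l ↦ l ≠ i ∧ θ i k • l ≠ l) =
          (univ.filter fun l ↦ θ i k • l ≠ l).erase i := by
        ext l
        simp only [mem_filter, mem_erase, mem_univ, true_and]
      rw [herase, card_erase_of_mem hi]
      exact Nat.sub_le_of_le_add hs
  calc ∑ l, disturbance q θ i l = ∑ k, q i k * #{l : Ω | l ≠ i ∧ θ i k • l ≠ l} := by
        simp only [disturbance, sum_filter]
        rw [sum_comm]
        refine sum_congr rfl fun k _ ↦ ?_
        rw [← sum_filter, sum_const, nsmul_eq_mul, mul_comm]
    _ ≤ ∑ k, q i k * if k = i then 0 else (s : ℝ) := by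
        refine sum_le_sum fun k _ ↦ ?_
        by_cases hk : q i k = 0
        · simp [hk]
        · exact mul_le_mul_of_nonneg_left (mod_cast hcard k hk) (hq.1 i k)
    _ = s * (1 - q i i) := by rw [sum_mul_ite_ne hq, mul_comm]

end Disturbance

section Pivot

variable {Γ Ω : Type*} [Fintype Γ] [Fintype Ω] [DecidableEq Ω] [Group Γ] [MulAction Γ Ω]
  {q : Matrix Ω Ω ℝ} {θ : Ω → Ω → Γ} {P : Ω → Ω → Matrix Γ Γ ℝ} {j : Ω} {σ : Γ}

/-- The cost of a transport `p` on the fibre over `k` to which `θ i k` shifts the fibre over `i`: it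
has to make up for the disturbance that the shifts out of `i` have caused. -/
def pivotCost (q : Matrix Ω Ω ℝ) (θ : Ω → Ω → Γ) (i k : Ω) (p : Matrix Γ Γ ℝ) (τ : Γ) : ℝ :=
  penalizedCost (fun l σ ↦ σ • l) (fun l ↦ disturbance q θ i (θ i k • l)) p τ

lemma pivotCost_eq (i k : Ω) (p : Matrix Γ Γ ℝ) : pivotCost q θ i k p (σ * θ i k) =
    ∑ v : Ω, (moveProb (·⁻¹ • v) p (σ * θ i k) + disturbance q θ i (σ⁻¹ • v)) ^ 2 := by
  refine (Equiv.sum_comp (MulAction.toPerm (σ * θ i k)⁻¹) _).symm.trans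
    (sum_congr rfl fun v _ ↦ ?_)
  beta_reduce
  rw [MulAction.toPerm_apply, moveProb_smul_inv_smul, mul_inv_rev, mul_smul, smul_inv_smul]

variable [DecidableEq Γ]

lemma moveProb_glue_self_le (hq : q ∈ Matrix.rowStochastic ℝ Ω)
    (hP : ∀ i k, P i k ∈ Matrix.rowStochastic ℝ Γ) (hone : ∀ i, θ i i = 1)
    (hself : q (σ⁻¹ • j) (σ⁻¹ • j) ≠ 0 →
      ∀ τ, P (σ⁻¹ • j) (σ⁻¹ • j) σ τ ≠ 0 → τ⁻¹ • j = σ⁻¹ • j) :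
    moveProb (·⁻¹ • j) (glue (·⁻¹ • j) (fun i k ↦ Equiv.mulRight (θ i k)) q P) σ ≤
      1 - q (σ⁻¹ • j) (σ⁻¹ • j) := by
  rw [moveProb_glue, ← mul_one (1 - _), ← sum_mul_ite_ne hq]
  refine sum_le_sum fun k _ ↦ ?_
  by_cases hk : q (σ⁻¹ • j) k = 0
  · simp [hk]
  refine mul_le_mul_of_nonneg_left ?_ (hq.1 _ k)
  split_ifs with hkj
  · subst hkj
    simp only [hone, Equiv.coe_mulRight, mul_one]
    exact (sum_eq_zero fun τ hτ ↦ by_contra fun h ↦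
      absurd (hself hk τ h) (mem_filter.1 hτ).2).le
  · exact sum_filter_le_one (hP _ k) _ _

lemma moveProb_glue_le (hq : q ∈ Matrix.rowStochastic ℝ Ω)
    (hP : ∀ i k, P i k ∈ Matrix.rowStochastic ℝ Γ) {v : Ω} (hv : v ≠ j) :
    moveProb (·⁻¹ • v) (glue (·⁻¹ • j) (fun i k ↦ Equiv.mulRight (θ i k)) q P) σ ≤
      ∑ k, q (σ⁻¹ • j) k * (moveProb (·⁻¹ • v) (P (σ⁻¹ • j) k) (σ * θ (σ⁻¹ • j) k) +
        disturbance q θ (σ⁻¹ • j) (σ⁻¹ • v)) := by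
  simp only [mul_add, sum_add_distrib, ← sum_mul, Matrix.sum_row_of_mem_rowStochastic hq, one_mul]
  rw [moveProb_glue, disturbance, sum_filter, ← sum_add_distrib]
  refine sum_le_sum fun k _ ↦ ?_
  have hvj : σ⁻¹ • v ≠ σ⁻¹ • j := fun h ↦ hv (smul_left_cancel _ h)
  by_cases hθ : θ (σ⁻¹ • j) k • σ⁻¹ • v = σ⁻¹ • v
  · rw [if_neg fun h ↦ h.2 hθ, add_zero]
    have hinv : (σ * θ (σ⁻¹ • j) k)⁻¹ • v = σ⁻¹ • v := by
      rw [mul_inv_rev, mul_smul, inv_smul_eq_iff, hθ]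
    simp only [moveProb, hinv, Equiv.coe_mulRight, le_refl]
  · rw [if_pos ⟨hvj, hθ⟩]
    have hnonneg := mul_nonneg (hq.1 (σ⁻¹ • j) k) (moveProb_nonneg (f := (·⁻¹ • v))
      (hP (σ⁻¹ • j) k) (σ * θ (σ⁻¹ • j) k))
    exact (mul_le_of_le_one_right (hq.1 _ k) (sum_filter_le_one (hP _ k) _ _)).trans
      (le_add_of_nonneg_left hnonneg)

lemma penalizedCost_glue_le (hq : q ∈ Matrix.rowStochastic ℝ Ω)
    (hP : ∀ i k, P i k ∈ Matrix.rowStochastic ℝ Γ) (hone : ∀ i, θ i i = 1)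
    (hself : q (σ⁻¹ • j) (σ⁻¹ • j) ≠ 0 →
      ∀ τ, P (σ⁻¹ • j) (σ⁻¹ • j) σ τ ≠ 0 → τ⁻¹ • j = σ⁻¹ • j)
    (hglue : glue (·⁻¹ • j) (fun i k ↦ Equiv.mulRight (θ i k)) q P ∈ Matrix.rowStochastic ℝ Γ)
    {Y : ℝ} (hY : 0 ≤ Y) :
    penalizedCost (fun v τ ↦ τ⁻¹ • v) (Pi.single j Y)
        (glue (·⁻¹ • j) (fun i k ↦ Equiv.mulRight (θ i k)) q P) σ ≤
      2 * (1 - q (σ⁻¹ • j) (σ⁻¹ • j)) ^ 2 + 2 * Y ^ 2 +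
        ∑ k, q (σ⁻¹ • j) k * pivotCost q θ (σ⁻¹ • j) k (P (σ⁻¹ • j) k) (σ * θ (σ⁻¹ • j) k) := by
  set i := σ⁻¹ • j with hi
  have hrow : q i ∈ stdSimplex ℝ Ω := ⟨hq.1 i, Matrix.sum_row_of_mem_rowStochastic hq i⟩
  have hterm (v : Ω) : (moveProb (·⁻¹ • v)
      (glue (·⁻¹ • j) (fun i k ↦ Equiv.mulRight (θ i k)) q P) σ +
        Pi.single (M := fun _ ↦ ℝ) j Y v) ^ 2 ≤
      Pi.single (M := fun _ ↦ ℝ) j (2 * (1 - q i i) ^ 2 + 2 * Y ^ 2) v +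
        ∑ k, q i k * (moveProb (·⁻¹ • v) (P i k) (σ * θ i k) +
          disturbance q θ i (σ⁻¹ • v)) ^ 2 := by
    have hnonneg := moveProb_nonneg (f := (·⁻¹ • v)) hglue σ
    obtain rfl | hv := eq_or_ne v j
    · rw [Pi.single_eq_same, Pi.single_eq_same]
      refine le_add_of_le_of_nonneg ?_
        (sum_nonneg fun k _ ↦ mul_nonneg (hq.1 i k) (sq_nonneg _))
      refine (pow_le_pow_left₀ (add_nonneg hnonneg hY)
        (add_le_add_left (moveProb_glue_self_le hq hP hone hself) Y) 2).trans ?_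
      rw [← mul_add]
      exact add_sq_le
    · rw [Pi.single_eq_of_ne hv, Pi.single_eq_of_ne hv, add_zero, zero_add]
      exact (pow_le_pow_left₀ hnonneg (moveProb_glue_le hq hP hv) 2).trans (sq_sum_mul_le hrow _)
  refine (sum_le_sum fun v _ ↦ hterm v).trans_eq ?_
  rw [sum_add_distrib, Finset.sum_pi_single', if_pos (mem_univ j), sum_comm]
  simp only [pivotCost_eq, mul_sum]

end Pivot

lemma exists_mem_stdSimplex_mul_sum_eq {Ω : Type*} [Fintype Ω] {Z : Set Ω} {y : Ω → ℝ}
    (hy : 0 ≤ y) (hyZ : ∀ v ∈ Z, y v = 0) {j : Ω} (hj : j ∉ Z) :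
    ∃ ω ∈ stdSimplex ℝ Ω, (∀ v ∈ Z, ω v = 0) ∧ ∀ v, y v = ω v * ∑ u, y u := by
  classical
  by_cases hY : ∑ u, y u = 0
  · refine ⟨Pi.single j 1, single_mem_stdSimplex ℝ j, fun v hv ↦ ?_, fun v ↦ ?_⟩
    · exact Pi.single_eq_of_ne (ne_of_mem_of_not_mem hv hj) _
    · rw [hY, mul_zero, (sum_eq_zero_iff_of_nonneg fun u _ ↦ hy u).1 hY v (mem_univ v)]
  · exact ⟨fun v ↦ y v / ∑ u, y u,
      ⟨fun v ↦ div_nonneg (hy v) (sum_nonneg fun u _ ↦ hy u), by rw [← sum_div, div_self hY]⟩,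
      fun v hv ↦ by simp only [hyZ v hv, zero_div], fun v ↦ (div_mul_cancel₀ _ hY).symm⟩

section Penalized

variable {Γ Ω : Type*} [Fintype Γ] [DecidableEq Γ] [Fintype Ω] [DecidableEq Ω] {a b C : ℝ}
  {f : Ω → Γ → Ω} {Z : Finset Ω} {μ ν₁ ν₂ : Γ → ℝ}

/-- Laws that are absolutely continuous with respect to `μ` have, for every penalty `y` that
vanishes on `Z`, a transport whose penalized cost is at most that of the whole penalty put at one
point, up to a factor `2` and a multiple of the entropies. -/
def PenalizedTransport (a b C : ℝ) (f : Ω → Γ → Ω) (Z : Finset Ω) (μ : Γ → ℝ) : Prop :=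
  ∀ ν₁ ∈ stdSimplex ℝ Γ, ∀ ν₂ ∈ stdSimplex ℝ Γ, ν₁.support ⊆ μ.support → ν₂.support ⊆ μ.support →
    ∀ y : Ω → ℝ, 0 ≤ y → (∀ v ∈ Z, y v = 0) → ∃ p, IsTransport p ν₁ ν₂ ∧
      ∑ σ, ν₁ σ * penalizedCost f y p σ ≤ 2 * (∑ v, y v) ^ 2 + C * entSum a b ν₁ ν₂ μ

lemma penalizedTransport_univ (hab : a.HolderConjugate b) (hC : 0 ≤ C) (hμ : 0 ≤ μ)
    (hsub : μ.support.Subsingleton) : PenalizedTransport a b C f univ μ := by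
  intro ν₁ h₁ ν₂ h₂ hac₁ hac₂ y hy hyZ
  obtain rfl : y = 0 := funext fun v ↦ hyZ v (mem_univ v)
  have hE := entSum_nonneg hab h₁ h₂ hμ hac₁ hac₂
  obtain rfl := eq_of_support_subsingleton h₁ h₂ hac₁ hac₂ hsub
  refine ⟨1, isTransport_one _, ?_⟩
  simp only [penalizedCost, moveProb_one, Pi.zero_apply, add_zero, ne_eq, OfNat.ofNat_ne_zero,
    not_false_eq_true, zero_pow, sum_const_zero, mul_zero, zero_add]
  exact mul_nonneg hC hE

lemma PenalizedTransport.of_inv [Group Γ]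
    (h : PenalizedTransport a b C (fun v σ ↦ f v σ⁻¹) Z (μ ∘ Equiv.inv Γ)) :
    PenalizedTransport a b C f Z μ := by
  intro ν₁ h₁ ν₂ h₂ hac₁ hac₂ y hy hyZ
  have hsimplex {ν : Γ → ℝ} (hν : ν ∈ stdSimplex ℝ Γ) : ν ∘ Equiv.inv Γ ∈ stdSimplex ℝ Γ :=
    ⟨fun σ ↦ hν.1 _, (Equiv.sum_comp (Equiv.inv Γ) ν).trans hν.2⟩
  obtain ⟨p, hp, hcost⟩ := h _ (hsimplex h₁) _ (hsimplex h₂) (fun _ hσ ↦ hac₁ hσ)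
    (fun _ hσ ↦ hac₂ hσ) y hy hyZ
  refine ⟨p.submatrix (Equiv.inv Γ) (Equiv.inv Γ), ⟨?_, funext fun τ ↦ ?_⟩, ?_⟩
  · refine Matrix.mem_rowStochastic_iff_sum.2 ⟨fun σ τ ↦ hp.nonneg _ _, fun σ ↦ ?_⟩
    exact (Equiv.sum_comp (Equiv.inv Γ) (p σ⁻¹)).trans (hp.sum_row _)
  · have hτ := congrFun hp.2 τ⁻¹
    rw [Function.comp_apply, Equiv.inv_apply, inv_inv] at hτ
    rw [← hτ]
    refine .trans ?_ (Equiv.sum_comp (Equiv.inv Γ) fun σ ↦ ν₁ σ⁻¹ * p σ τ⁻¹)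
    simp only [Equiv.inv_apply, inv_inv, Matrix.vecMul, dotProduct, Matrix.submatrix_apply]
  · simp only [entSum, relEnt_comp_equiv] at hcost
    have hpen (σ : Γ) : penalizedCost f y (p.submatrix (Equiv.inv Γ) (Equiv.inv Γ)) σ =
        penalizedCost (fun v σ ↦ f v σ⁻¹) y p σ⁻¹ := by
      simp only [penalizedCost, moveProb_submatrix_inv]
    refine hcost.trans' (le_of_eq ?_)
    rw [← Equiv.sum_comp (Equiv.inv Γ)]
    simp only [hpen]
    simp only [Function.comp_apply, Equiv.inv_apply, inv_inv]

lemma IsTransport.sum_smul {κ : Type*} [Fintype κ] {ω : κ → ℝ} (hω : ω ∈ stdSimplex ℝ κ)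
    {p : κ → Matrix Γ Γ ℝ} (hp : ∀ u, IsTransport (p u) ν₁ ν₂) :
    IsTransport (∑ u, ω u • p u) ν₁ ν₂ := by
  refine ⟨Matrix.convex_rowStochastic.sum_mem (fun u _ ↦ hω.1 u) hω.2 fun u _ ↦ (hp u).1, ?_⟩
  rw [Matrix.vecMul_sum]
  simp only [Matrix.vecMul_smul, (hp _).2, ← Finset.sum_smul, hω.2, one_smul]

lemma exists_transport_of_pivots (h₁ : 0 ≤ ν₁) {y : Ω → ℝ} (hy : 0 ≤ y)
    (hyZ : ∀ v ∈ Z, y v = 0) {j : Ω} (hj : j ∉ Z) {A : ℝ}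
    (h : ∀ u ∉ Z, ∃ p, IsTransport p ν₁ ν₂ ∧
      ∑ σ, ν₁ σ * penalizedCost f (Pi.single u (∑ v, y v)) p σ ≤ A) :
    ∃ p, IsTransport p ν₁ ν₂ ∧ ∑ σ, ν₁ σ * penalizedCost f y p σ ≤ A := by
  obtain ⟨ω, hω, hωZ, hωy⟩ := exists_mem_stdSimplex_mul_sum_eq (Z := (Z : Set Ω)) hy hyZ hj
  have hp (u : Ω) : ∃ p, IsTransport p ν₁ ν₂ ∧
      (u ∉ Z → ∑ σ, ν₁ σ * penalizedCost f (Pi.single u (∑ v, y v)) p σ ≤ A) := by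
    by_cases hu : u ∈ Z
    · obtain ⟨p, hp, -⟩ := h j hj
      exact ⟨p, hp, absurd hu⟩
    · obtain ⟨p, hp, hA⟩ := h u hu
      exact ⟨p, hp, fun _ ↦ hA⟩
  choose p hp hA using hp
  refine ⟨∑ u, ω u • p u, .sum_smul hω hp, ?_⟩
  calc _ ≤ ∑ σ, ν₁ σ * ∑ u, ω u * penalizedCost f (Pi.single u (∑ v, y v)) (p u) σ :=
        sum_le_sum fun σ _ ↦
          mul_le_mul_of_nonneg_left (penalizedCost_sum_smul_le hω hωy p σ) (h₁ σ)
    _ = ∑ u, ω u * ∑ σ, ν₁ σ * penalizedCost f (Pi.single u (∑ v, y v)) (p u) σ := by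
        simp only [mul_sum, mul_left_comm (ν₁ _)]
        exact sum_comm
    _ ≤ ∑ u, ω u * A := by
        refine sum_le_sum fun u _ ↦ ?_
        by_cases hu : u ∈ Z
        · simp [hωZ u hu]
        · exact mul_le_mul_of_nonneg_left (hA u hu) (hω.1 u)
    _ = A := by rw [← sum_mul, hω.2, one_mul]

section PivotTransport

variable [Group Γ] [MulAction Γ Ω] {J : Finset Ω} {j : Ω} {ρ : Γ} {s : ℕ}
  {q : Matrix Ω Ω ℝ} {θ : Ω → Ω → Γ} {i k : Ω}

/-- The transport `p` on the fibre over `k` makes up for the disturbance caused by the shifts out of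
`i`, each of which moves at most `s` points besides `i`. -/
structure IsPivotTransport (a b : ℝ) (s : ℕ) (q : Matrix Ω Ω ℝ) (θ : Ω → Ω → Γ) (i k : Ω)
    (ν₁ ν₂ μ : Γ → ℝ) (p : Matrix Γ Γ ℝ) : Prop where
  isTransport : IsTransport p ν₁ ν₂
  sum_mul_pivotCost_le : ∑ τ, ν₁ τ * pivotCost q θ i k p τ ≤
    2 * (s * (1 - q i i)) ^ 2 + (4 * s ^ 2 + 4) * entSum a b ν₁ ν₂ μ

lemma exists_isPivotTransport (hq : q ∈ Matrix.rowStochastic ℝ Ω) (h₁ : 0 ≤ ν₁) (h₂ : 0 ≤ ν₂)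
    (hμ : 0 ≤ μ) (hac₁ : ν₁.support ⊆ (restr μ J ρ).support)
    (hac₂ : ν₂.support ⊆ (restr μ J ρ).support)
    (hΘ : ShiftCompatible (·⁻¹ • j) (fun i k ↦ Equiv.mulRight (θ i k)) (restr μ J ρ))
    (hone : θ i i = 1) (hθ : ∀ k, k ≠ i → q i k ≠ 0 →
      #{l : Ω | θ i k • l ≠ l} ≤ s + 1 ∧ θ i k • k = i ∧ ∀ l ∈ J, θ i k • ρ⁻¹ • l = ρ⁻¹ • l)
    (hrec : ∀ ρ', Agree J ρ' ρ → PenalizedTransport a b (4 * s ^ 2 + 4) (fun l σ ↦ σ • l)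
      ((insert j J).image (ρ'⁻¹ • ·)) (restr μ (insert j J) ρ'))
    (hi : label (·⁻¹ • j) ν₁ i ≠ 0) (hk : label (·⁻¹ • j) ν₂ k ≠ 0) (hqk : q i k ≠ 0) :
    ∃ p, IsPivotTransport a b s q θ i k
      (shiftCond (·⁻¹ • j) (fun i k ↦ Equiv.mulRight (θ i k)) ν₁ i k)
      (fiberCond (·⁻¹ • j) ν₂ k) (fiberPart (·⁻¹ • j) (restr μ J ρ) k) p := by
  have hfix (k : Ω) (hqk : q i k ≠ 0) :
      θ i k • k = i ∧ ∀ l ∈ J, θ i k • ρ⁻¹ • l = ρ⁻¹ • l := by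
    obtain rfl | hne := eq_or_ne k i
    · simp only [hone, one_smul, implies_true, and_self]
    · exact (hθ k hne hqk).2
  have hμ' := restr_nonneg hμ J ρ
  have hkμ := support_label_subset hμ' hac₂ hk
  have hac₁' := support_shiftCond_subset hΘ hac₁ (support_label_subset hμ' hac₁ hi) hkμ
  have hac₂' := support_fiberCond_subset hac₂ (x := (·⁻¹ • j)) k
  obtain ⟨ρ', hρ', rfl⟩ := exists_agree_of_label_ne_zero hkμ
  rw [fiberPart_restr μ j hρ'] at hac₁' hac₂' ⊢
  obtain ⟨p, hp, hcost⟩ := hrec ρ' hρ' _ (shiftCond_mem_stdSimplex h₁ hi _) _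
    (fiberCond_mem_stdSimplex h₂ hk) hac₁' hac₂'
    (fun l ↦ disturbance q θ i (θ i (ρ'⁻¹ • j) • l)) (fun l ↦ disturbance_nonneg hq θ i _)
    (forall_mem_image.2 <| (forall_mem_insert ..).2
      ⟨disturbance_eq_zero (.inl (hfix _ hqk).1), fun l hl ↦ by
        rw [hρ' l hl, (hfix _ hqk).2 l hl]
        exact disturbance_eq_zero (.inr fun k hk ↦ (hfix k hk).2 l hl)⟩)
  have hsum : ∑ l, disturbance q θ i (θ i (ρ'⁻¹ • j) • l) ≤ s * (1 - q i i) :=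
    (Equiv.sum_comp (MulAction.toPerm (θ i (ρ'⁻¹ • j))) (disturbance q θ i)).trans_le
      (sum_disturbance_le hq hone fun k hne hk ↦ (hθ k hne hk).imp_right And.left)
  refine ⟨p, hp, hcost.trans ?_⟩
  gcongr
  exact sum_nonneg fun l _ ↦ disturbance_nonneg hq θ i _

variable {P : Ω → Ω → Matrix Γ Γ ℝ}

lemma sum_mul_sum_pivotCost_le (h₁ : 0 ≤ ν₁) (hq : q ∈ Matrix.rowStochastic ℝ Ω)
    (hP : ∀ i k, label (·⁻¹ • j) ν₁ i ≠ 0 → q i k ≠ 0 → IsPivotTransport a b s q θ i k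
      (shiftCond (·⁻¹ • j) (fun i k ↦ Equiv.mulRight (θ i k)) ν₁ i k)
      (fiberCond (·⁻¹ • j) ν₂ k) (fiberPart (·⁻¹ • j) μ k) (P i k)) :
    ∑ σ, ν₁ σ * ∑ k, q (σ⁻¹ • j) k *
        pivotCost q θ (σ⁻¹ • j) k (P (σ⁻¹ • j) k) (σ * θ (σ⁻¹ • j) k) ≤
      2 * s ^ 2 * ∑ i, label (·⁻¹ • j) ν₁ i * (1 - q i i) ^ 2 +
        (4 * s ^ 2 + 4) * ∑ i, ∑ k, label (·⁻¹ • j) ν₁ i * q i k *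
          entSum a b (shiftCond (·⁻¹ • j) (fun i k ↦ Equiv.mulRight (θ i k)) ν₁ i k)
            (fiberCond (·⁻¹ • j) ν₂ k) (fiberPart (·⁻¹ • j) μ k) := by
  refine (sum_mul_sum_shift_le (x := (·⁻¹ • j)) (Θ := fun i k ↦ Equiv.mulRight (θ i k))
    (f := fun i k τ ↦ pivotCost q θ i k (P i k) τ) h₁ hq
    fun i k hi hk ↦ (hP i k hi hk).sum_mul_pivotCost_le).trans_eq ?_
  simp only [mul_add, sum_add_distrib, mul_sum (_ : Finset Ω)]
  congr 1
  · refine sum_congr rfl fun i _ ↦ ?_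
    rw [← sum_mul, ← mul_sum, Matrix.sum_row_of_mem_rowStochastic hq]
    ring
  · exact sum_congr rfl fun i _ ↦ sum_congr rfl fun k _ ↦ mul_left_comm ..

lemma sum_mul_penalizedCost_glue_le (hab : a.HolderConjugate b) (h₁ : ν₁ ∈ stdSimplex ℝ Γ)
    (h₂ : ν₂ ∈ stdSimplex ℝ Γ) (hμ : 0 ≤ μ) (hac₁ : ν₁.support ⊆ μ.support)
    (hac₂ : ν₂.support ⊆ μ.support)
    (hΘ : ShiftCompatible (·⁻¹ • j) (fun i k ↦ Equiv.mulRight (θ i k)) μ) (hone : ∀ i, θ i i = 1)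
    (hq : q = maximalCoupling (label (·⁻¹ • j) ν₁) (label (·⁻¹ • j) ν₂))
    (hP : ∀ i k, P i k ∈ Matrix.rowStochastic ℝ Γ)
    (hrec : ∀ i k, label (·⁻¹ • j) ν₁ i ≠ 0 → q i k ≠ 0 → IsPivotTransport a b s q θ i k
      (shiftCond (·⁻¹ • j) (fun i k ↦ Equiv.mulRight (θ i k)) ν₁ i k)
      (fiberCond (·⁻¹ • j) ν₂ k) (fiberPart (·⁻¹ • j) μ k) (P i k))
    {Y : ℝ} (hY : 0 ≤ Y) :
    ∑ σ, ν₁ σ * penalizedCost (fun v τ ↦ τ⁻¹ • v) (Pi.single j Y)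
        (glue (·⁻¹ • j) (fun i k ↦ Equiv.mulRight (θ i k)) q P) σ ≤
      2 * Y ^ 2 + (4 * s ^ 2 + 4) * entSum a b ν₁ ν₂ μ := by
  have hl₁ := label_mem_stdSimplex (x := (·⁻¹ • j)) h₁
  have hl₂ := label_mem_stdSimplex (x := (·⁻¹ • j)) h₂
  have hqt : IsTransport q _ _ := hq ▸ isTransport_maximalCoupling hl₁ hl₂
  have hglue := isTransport_glue h₁.1 h₂.1 hqt hP fun i k hi hk ↦ (hrec i k hi hk).isTransport
  have hlabel : ∑ i, label (·⁻¹ • j) ν₁ i * (1 - q i i) ^ 2 ≤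
      2 * entSum a b (label (·⁻¹ • j) ν₁) (label (·⁻¹ • j) ν₂) (label (·⁻¹ • j) μ) := by
    rw [hq]
    exact sum_mul_one_sub_maximalCoupling_sq_le hab hl₁ hl₂ (label_nonneg hμ)
      (support_label_subset hμ hac₁) (support_label_subset hμ hac₂)
  have hpoint (σ : Γ) : ν₁ σ * penalizedCost (fun v τ ↦ τ⁻¹ • v) (Pi.single j Y)
        (glue (·⁻¹ • j) (fun i k ↦ Equiv.mulRight (θ i k)) q P) σ ≤
      ν₁ σ * (2 * (1 - q (σ⁻¹ • j) (σ⁻¹ • j)) ^ 2 + 2 * Y ^ 2 + ∑ k, q (σ⁻¹ • j) k *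
        pivotCost q θ (σ⁻¹ • j) k (P (σ⁻¹ • j) k) (σ * θ (σ⁻¹ • j) k)) := by
    by_cases hσ : ν₁ σ = 0
    · rw [hσ, zero_mul, zero_mul]
    refine mul_le_mul_of_nonneg_left (penalizedCost_glue_le hqt.1 hP hone
      (fun hk τ hτ ↦ ?_) hglue.1 hY) (h₁.1 σ)
    have hi : label (·⁻¹ • j) ν₁ (σ⁻¹ • j) ≠ 0 := label_ne_zero h₁.1 hσ
    have hshift := shiftCond_apply_ne_zero (x := (·⁻¹ • j))
      (Θ := fun i k ↦ Equiv.mulRight (θ i k)) h₁.1 hσ (σ⁻¹ • j)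
    simp only [hone, Equiv.coe_mulRight, mul_one] at hshift
    exact (fiberPart_ne_zero_iff.1 (div_ne_zero_iff.1 ((hrec _ _ hi hk).isTransport.apply_ne_zero
      (shiftCond_mem_stdSimplex h₁.1 hi _).1 hshift hτ)).1).1
  refine (sum_le_sum fun σ _ ↦ hpoint σ).trans ?_
  have hfiber := sum_mul_sum_pivotCost_le h₁.1 hqt.1 hrec
  have hsum := sum_mul_comp_label (ν := ν₁) (x := (·⁻¹ • j)) fun i ↦ (1 - q i i) ^ 2
  simp only [mul_add, sum_add_distrib, ← sum_mul, h₁.2, mul_left_comm _ (2 : ℝ), ← mul_sum, hsum]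
  rw [← entSum_label_add_eq a b h₁.1 h₂.1 hμ hac₁ hac₂ hΘ hqt]
  nlinarith [mul_le_mul_of_nonneg_left hlabel (by positivity : (0 : ℝ) ≤ 2 * s ^ 2 + 2)]

lemma FiberShift.exists_transport_pivot
    (h : FiberShift (fun θ ↦ #{l : Ω | θ • l ≠ l} ≤ s + 1) μ J j) (hab : a.HolderConjugate b)
    (hμ : 0 ≤ μ) (hrec : ∀ ρ', Agree J ρ' ρ → PenalizedTransport a b (4 * s ^ 2 + 4)
      (fun l σ ↦ σ • l) ((insert j J).image (ρ'⁻¹ • ·)) (restr μ (insert j J) ρ'))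
    (h₁ : ν₁ ∈ stdSimplex ℝ Γ) (h₂ : ν₂ ∈ stdSimplex ℝ Γ)
    (hac₁ : ν₁.support ⊆ (restr μ J ρ).support) (hac₂ : ν₂.support ⊆ (restr μ J ρ).support)
    {Y : ℝ} (hY : 0 ≤ Y) :
    ∃ p, IsTransport p ν₁ ν₂ ∧
      ∑ σ, ν₁ σ * penalizedCost (fun v σ ↦ σ⁻¹ • v) (Pi.single j Y) p σ ≤
        2 * Y ^ 2 + (4 * s ^ 2 + 4) * entSum a b ν₁ ν₂ (restr μ J ρ) := by
  obtain ⟨θ, hone, hΘ, hθ⟩ := h.exists_shift ρ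
  have hμ' := restr_nonneg hμ J ρ
  set q := maximalCoupling (label (·⁻¹ • j) ν₁) (label (·⁻¹ • j) ν₂) with hq
  have hqt : IsTransport q (label (·⁻¹ • j) ν₁) (label (·⁻¹ • j) ν₂) :=
    isTransport_maximalCoupling (label_mem_stdSimplex h₁) (label_mem_stdSimplex h₂)
  have hP (i k : Ω) : ∃ P ∈ Matrix.rowStochastic ℝ Γ,
      (label (·⁻¹ • j) ν₁ i ≠ 0 → q i k ≠ 0 → IsPivotTransport a b s q θ i k
        (shiftCond (·⁻¹ • j) (fun i k ↦ Equiv.mulRight (θ i k)) ν₁ i k)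
        (fiberCond (·⁻¹ • j) ν₂ k) (fiberPart (·⁻¹ • j) (restr μ J ρ) k) P) := by
    by_cases hik : label (·⁻¹ • j) ν₁ i ≠ 0 ∧ q i k ≠ 0
    · obtain ⟨hi, hk⟩ := hik
      have hlabel₂ {l : Ω} (hl : q i l ≠ 0) := hqt.apply_ne_zero (label_nonneg h₁.1) hi hl
      obtain ⟨P, hP⟩ := exists_isPivotTransport hqt.1 h₁.1 h₂.1 hμ hac₁ hac₂ hΘ (hone i)
        (fun l hl hql ↦ hθ i l hl.symm (support_label_subset hμ' hac₁ hi)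
          (support_label_subset hμ' hac₂ (hlabel₂ hql))) hrec hi (hlabel₂ hk) hk
      exact ⟨P, hP.isTransport.1, fun _ _ ↦ hP⟩
    · exact ⟨1, one_mem _, fun hi hk ↦ absurd ⟨hi, hk⟩ hik⟩
  choose P hP hrec using hP
  exact ⟨_, isTransport_glue h₁.1 h₂.1 hqt hP fun i k hi hk ↦ (hrec i k hi hk).isTransport,
    sum_mul_penalizedCost_glue_le hab h₁ h₂ hμ' hac₁ hac₂ hΘ hone hq hP hrec hY⟩

/-- The induction alternates between the positions of values and the values at positions: fixing
one more value prescribes the permutation at one more position, which is again a value of its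
inverse. -/
lemma penalizedTransport_restr [FaithfulSMul Γ Ω] (hab : a.HolderConjugate b) (hμ : 0 ≤ μ)
    (h : ∀ J : Finset Ω, ∀ j ∉ J, FiberShift (fun θ ↦ #{l : Ω | θ • l ≠ l} ≤ s + 1) μ J j)
    (hinv : ∀ J : Finset Ω, ∀ j ∉ J,
      FiberShift (fun θ ↦ #{l : Ω | θ • l ≠ l} ≤ s + 1) (μ ∘ Equiv.inv Γ) J j) :
    PenalizedTransport a b (4 * s ^ 2 + 4) (fun v σ ↦ σ⁻¹ • v) J (restr μ J ρ) := by
  induction hm : #Jᶜ generalizing μ J ρ with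
  | zero =>
    obtain rfl := (compl_eq_empty_iff J).1 (card_eq_zero.1 hm)
    exact penalizedTransport_univ hab (by positivity) (restr_nonneg hμ univ ρ)
      (support_restr_univ_subsingleton μ ρ)
  | succ m ih =>
    obtain ⟨j, hj⟩ := card_pos.1 (m.succ_pos.trans_eq hm.symm)
    rw [mem_compl] at hj
    have hμinv : (μ ∘ Equiv.inv Γ) ∘ Equiv.inv Γ = μ := funext fun σ ↦ congrArg μ (inv_inv σ)
    intro ν₁ h₁ ν₂ h₂ hac₁ hac₂ y hy hyJ
    refine exists_transport_of_pivots h₁.1 hy hyJ hj fun u hu ↦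
      (h J u hu).exists_transport_pivot hab hμ (fun ρ' _ ↦ .of_inv ?_) h₁ h₂ hac₁ hac₂
        (sum_nonneg fun v _ ↦ hy v)
    rw [← restr_inv]
    refine ih (fun σ ↦ hμ σ⁻¹) hinv (hμinv.symm ▸ h) ?_
    rw [card_compl, card_image_of_injective _ (MulAction.injective ρ'⁻¹),
      card_insert_of_notMem hu, Nat.sub_add_eq, ← card_compl, hm, Nat.add_sub_cancel]

lemma exists_transport_smul [FaithfulSMul Γ Ω] (hab : a.HolderConjugate b) (hμ : 0 ≤ μ)
    (h : ∀ J : Finset Ω, ∀ j ∉ J, FiberShift (fun θ ↦ #{l : Ω | θ • l ≠ l} ≤ s + 1) μ J j)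
    (hinv : ∀ J : Finset Ω, ∀ j ∉ J,
      FiberShift (fun θ ↦ #{l : Ω | θ • l ≠ l} ≤ s + 1) (μ ∘ Equiv.inv Γ) J j)
    (h₁ : ν₁ ∈ stdSimplex ℝ Γ) (h₂ : ν₂ ∈ stdSimplex ℝ Γ) (hac₁ : ν₁.support ⊆ μ.support)
    (hac₂ : ν₂.support ⊆ μ.support) :
    ∃ p, IsTransport p ν₁ ν₂ ∧ ∑ σ, ν₁ σ * ∑ l : Ω, moveProb (· • l) p σ ^ 2 ≤
      (4 * s ^ 2 + 4) * entSum a b ν₁ ν₂ μ := by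
  have hT : PenalizedTransport a b (4 * s ^ 2 + 4) (fun v σ ↦ σ⁻¹ • v) (∅ : Finset Ω) μ :=
    restr_empty (Ω := Ω) μ 1 ▸ penalizedTransport_restr hab hμ h hinv
  obtain ⟨p, hp, hcost⟩ := hT ν₁ h₁ ν₂ h₂ hac₁ hac₂ 0 le_rfl fun _ _ ↦ rfl
  have hpositions (σ : Γ) : ∑ l : Ω, moveProb (· • l) p σ ^ 2 =
      penalizedCost (fun v σ ↦ σ⁻¹ • v) (0 : Ω → ℝ) p σ := by
    rw [← Equiv.sum_comp (MulAction.toPerm σ⁻¹)]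
    simp only [penalizedCost, Pi.zero_apply, add_zero, MulAction.toPerm_apply,
      moveProb_smul_inv_smul]
  simp only [Pi.zero_apply, sum_const_zero, ne_eq, OfNat.ofNat_ne_zero, not_false_eq_true,
    zero_pow, mul_zero, zero_add] at hcost
  exact ⟨p, hp, by simpa only [hpositions] using hcost⟩

end PivotTransport

end Penalized

section PointMass

variable {α : Type*} [MeasurableSpace α]

/-- The mass function of a measure on a finite type, through which measures enter the transport
problems on vectors and matrices. -/
def pointMass (ν : Measure α) (x : α) : ℝ := ν.real {x}

lemma pointMass_nonneg (ν : Measure α) : 0 ≤ pointMass ν := fun _ ↦ measureReal_nonneg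

lemma pointMass_congr {ν : Measure α} {x y : α} (h : ν {x} = ν {y}) :
    pointMass ν x = pointMass ν y := congrArg ENNReal.toReal h

lemma ofReal_pointMass (ν : Measure α) [IsFiniteMeasure ν] (x : α) :
    ENNReal.ofReal (pointMass ν x) = ν {x} := ofReal_measureReal

lemma support_pointMass_subset {ν μ : Measure α} [IsFiniteMeasure μ] (h : ν ≪ μ) :
    (pointMass ν).support ⊆ (pointMass μ).support :=
  fun _ hν hμ ↦
    hν (congrArg ENNReal.toReal (h ((measureReal_eq_zero_iff (measure_ne_top _ _)).1 hμ)))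

lemma pointMass_mem_stdSimplex [Fintype α] [MeasurableSingletonClass α] (ν : Measure α)
    [IsProbabilityMeasure ν] : pointMass ν ∈ stdSimplex ℝ α :=
  ⟨pointMass_nonneg ν, by
    simp only [pointMass, sum_measureReal_singleton, coe_univ, probReal_univ]⟩

lemma klDiv_eq_ofReal_relEnt [Fintype α] [MeasurableSingletonClass α] {ν μ : Measure α}
    [IsProbabilityMeasure ν] [IsProbabilityMeasure μ] (h : ν ≪ μ) :
    klDiv ν μ = ENNReal.ofReal (relEnt (pointMass ν) (pointMass μ)) := by
  have hratio (x : α) : 0 ≤ pointMass ν x / pointMass μ x :=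
    div_nonneg (pointMass_nonneg ν x) (pointMass_nonneg μ x)
  rw [klDiv_eq_lintegral_klFun_of_ac h, lintegral_fintype,
    relEnt_eq_sum_klFun (pointMass_mem_stdSimplex ν) (pointMass_nonneg μ)
      (support_pointMass_subset h), (pointMass_mem_stdSimplex μ).2]
  simp only [div_one]
  rw [ENNReal.ofReal_sum_of_nonneg fun x _ ↦
    mul_nonneg (pointMass_nonneg μ x) (klFun_nonneg (hratio x))]
  refine sum_congr rfl fun x _ ↦ ?_
  rw [ENNReal.ofReal_mul (pointMass_nonneg μ x), ofReal_pointMass, mul_comm]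
  by_cases hx : μ {x} = 0
  · rw [hx, zero_mul, zero_mul]
  · have hdensity : ν {x} = ν.rnDeriv μ x * μ {x} := by
      conv_lhs => rw [← Measure.withDensity_rnDeriv_eq ν μ h]
      rw [withDensity_apply _ (measurableSet_singleton x), lintegral_singleton]
    rw [pointMass, pointMass, measureReal_def, measureReal_def, ← ENNReal.toReal_div, hdensity,
      ENNReal.mul_div_cancel_right hx (measure_ne_top μ _)]

end PointMass

section ShiftInstances

variable {n ℓ : ℕ} {G : Subgroup (Equiv.Perm (Fin n))}

lemma IsLocal.fiberShift (hG : IsLocal ℓ G) {μ : G → ℝ} (hμ : ∀ σ τ, μ σ = μ τ)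
    (J : Finset (Fin n)) (j : Fin n) :
    FiberShift (fun θ : G ↦ deg (θ : Equiv.Perm (Fin n)) ≤ ℓ) μ J j := by
  intro σ₁ σ₂ hag _ _
  obtain ⟨τ, hτ, hsupp, hdeg, hτj⟩ :=
    hG _ (σ₁⁻¹ * σ₂).2 (σ₂⁻¹ • j) (σ₁⁻¹ • j)
      (congrArg (σ₁⁻¹ • ·) (smul_inv_smul σ₂ j))
  have hagree (k : Fin n) (hk : τ (σ₂⁻¹ • k) = σ₁⁻¹ • k) :
      (σ₁ * ⟨τ, hτ⟩ : G)⁻¹ • k = σ₂⁻¹ • k := by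
    rw [mul_inv_rev, mul_smul, ← hk]
    exact inv_smul_smul (⟨τ, hτ⟩ : G) _
  refine ⟨⟨τ, hτ⟩, hdeg, agree_insert.2 ⟨hagree j hτj, fun k hk ↦ hagree k ?_⟩, 1, one_pos,
    fun σ _ ↦ by rw [one_mul]; exact hμ _ _⟩
  have hfix : σ₁⁻¹ • σ₂ • σ₂⁻¹ • k = σ₂⁻¹ • k := by rw [smul_inv_smul, hag k hk]
  rw [Equiv.Perm.notMem_support.1 (mt (@hsupp _) (Equiv.Perm.notMem_support.2 hfix)), hag k hk]

section Base

variable {t : (j : Fin n) → orb G j → G} {i i' : (j : Fin n) → orb G j}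

/-- The product `t_{i_1,1} ⋯ t_{i_{j-1},j-1}` of the factors of `baseMap t i` before the `j`-th. -/
def headProd (t : (j : Fin n) → orb G j → G) (i : (j : Fin n) → orb G j) (j : Fin n) : G :=
  ((List.ofFn fun k ↦ t k (i k)).take j).prod

/-- The product `t_{i_{j+1},j+1} ⋯ t_{i_n,n}` of the factors of `baseMap t i` after the `j`-th. -/
def tailProd (t : (j : Fin n) → orb G j → G) (i : (j : Fin n) → orb G j) (j : Fin n) : G :=
  ((List.ofFn fun k ↦ t k (i k)).drop (j + 1)).prod

lemma baseMap_eq (t : (j : Fin n) → orb G j → G) (i : (j : Fin n) → orb G j) (j : Fin n) :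
    baseMap t i = headProd t i j * t j (i j) * tailProd t i j := by
  rw [baseMap, ← List.prod_take_mul_prod_drop _ (j + 1), List.prod_take_succ _ _ (by simp),
    List.getElem_ofFn, headProd, tailProd]

lemma headProd_congr {j : Fin n} (h : ∀ k < j, i k = i' k) : headProd t i j = headProd t i' j := by
  refine congrArg List.prod (List.ext_getElem (by simp) fun m hm _ ↦ ?_)
  rw [List.length_take, lt_min_iff] at hm
  rw [List.getElem_take, List.getElem_take, List.getElem_ofFn, List.getElem_ofFn, h _ hm.1]

lemma tailProd_congr {j : Fin n} (h : ∀ k, j < k → i k = i' k) :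
    tailProd t i j = tailProd t i' j := by
  refine congrArg List.prod (List.ext_getElem (by simp) fun m _ _ ↦ ?_)
  rw [List.getElem_drop, List.getElem_drop, List.getElem_ofFn, List.getElem_ofFn,
    h _ (Fin.lt_def.2 (by simp only; omega))]

lemma baseMap_update (t : (j : Fin n) → orb G j → G) (i : (j : Fin n) → orb G j) (j : Fin n)
    (k : orb G j) :
    baseMap t (Function.update i j k) = headProd t i j * t j k * tailProd t i j := by
  rw [baseMap_eq t _ j, Function.update_self,
    headProd_congr fun l hl ↦ Function.update_of_ne hl.ne _ _,
    tailProd_congr fun l hl ↦ Function.update_of_ne hl.ne' _ _]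

lemma IsLocalBase.smul_eq_of_lt (ht : IsLocalBase ℓ G t) {j k : Fin n} (l : orb G j) (h : j < k) :
    t j l • k = k := by
  by_cases hl : (l : Fin n) = j
  · rw [(ht j l).1 hl, one_smul]
  · exact ((ht j l).2 hl).1.2 k h

lemma IsLocalBase.smul_self (ht : IsLocalBase ℓ G t) (j : Fin n) (l : orb G j) :
    t j l • (l : Fin n) = j := by
  by_cases hl : (l : Fin n) = j
  · rw [(ht j l).1 hl, one_smul, hl]
  · exact ((ht j l).2 hl).2.1

lemma IsLocalBase.deg_le (ht : IsLocalBase ℓ G t) (j : Fin n) (l : orb G j) :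
    deg (t j l : Equiv.Perm (Fin n)) ≤ ℓ := by
  by_cases hl : (l : Fin n) = j
  · simp [(ht j l).1 hl, deg]
  · exact ((ht j l).2 hl).2.2

lemma IsLocalBase.headProd_smul (ht : IsLocalBase ℓ G t) (i : (j : Fin n) → orb G j)
    {j k : Fin n} (h : j ≤ k) : headProd t i j • k = k := by
  refine MulAction.mem_stabilizer_iff.1 (list_prod_mem fun x hx ↦ ?_)
  obtain ⟨m, hm, rfl⟩ := List.getElem_of_mem hx
  rw [List.length_take, lt_min_iff] at hm
  rw [List.getElem_take, List.getElem_ofFn, MulAction.mem_stabilizer_iff]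
  exact ht.smul_eq_of_lt _ (lt_of_lt_of_le hm.1 h)

lemma IsLocalBase.inv_baseMap_smul (ht : IsLocalBase ℓ G t) (i : (j : Fin n) → orb G j)
    (j : Fin n) : (baseMap t i)⁻¹ • j = (tailProd t i j)⁻¹ • (i j : Fin n) := by
  rw [inv_smul_eq_iff, baseMap_eq t i j, mul_smul, smul_inv_smul, mul_smul, ht.smul_self,
    ht.headProd_smul i le_rfl]

lemma IsLocalBase.agree_baseMap_iff (ht : IsLocalBase ℓ G t) {J : Finset (Fin n)}
    (hJ : IsUpperSet (J : Set (Fin n))) :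
    Agree J (baseMap t i) (baseMap t i') ↔ ∀ k ∈ J, i k = i' k := by
  have htail {k : Fin n} (hk : k ∈ J) (h : ∀ l, k < l → l ∈ J → i l = i' l) :
      tailProd t i k = tailProd t i' k := tailProd_congr fun l hl ↦ h l hl (hJ hl.le hk)
  refine ⟨fun h k hk ↦ ?_, fun h k hk ↦ ?_⟩
  · induction k using WellFoundedGT.induction with
    | ind k ih =>
      have hk' := h k hk
      rw [ht.inv_baseMap_smul, ht.inv_baseMap_smul, htail hk ih, smul_left_cancel_iff] at hk'
      exact Subtype.ext hk'
  · rw [ht.inv_baseMap_smul, ht.inv_baseMap_smul, htail hk fun l _ ↦ h l, h k hk]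

lemma IsLocalBase.injective_baseMap (ht : IsLocalBase ℓ G t) : Function.Injective (baseMap t) :=
  fun i i' h ↦ funext fun k ↦
    (ht.agree_baseMap_iff (J := univ) (by simp [isUpperSet_univ])).1 (fun _ _ ↦ by rw [h]) k
      (mem_univ k)

/-- The element by which one multiplies `baseMap t i` on the right to replace its `j`-th coordinate
by `k`. -/
def baseShift (t : (j : Fin n) → orb G j → G) (i : (j : Fin n) → orb G j) (j : Fin n)
    (k : orb G j) : G :=
  (tailProd t i j)⁻¹ * ((t j (i j))⁻¹ * t j k) * tailProd t i j

lemma baseMap_mul_baseShift (t : (j : Fin n) → orb G j → G) (i : (j : Fin n) → orb G j)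
    (j : Fin n) (k : orb G j) :
    baseMap t i * baseShift t i j k = baseMap t (Function.update i j k) := by
  rw [baseMap_update, baseMap_eq t i j, baseShift]
  group

lemma baseShift_congr {j : Fin n} (h : ∀ l, j ≤ l → i l = i' l) (k : orb G j) :
    baseShift t i j k = baseShift t i' j k := by
  rw [baseShift, baseShift, h j le_rfl, tailProd_congr fun l hl ↦ h l hl.le]

lemma deg_conj (σ τ : Equiv.Perm (Fin n)) : deg (σ * τ * σ⁻¹) = deg τ :=
  Equiv.Perm.card_support_conj

lemma deg_inv_mul_mul (σ τ : G) :
    deg ((σ⁻¹ * τ * σ : G) : Equiv.Perm (Fin n)) = deg (τ : Equiv.Perm (Fin n)) := by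
  simpa using deg_conj (σ : Equiv.Perm (Fin n))⁻¹ τ

lemma deg_inv (σ : Equiv.Perm (Fin n)) : deg σ⁻¹ = deg σ := by
  rw [deg, deg, Equiv.Perm.support_inv]

lemma IsLocalBase.exists_baseShift_eq_mul (ht : IsLocalBase ℓ G t) (i : (j : Fin n) → orb G j)
    (j : Fin n) (k : orb G j) : ∃ g₁ g₂ : G, deg (g₁ : Equiv.Perm (Fin n)) ≤ ℓ ∧
      deg (g₂ : Equiv.Perm (Fin n)) ≤ ℓ ∧ baseShift t i j k = g₁ * g₂ := by
  refine ⟨(tailProd t i j)⁻¹ * (t j (i j))⁻¹ * tailProd t i j,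
    (tailProd t i j)⁻¹ * t j k * tailProd t i j, ?_, ?_, by rw [baseShift]; group⟩
  · rw [deg_inv_mul_mul, InvMemClass.coe_inv, deg_inv]
    exact ht.deg_le j (i j)
  · rw [deg_inv_mul_mul]
    exact ht.deg_le j k

lemma IsLocalBase.mem_support (ht : IsLocalBase ℓ G t) {j : Fin n} {l : orb G j}
    (hl : (l : Fin n) ≠ j) : j ∈ (t j l : Equiv.Perm (Fin n)).support :=
  Equiv.Perm.mem_support.2 fun h ↦
    hl ((t j l : Equiv.Perm (Fin n)).injective ((ht.smul_self j l).trans h.symm))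

lemma IsLocalBase.deg_baseShift_le (ht : IsLocalBase ℓ G t) (hℓ : 1 ≤ ℓ)
    (i : (j : Fin n) → orb G j) (j : Fin n) (k : orb G j) :
    deg (baseShift t i j k : Equiv.Perm (Fin n)) ≤ 2 * ℓ - 1 := by
  have hi := ht.deg_le j (i j)
  have hk := ht.deg_le j k
  rw [baseShift, deg_inv_mul_mul, Subgroup.coe_mul, InvMemClass.coe_inv]
  by_cases hij : (i j : Fin n) = j
  · rw [(ht j (i j)).1 hij, OneMemClass.coe_one, inv_one, one_mul]
    lia
  by_cases hkj : (k : Fin n) = j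
  · rw [(ht j k).1 hkj, OneMemClass.coe_one, mul_one, deg_inv]
    lia
  -- Both supports contain `j`, so their union has at most `2 * ℓ - 1` points.
  have hsub := Equiv.Perm.support_mul_le (t j (i j) : Equiv.Perm (Fin n))⁻¹ (t j k)
  rw [Equiv.Perm.support_inv] at hsub
  have hinter := card_pos.2 ⟨j, mem_inter.2 ⟨ht.mem_support hij, ht.mem_support hkj⟩⟩
  have hunion := card_union_add_card_inter (t j (i j) : Equiv.Perm (Fin n)).support
    (t j k : Equiv.Perm (Fin n)).support
  have hcard := card_le_card hsub
  rw [sup_eq_union] at hcard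
  simp only [deg] at hi hk ⊢
  lia

lemma IsLocalBase.mul_baseShift_mem_range_iff (ht : IsLocalBase ℓ G t) {j : Fin n} {σ : G}
    (hσ : Agree (insert j (Ioi j)) σ (baseMap t i)) (k : orb G j) :
    σ * baseShift t i j k ∈ Set.range (baseMap t) ↔ σ ∈ Set.range (baseMap t) := by
  rw [Ioi_insert] at hσ
  have hIci : IsUpperSet ((Ici j : Finset (Fin n)) : Set (Fin n)) := coe_Ici j ▸ isUpperSet_Ici j
  constructor
  · rintro ⟨i', hi'⟩
    have hag : Agree (Ici j) (baseMap t i') (baseMap t (Function.update i j k)) := by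
      rw [hi', ← baseMap_mul_baseShift]
      exact (agree_mul_right_iff _).2 hσ
    have heq := (ht.agree_baseMap_iff hIci).1 hag
    have hcancel : baseShift t i j k * baseShift t i' j (i j) = 1 := by
      apply mul_left_cancel (a := baseMap t i)
      rw [← mul_assoc, baseMap_mul_baseShift,
        baseShift_congr (fun l hl ↦ heq l (mem_Ici.2 hl)) (i j), baseMap_mul_baseShift,
        Function.update_idem, Function.update_eq_self, mul_one]
    exact ⟨_, by rw [← baseMap_mul_baseShift t i' j (i j), hi', mul_assoc, hcancel, mul_one]⟩
  · rintro ⟨i', rfl⟩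
    have heq := (ht.agree_baseMap_iff hIci).1 hσ
    rw [← baseShift_congr (fun l hl ↦ heq l (mem_Ici.2 hl)) k, baseMap_mul_baseShift]
    exact ⟨_, rfl⟩

lemma IsLocalBase.pointMass_map_baseMap (ht : IsLocalBase ℓ G t)
    (ν : (j : Fin n) → Measure (orb G j)) [∀ j, IsProbabilityMeasure (ν j)]
    (i : (j : Fin n) → orb G j) :
    pointMass ((Measure.pi ν).map (baseMap t)) (baseMap t i) = ∏ j, pointMass (ν j) (i j) := by
  rw [pointMass, measureReal_def, Measure.map_apply .of_discrete (measurableSet_singleton _),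
    ← Set.image_singleton, ht.injective_baseMap.preimage_image, Measure.pi_singleton,
    ENNReal.toReal_prod]
  rfl

lemma pointMass_map_baseMap_eq_zero (ν : (j : Fin n) → Measure (orb G j)) {σ : G}
    (hσ : σ ∉ Set.range (baseMap t)) : pointMass ((Measure.pi ν).map (baseMap t)) σ = 0 := by
  rw [pointMass, measureReal_def, Measure.map_apply .of_discrete (measurableSet_singleton _),
    Set.preimage_singleton_eq_empty.2 hσ, measure_empty, ENNReal.toReal_zero]

lemma IsLocalBase.pointMass_map_baseMap_update (ht : IsLocalBase ℓ G t)
    (ν : (j : Fin n) → Measure (orb G j)) [∀ j, IsProbabilityMeasure (ν j)]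
    (i : (j : Fin n) → orb G j) {j : Fin n} (k : orb G j) (hj : pointMass (ν j) (i j) ≠ 0) :
    pointMass ((Measure.pi ν).map (baseMap t)) (baseMap t (Function.update i j k)) =
      pointMass (ν j) k / pointMass (ν j) (i j) *
        pointMass ((Measure.pi ν).map (baseMap t)) (baseMap t i) := by
  rw [ht.pointMass_map_baseMap, ht.pointMass_map_baseMap, ← mul_prod_erase univ _ (mem_univ j),
    ← mul_prod_erase univ _ (mem_univ j), Function.update_self, ← mul_assoc, div_mul_cancel₀ _ hj]
  exact congrArg _ (prod_congr rfl fun l hl ↦ by rw [Function.update_of_ne (ne_of_mem_erase hl)])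

lemma IsLocalBase.fiberShift (ht : IsLocalBase ℓ G t) {μ : Measure G} (hμ : μ ∈ measureClass t)
    (j : Fin n) :
    FiberShift (fun θ ↦ ∃ i k, θ = baseShift t i j k) (pointMass μ) (Ioi j) j := by
  obtain ⟨ν, hν, rfl⟩ := hμ
  intro σ₁ σ₂ hag h₁ h₂
  obtain ⟨i₁, rfl⟩ := not_imp_comm.1 (pointMass_map_baseMap_eq_zero ν) h₁
  obtain ⟨i₂, rfl⟩ := not_imp_comm.1 (pointMass_map_baseMap_eq_zero ν) h₂
  have hIoi : IsUpperSet ((Ioi j : Finset (Fin n)) : Set (Fin n)) :=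
    coe_Ioi j ▸ isUpperSet_Ioi j
  have hIci : IsUpperSet ((insert j (Ioi j) : Finset (Fin n)) : Set (Fin n)) :=
    Ioi_insert j ▸ coe_Ici j ▸ isUpperSet_Ici j
  rw [ht.agree_baseMap_iff hIoi] at hag
  simp only [ht.pointMass_map_baseMap, prod_ne_zero_iff] at h₁ h₂
  have hpos {i : (j : Fin n) → orb G j} (h : ∀ l ∈ univ, pointMass (ν l) (i l) ≠ 0) :
      0 < pointMass (ν j) (i j) := (pointMass_nonneg _ _).lt_of_ne' (h j (mem_univ j))
  refine ⟨baseShift t i₁ j (i₂ j), ⟨i₁, i₂ j, rfl⟩, ?_,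
    pointMass (ν j) (i₂ j) / pointMass (ν j) (i₁ j), div_pos (hpos h₂) (hpos h₁), fun σ hσ ↦ ?_⟩
  · rw [baseMap_mul_baseShift, ht.agree_baseMap_iff hIci, forall_mem_insert]
    exact ⟨Function.update_self .., fun k hk ↦
      (Function.update_of_ne (mem_Ioi.1 hk).ne' _ _).trans (hag k hk)⟩
  · by_cases hrange : σ ∈ Set.range (baseMap t)
    · obtain ⟨i, rfl⟩ := hrange
      have heq := (ht.agree_baseMap_iff hIci).1 hσ
      rw [← heq j (mem_insert_self _ _), ← baseShift_congr (fun l hl ↦ heq l (by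
          rwa [Ioi_insert, mem_Ici])), baseMap_mul_baseShift]
      exact ht.pointMass_map_baseMap_update ν i _ (by
        rw [heq j (mem_insert_self _ _)]; exact (hpos h₁).ne')
    · simp only [pointMass_map_baseMap_eq_zero ν hrange, pointMass_map_baseMap_eq_zero ν
        (mt (ht.mul_baseShift_mem_range_iff hσ _).1 hrange), mul_zero]

end Base

end ShiftInstances

section Conjugation

lemma exists_perm_map_Ioi {n : ℕ} {J : Finset (Fin n)} {j : Fin n} (hj : j ∉ J) :
    ∃ (s : Equiv.Perm (Fin n)) (m : Fin n), s m = j ∧ (Ioi m).map s.toEmbedding = J := by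
  -- Sort the points so that `j` comes after the other points outside `J`, and `J` comes last.
  let rank (k : Fin n) : ℕ := if k ∈ J then 2 else if k = j then 1 else 0
  have hrank_j : rank j = 1 := by simp [rank, hj]
  have hrank_mem {k : Fin n} : k ∈ J ↔ rank k = 2 := by
    simp only [rank]
    split_ifs <;> simp_all
  let s := Tuple.sort rank
  have hmono : Monotone (rank ∘ s) := Tuple.monotone_sort rank
  refine ⟨s, s⁻¹ j, s.apply_symm_apply j, ?_⟩
  ext k
  rw [mem_map_equiv, mem_Ioi, hrank_mem]
  refine ⟨fun h ↦ ?_, fun h ↦ hmono.reflect_lt ?_⟩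
  · have hle : rank (s (s.symm j)) ≤ rank (s (s.symm k)) := hmono h.le
    have hne : k ≠ j := fun hk ↦ h.ne (congrArg _ hk.symm)
    rw [s.apply_symm_apply, s.apply_symm_apply, hrank_j] at hle
    simp only [rank, if_neg hne] at hle ⊢
    split_ifs at hle ⊢ <;> lia
  · change rank (s (s.symm j)) < rank (s (s.symm k))
    rw [s.apply_symm_apply, s.apply_symm_apply, hrank_j, h]
    exact one_lt_two

variable {Γ Ω : Type*} [Group Γ] [MulAction Γ Ω] {J : Finset Ω} {j : Ω}
  {μ : Γ → ℝ} {Q : Γ → Prop}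

lemma agree_map_iff {φ : Γ ≃* Γ} {s : Equiv.Perm Ω} (hs : ∀ σ k, φ σ • s k = s (σ • k))
    {σ τ : Γ} : Agree (J.map s.toEmbedding) (φ σ) (φ τ) ↔ Agree J σ τ := by
  simp only [Agree, forall_mem_map, Equiv.coe_toEmbedding, ← map_inv, hs, s.apply_eq_iff_eq]

lemma FiberShift.map [DecidableEq Ω] (h : FiberShift Q μ J j) {φ : Γ ≃* Γ} {s : Equiv.Perm Ω}
    (hs : ∀ σ k, φ σ • s k = s (σ • k)) (hμ : ∀ σ, μ (φ σ) = μ σ) (hQ : ∀ θ, Q θ → Q (φ θ)) :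
    FiberShift Q μ (J.map s.toEmbedding) (s j) := by
  have hins : insert (s j) (J.map s.toEmbedding) = (insert j J).map s.toEmbedding :=
    (map_insert ..).symm
  rw [FiberShift, hins, φ.surjective.forall₂]
  intro σ₁ σ₂ hag h₁ h₂
  rw [hμ] at h₁ h₂
  obtain ⟨θ, hθ, hagθ, κ, hκ, hshift⟩ := h σ₁ σ₂ ((agree_map_iff hs).1 hag) h₁ h₂
  refine ⟨φ θ, hQ θ hθ, by rwa [← map_mul, agree_map_iff hs], κ, hκ, ?_⟩
  rw [φ.surjective.forall]
  intro σ hσ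
  rw [← map_mul, hμ, hμ]
  exact hshift σ ((agree_map_iff hs).1 hσ)

end Conjugation

section Normal

variable {n : ℕ} {G : Subgroup (Equiv.Perm (Fin n))}

lemma FiberShift.of_normal [G.Normal] {μ : G → ℝ} {Q : G → Prop}
    (h : ∀ m : Fin n, FiberShift Q μ (Ioi m) m)
    (hμ : ∀ (s : Equiv.Perm (Fin n)) (σ : G), μ (MulAut.conjNormal s σ) = μ σ)
    (hQ : ∀ (s : Equiv.Perm (Fin n)) (θ : G), Q θ → Q (MulAut.conjNormal s θ))
    {J : Finset (Fin n)} {j : Fin n} (hj : j ∉ J) : FiberShift Q μ J j := by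
  obtain ⟨s, m, rfl, rfl⟩ := exists_perm_map_Ioi hj
  refine (h m).map (φ := MulAut.conjNormal s) (fun σ k ↦ ?_) (hμ s) (hQ s)
  rw [Subgroup.smul_def, MulAut.conjNormal_apply, mul_smul, mul_smul]
  exact congrArg (s • σ • ·) (s.symm_apply_apply k)

end Normal

section MatrixKernel

variable {α : Type*} [Fintype α] [MeasurableSpace α] [MeasurableSingletonClass α]
  {p : Matrix α α ℝ}

/-- The kernel with transition matrix `p`; the entries of `p` are truncated at `0`. -/
def matrixKernel (p : Matrix α α ℝ) : Kernel α α :=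
  Kernel.ofFunOfCountable fun x ↦ ∑ y, ENNReal.ofReal (p x y) • Measure.dirac y

lemma lintegral_matrixKernel (p : Matrix α α ℝ) (x : α) (f : α → ℝ≥0∞) :
    ∫⁻ y, f y ∂(matrixKernel p x) = meanCost f (p x) := by
  change ∫⁻ y, f y ∂(∑ y, ENNReal.ofReal (p x y) • Measure.dirac y) = _
  simp only [lintegral_finsetSum_measure, lintegral_smul_measure, lintegral_dirac, smul_eq_mul,
    meanCost]

lemma matrixKernel_apply_setOf {x : α} (hp : ∀ y, 0 ≤ p x y) (A : α → Prop) [DecidablePred A] :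
    matrixKernel p x {y | A y} = ENNReal.ofReal (∑ y with A y, p x y) := by
  rw [← lintegral_indicator_one (Set.toFinite {y | A y}).measurableSet, lintegral_matrixKernel,
    ENNReal.ofReal_sum_of_nonneg fun y _ ↦ hp y, sum_filter, meanCost]
  refine sum_congr rfl fun y _ ↦ ?_
  by_cases h : A y <;> simp [h]

variable [DecidableEq α]

lemma IsTransport.isMarkovKernel {ν₁ ν₂ : α → ℝ} (hp : IsTransport p ν₁ ν₂) :
    IsMarkovKernel (matrixKernel p) := by
  refine ⟨fun x ↦ ⟨?_⟩⟩
  rw [← lintegral_one, lintegral_matrixKernel, meanCost]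
  simp only [mul_one]
  rw [← ENNReal.ofReal_sum_of_nonneg fun y _ ↦ hp.nonneg x y, hp.sum_row, ENNReal.ofReal_one]

lemma IsTransport.snd_compProd {ν₁ ν₂ : Measure α} [IsFiniteMeasure ν₁] [IsFiniteMeasure ν₂]
    (hp : IsTransport p (pointMass ν₁) (pointMass ν₂)) : (ν₁ ⊗ₘ matrixKernel p).snd = ν₂ := by
  have := hp.isMarkovKernel
  rw [Measure.snd_compProd]
  refine Measure.ext_of_singleton fun y ↦ ?_
  rw [Measure.bind_apply (measurableSet_singleton y) (matrixKernel p).aemeasurable,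
    lintegral_fintype, ← ofReal_pointMass, ← hp.sum_mul_eq,
    ENNReal.ofReal_sum_of_nonneg fun x _ ↦ mul_nonneg (pointMass_nonneg ν₁ x) (hp.nonneg x y)]
  refine sum_congr rfl fun x _ ↦ ?_
  have hsingle := matrixKernel_apply_setOf (hp.nonneg x) (· = y)
  rw [filter_eq', if_pos (mem_univ y), sum_singleton, Set.ofPred_eq_eq_singleton] at hsingle
  rw [hsingle, ENNReal.ofReal_mul (pointMass_nonneg ν₁ x), ofReal_pointMass, mul_comm]

end MatrixKernel

section Optimization

lemma exists_holderConjugate_mul_add_mul_le {x y u : ℝ} (hx : 0 ≤ x) (hy : 0 ≤ y)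
    (hu : √x + √y < u) : ∃ a b : ℝ, a.HolderConjugate b ∧ a * x + b * y ≤ u ^ 2 := by
  obtain ⟨ε, hε, rfl⟩ : ∃ ε, 0 < ε ∧ u = √x + ε + (√y + ε) :=
    ⟨(u - (√x + √y)) / 2, half_pos (sub_pos.2 hu), by ring⟩
  have hdiv {z : ℝ} (hz : 0 ≤ z) : z / (√z + ε) ≤ √z + ε := by
    rw [div_le_iff₀ (by positivity)]
    nlinarith [Real.sq_sqrt hz, Real.sqrt_nonneg z]
  set u := √x + ε + (√y + ε) with hu_def
  have hu_pos : 0 < u := by positivity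
  refine ⟨u / (√x + ε), u / (√y + ε), ⟨?_, by positivity, by positivity⟩, ?_⟩
  · rw [inv_div, inv_div, ← add_div, inv_one, div_self hu_pos.ne']
  · calc u / (√x + ε) * x + u / (√y + ε) * y = u * (x / (√x + ε) + y / (√y + ε)) := by ring
      _ ≤ u * (√x + ε + (√y + ε)) := by gcongr <;> exact hdiv ‹_›
      _ = u ^ 2 := by rw [← hu_def, sq]

lemma le_mul_sqrt_add_sqrt_sq {T C : ℝ≥0∞} (hC : C ≠ ∞) {x y : ℝ} (hx : 0 ≤ x) (hy : 0 ≤ y)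
    (h : ∀ a b : ℝ, a.HolderConjugate b → T ≤ C * ENNReal.ofReal (a * x + b * y)) :
    T ≤ C * (ENNReal.ofReal x ^ (1 / 2 : ℝ) + ENNReal.ofReal y ^ (1 / 2 : ℝ)) ^ 2 := by
  rw [ENNReal.ofReal_rpow_of_nonneg hx one_half_pos.le,
    ENNReal.ofReal_rpow_of_nonneg hy one_half_pos.le, ← Real.sqrt_eq_rpow, ← Real.sqrt_eq_rpow,
    ← ENNReal.ofReal_add (Real.sqrt_nonneg _) (Real.sqrt_nonneg _),
    ← ENNReal.ofReal_pow (by positivity)]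
  have hbound (u : ℝ) (hu : √x + √y < u) : T ≤ C * ENNReal.ofReal (u ^ 2) := by
    obtain ⟨a, b, hab, hle⟩ := exists_holderConjugate_mul_add_mul_le hx hy hu
    exact (h a b hab).trans (by gcongr)
  have hlim : Filter.Tendsto (fun u : ℝ ↦ C * ENNReal.ofReal (u ^ 2))
      (nhdsWithin (√x + √y) (Set.Ioi (√x + √y))) (nhds (C * ENNReal.ofReal ((√x + √y) ^ 2))) :=
    ENNReal.Tendsto.const_mul (ENNReal.tendsto_ofReal
      (((continuous_pow 2).tendsto _).mono_left nhdsWithin_le_nhds)) (Or.inr hC)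
  exact ge_of_tendsto hlim (eventually_nhdsWithin_of_forall hbound)

end Optimization

section Cost

variable {n : ℕ} {G : Subgroup (Equiv.Perm (Fin n))} {μ ν₁ ν₂ : Measure G}

lemma subsingleton_of_numNontrivialOrb_eq_zero (h : numNontrivialOrb G = 0) : Subsingleton G := by
  have horb (j : Fin n) : orb G j = {j} := by
    rw [numNontrivialOrb, Set.ncard_eq_zero, Set.eq_empty_iff_forall_notMem] at h
    exact not_not.1 (h j)
  refine ⟨fun σ τ ↦ Agree.eq (Ω := Fin n) fun k _ ↦ ?_⟩
  induction k using WellFoundedGT.induction with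
  | ind k ih => exact inv_smul_eq_of_orb_eq (horb k) fun l hl ↦ ih l (mem_Ioi.1 hl) (mem_univ l)

lemma absolutelyContinuous_of_subsingleton [Subsingleton G] [NeZero μ] : ν₁ ≪ μ := by
  intro A hA
  obtain rfl | hne := A.eq_empty_or_nonempty
  · exact measure_empty
  · rw [Subsingleton.eq_univ_of_nonempty hne] at hA
    exact absurd hA (NeZero.ne _)

lemma entropyBound_eq_top (h : ¬ (ν₁ ≪ μ ∧ ν₂ ≪ μ)) : entropyBound μ ν₁ ν₂ = ∞ := by
  rw [not_and_or] at h
  rw [entropyBound]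
  obtain h | h := h <;> rw [klDiv_of_not_ac h, ENNReal.top_rpow_of_pos one_half_pos] <;> simp

variable [IsProbabilityMeasure ν₁] [IsProbabilityMeasure ν₂]

lemma le_mul_entropyBound [Fintype G] [IsProbabilityMeasure μ] {T : ℝ≥0∞} {K : ℕ}
    (hK : K = 0 → Subsingleton G)
    (h : ν₁ ≪ μ → ν₂ ≪ μ → ∀ a b : ℝ, a.HolderConjugate b →
      T ≤ K * ENNReal.ofReal (entSum a b (pointMass ν₁) (pointMass ν₂) (pointMass μ))) :
    T ≤ K * entropyBound μ ν₁ ν₂ := by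
  by_cases hac : ν₁ ≪ μ ∧ ν₂ ≪ μ
  · obtain ⟨hac₁, hac₂⟩ := hac
    have hnonneg {ν : Measure G} [IsProbabilityMeasure ν] (hac : ν ≪ μ) :
        0 ≤ relEnt (pointMass ν) (pointMass μ) :=
      relEnt_nonneg (pointMass_mem_stdSimplex ν) (pointMass_nonneg μ) (support_pointMass_subset hac)
    rw [entropyBound, klDiv_eq_ofReal_relEnt hac₁, klDiv_eq_ofReal_relEnt hac₂]
    exact le_mul_sqrt_add_sqrt_sq (ENNReal.natCast_ne_top K) (hnonneg hac₁) (hnonneg hac₂)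
      (h hac₁ hac₂)
  · have hK0 : (K : ℝ≥0∞) ≠ 0 := Nat.cast_ne_zero.2 fun hK0 ↦ by
      have := hK hK0
      exact hac ⟨absolutelyContinuous_of_subsingleton, absolutelyContinuous_of_subsingleton⟩
    rw [entropyBound_eq_top hac, ENNReal.mul_top hK0]
    exact le_top

variable [Fintype G] {p : Matrix G G ℝ} {d : G → G → ℝ≥0∞} {c : ℝ≥0∞} {E : ℝ} {v : G → ℝ}

lemma IsTransport.compProd_mem_couplings (hp : IsTransport p (pointMass ν₁) (pointMass ν₂)) :
    ν₁ ⊗ₘ matrixKernel p ∈ couplings ν₁ ν₂ := by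
  have := hp.isMarkovKernel
  exact ⟨Measure.fst_compProd _ _, hp.snd_compProd⟩

lemma IsTransport.W₁_le (hp : IsTransport p (pointMass ν₁) (pointMass ν₂)) :
    W₁ d ν₁ ν₂ ≤ ∑ σ, ENNReal.ofReal (pointMass ν₁ σ) * meanCost (d σ) (p σ) := by
  have := hp.isMarkovKernel
  refine (iInf₂_le _ hp.compProd_mem_couplings).trans_eq ?_
  rw [Measure.lintegral_compProd .of_discrete, lintegral_fintype]
  simp only [lintegral_matrixKernel, ofReal_pointMass, mul_comm]

lemma IsTransport.Ttilde_le (hp : IsTransport p (pointMass ν₁) (pointMass ν₂)) :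
    Ttilde d ν₂ ν₁ ≤ ∑ σ, ENNReal.ofReal (pointMass ν₁ σ) * meanCost (d σ) (p σ) ^ 2 := by
  refine (iInf₂_le _ hp.compProd_mem_couplings).trans ((iInf₂_le _ hp.isMarkovKernel).trans
    ((iInf_le _ rfl).trans_eq ?_))
  rw [lintegral_fintype]
  simp only [lintegral_matrixKernel, ofReal_pointMass, mul_comm]

lemma IsTransport.That_le (hp : IsTransport p (pointMass ν₁) (pointMass ν₂)) :
    That ν₂ ν₁ ≤
      ENNReal.ofReal (∑ σ, pointMass ν₁ σ * ∑ l : Fin n, moveProb (· • l) p σ ^ 2) := by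
  refine (iInf₂_le _ hp.compProd_mem_couplings).trans ((iInf₂_le _ hp.isMarkovKernel).trans
    ((iInf_le _ rfl).trans_eq ?_))
  rw [lintegral_fintype, ENNReal.ofReal_sum_of_nonneg fun σ _ ↦
    mul_nonneg (pointMass_nonneg ν₁ σ) (sum_nonneg fun l _ ↦ sq_nonneg _)]
  refine sum_congr rfl fun σ _ ↦ ?_
  rw [ENNReal.ofReal_mul (pointMass_nonneg ν₁ σ), ofReal_pointMass, mul_comm,
    ENNReal.ofReal_sum_of_nonneg fun l _ ↦ sq_nonneg _]
  refine congrArg _ (sum_congr rfl fun l _ ↦ ?_)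
  rw [matrixKernel_apply_setOf (hp.nonneg σ),
    ← ENNReal.ofReal_pow (sum_nonneg fun τ _ ↦ hp.nonneg σ τ)]
  simp only [ne_comm (a := (σ : Equiv.Perm (Fin n)) l)]
  rfl

lemma IsCostTransport.W₁_sq_le (hp : IsCostTransport d c E (pointMass ν₁) (pointMass ν₂) p v) :
    W₁ d ν₁ ν₂ ^ 2 ≤ c ^ 2 * ENNReal.ofReal (E / 2) := by
  have hmul_nonneg (σ : G) : 0 ≤ pointMass ν₁ σ * v σ :=
    mul_nonneg (pointMass_nonneg ν₁ σ) (hp.nonneg σ)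
  have hle : W₁ d ν₁ ν₂ ≤ c * ENNReal.ofReal (∑ σ, pointMass ν₁ σ * v σ) := by
    refine hp.isTransport.W₁_le.trans ?_
    rw [ENNReal.ofReal_sum_of_nonneg fun σ _ ↦ hmul_nonneg σ, mul_sum]
    refine sum_le_sum fun σ _ ↦ ?_
    rw [ENNReal.ofReal_mul (pointMass_nonneg ν₁ σ), mul_left_comm]
    obtain hσ | hσ := eq_or_ne (pointMass ν₁ σ) 0
    · simp [hσ]
    · gcongr
      exact hp.meanCost_le σ hσ
  calc W₁ d ν₁ ν₂ ^ 2 ≤ (c * ENNReal.ofReal (∑ σ, pointMass ν₁ σ * v σ)) ^ 2 := by gcongr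
    _ = c ^ 2 * ENNReal.ofReal ((∑ σ, pointMass ν₁ σ * v σ) ^ 2) := by
      rw [mul_pow, ENNReal.ofReal_pow (sum_nonneg fun σ _ ↦ hmul_nonneg σ)]
    _ ≤ c ^ 2 * ENNReal.ofReal (E / 2) := by gcongr; exact hp.sq_sum_mul_le

lemma IsCostTransport.Ttilde_le (hp : IsCostTransport d c E (pointMass ν₁) (pointMass ν₂) p v) :
    Ttilde d ν₂ ν₁ ≤ c ^ 2 * ENNReal.ofReal (2 * E) := by
  calc Ttilde d ν₂ ν₁ ≤ ∑ σ, ENNReal.ofReal (pointMass ν₁ σ) * meanCost (d σ) (p σ) ^ 2 :=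
        hp.isTransport.Ttilde_le
    _ ≤ ∑ σ, ENNReal.ofReal (pointMass ν₁ σ) * (c * ENNReal.ofReal (v σ)) ^ 2 := by
        refine sum_le_sum fun σ _ ↦ ?_
        obtain hσ | hσ := eq_or_ne (pointMass ν₁ σ) 0
        · simp [hσ]
        · gcongr
          exact hp.meanCost_le σ hσ
    _ = c ^ 2 * ENNReal.ofReal (∑ σ, pointMass ν₁ σ * v σ ^ 2) := by
        rw [ENNReal.ofReal_sum_of_nonneg fun σ _ ↦
          mul_nonneg (pointMass_nonneg ν₁ σ) (sq_nonneg _), mul_sum]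
        refine sum_congr rfl fun σ _ ↦ ?_
        rw [ENNReal.ofReal_mul (pointMass_nonneg ν₁ σ), ENNReal.ofReal_pow (hp.nonneg σ)]
        ring
    _ ≤ c ^ 2 * ENNReal.ofReal (2 * E) := by gcongr; exact hp.sum_mul_sq_le

end Cost

section Inequalities

variable {n : ℕ} {G : Subgroup (Equiv.Perm (Fin n))} {μ : Measure G} [IsProbabilityMeasure μ]

lemma exists_isCostTransport_pointMass [Fintype G] {d : G → G → ℝ≥0∞} {c : ℝ≥0∞}
    (hd : ∀ σ, d σ σ = 0) (htri : ∀ σ τ ρ, d σ ρ ≤ d σ τ + d τ ρ)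
    (h : ∀ j : Fin n, FiberShift (fun θ ↦ ∀ σ, d σ (σ * θ) ≤ c) (pointMass μ) (Ioi j) j)
    {a b : ℝ} (hab : a.HolderConjugate b) {ν₁ ν₂ : Measure G} [IsProbabilityMeasure ν₁]
    [IsProbabilityMeasure ν₂] (hac₁ : ν₁ ≪ μ) (hac₂ : ν₂ ≪ μ) :
    ∃ p v, IsCostTransport d c
      (numNontrivialOrb G * entSum a b (pointMass ν₁) (pointMass ν₂) (pointMass μ))
      (pointMass ν₁) (pointMass ν₂) p v :=
  (shiftTower_numNontrivialOrb h).exists_isCostTransport hd htri hab (pointMass_nonneg μ)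
    (pointMass_mem_stdSimplex ν₁) (pointMass_mem_stdSimplex ν₂) (support_pointMass_subset hac₁)
    (support_pointMass_subset hac₂)

theorem w₁EntropyIneq_of_fiberShift {d : G → G → ℝ≥0∞} {c : ℕ} (hd : ∀ σ, d σ σ = 0)
    (htri : ∀ σ τ ρ, d σ ρ ≤ d σ τ + d τ ρ)
    (h : ∀ j : Fin n, FiberShift (fun θ ↦ ∀ σ, d σ (σ * θ) ≤ c) (pointMass μ) (Ioi j) j) :
    W₁EntropyIneq d c μ := by
  have := Fintype.ofFinite G
  intro ν₁ ν₂ _ _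
  refine le_mul_entropyBound subsingleton_of_numNontrivialOrb_eq_zero fun hac₁ hac₂ a b hab ↦ ?_
  obtain ⟨p, v, hp⟩ := exists_isCostTransport_pointMass hd htri h hab hac₁ hac₂
  set E := entSum a b (pointMass ν₁) (pointMass ν₂) (pointMass μ)
  rw [← ENNReal.mul_div_right_comm]
  refine ENNReal.div_le_of_le_mul ?_
  calc 2 * W₁ d ν₁ ν₂ ^ 2 ≤ 2 * (c ^ 2 * ENNReal.ofReal (numNontrivialOrb G * E / 2)) := by
        gcongr
        exact hp.W₁_sq_le
    _ = numNontrivialOrb G * ENNReal.ofReal E * c ^ 2 := by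
        rw [← ENNReal.ofReal_natCast (numNontrivialOrb G),
          ← ENNReal.ofReal_mul (Nat.cast_nonneg _), mul_left_comm, ← ENNReal.ofReal_ofNat 2,
          ← ENNReal.ofReal_mul zero_le_two, mul_div_cancel₀ _ two_ne_zero, mul_comm]

theorem ttildeEntropyIneq_of_fiberShift {d : G → G → ℝ≥0∞} {c : ℕ} (hd : ∀ σ, d σ σ = 0)
    (htri : ∀ σ τ ρ, d σ ρ ≤ d σ τ + d τ ρ)
    (h : ∀ j : Fin n, FiberShift (fun θ ↦ ∀ σ, d σ (σ * θ) ≤ c) (pointMass μ) (Ioi j) j) :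
    TtildeEntropyIneq d c μ := by
  have := Fintype.ofFinite G
  intro ν₁ ν₂ _ _
  refine le_mul_entropyBound subsingleton_of_numNontrivialOrb_eq_zero fun hac₁ hac₂ a b hab ↦ ?_
  obtain ⟨p, v, hp⟩ := exists_isCostTransport_pointMass hd htri h hab hac₁ hac₂
  set E := entSum a b (pointMass ν₁) (pointMass ν₂) (pointMass μ)
  rw [← ENNReal.mul_div_right_comm, one_mul]
  refine ENNReal.div_le_of_le_mul ?_
  calc Ttilde d ν₂ ν₁ ≤ c ^ 2 * ENNReal.ofReal (2 * (numNontrivialOrb G * E)) := hp.Ttilde_le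
    _ = numNontrivialOrb G * ENNReal.ofReal E * (2 * c ^ 2) := by
        rw [ENNReal.ofReal_mul zero_le_two, ENNReal.ofReal_mul (Nat.cast_nonneg _),
          ENNReal.ofReal_natCast, ENNReal.ofReal_ofNat]
        ring

theorem thatEntropyIneq_of_fiberShift {s : ℕ}
    (h : ∀ J : Finset (Fin n), ∀ j ∉ J, FiberShift
      (fun θ : G ↦ deg (θ : Equiv.Perm (Fin n)) ≤ s + 1) (pointMass μ) J j)
    (hinv : ∀ σ : G, μ {σ} = μ {σ⁻¹}) : ThatEntropyIneq (2 * s ^ 2 + 2) μ := by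
  have := Fintype.ofFinite G
  intro ν₁ ν₂ _ _
  have hinv' : pointMass μ ∘ Equiv.inv G = pointMass μ :=
    funext fun σ ↦ (pointMass_congr (hinv σ)).symm
  rw [← one_mul (entropyBound μ ν₁ ν₂), ← Nat.cast_one (R := ℝ≥0∞)]
  refine le_mul_entropyBound (fun h ↦ absurd h one_ne_zero) fun hac₁ hac₂ a b hab ↦ ?_
  obtain ⟨p, hp, hcost⟩ := exists_transport_smul hab (pointMass_nonneg μ) h
    (hinv'.symm ▸ h) (pointMass_mem_stdSimplex ν₁) (pointMass_mem_stdSimplex ν₂)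
    (support_pointMass_subset hac₁) (support_pointMass_subset hac₂)
  set E := entSum a b (pointMass ν₁) (pointMass ν₂) (pointMass μ)
  rw [← ENNReal.mul_div_right_comm, Nat.cast_one, one_mul, one_mul]
  refine ENNReal.div_le_of_le_mul ?_
  have hconst : (4 * s ^ 2 + 4 : ℝ) = ((2 * (2 * s ^ 2 + 2) : ℕ) : ℝ) := by
    push_cast
    ring
  calc That ν₂ ν₁ ≤ ENNReal.ofReal ((4 * s ^ 2 + 4) * E) :=
        hp.That_le.trans (ENNReal.ofReal_le_ofReal hcost)
    _ = ENNReal.ofReal E * (2 * (2 * s ^ 2 + 2 : ℕ)) := by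
        rw [hconst, ENNReal.ofReal_mul (Nat.cast_nonneg _), ENNReal.ofReal_natCast, mul_comm,
          Nat.cast_mul, Nat.cast_ofNat]

end Inequalities

section Distances

variable {n ℓ : ℕ} {G : Subgroup (Equiv.Perm (Fin n))}

lemma dH_self (σ : G) : dH G σ σ = 0 := by rw [dH, hammingDist_self, Nat.cast_zero]

lemma dH_triangle (σ τ ρ : G) : dH G σ ρ ≤ dH G σ τ + dH G τ ρ := by
  simp only [dH]
  exact mod_cast hammingDist_triangle _ _ _

lemma dH_mul_right (σ θ : G) : dH G σ (σ * θ) = deg (θ : Equiv.Perm (Fin n)) := by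
  simp only [dH, deg, hammingDist, Equiv.Perm.support, Subgroup.coe_mul, Equiv.Perm.mul_apply,
    (σ : Equiv.Perm (Fin n)).injective.ne_iff, ne_comm]

lemma deg_le_card (σ : Equiv.Perm (Fin n)) : deg σ ≤ n :=
  (card_le_univ _).trans_eq (Fintype.card_fin n)

lemma dT_mul_prod_le (σ : G) {l : List G} (hl : ∀ t ∈ l, deg (t : Equiv.Perm (Fin n)) ≤ ℓ) :
    dT ℓ G σ (σ * l.prod) ≤ l.length :=
  (iInf₂_le l hl).trans (iInf_le _ rfl)

lemma dT_self (σ : G) : dT ℓ G σ σ = 0 := by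
  simpa using dT_mul_prod_le (ℓ := ℓ) σ (List.forall_mem_nil _)

lemma dT_triangle (σ τ ρ : G) : dT ℓ G σ ρ ≤ dT ℓ G σ τ + dT ℓ G τ ρ := by
  conv_rhs => rw [dT, dT]
  simp only [ENNReal.iInf_add, ENNReal.add_iInf, le_iInf_iff]
  rintro l₂ hl₂ rfl l₁ hl₁ rfl
  simpa [mul_assoc] using dT_mul_prod_le σ (List.forall_mem_append.2 ⟨hl₁, hl₂⟩)

end Distances

section Measures

variable {n ℓ : ℕ} {G : Subgroup (Equiv.Perm (Fin n))} {t : (j : Fin n) → orb G j → G}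
  {μ : Measure G}

lemma isProbabilityMeasure_of_mem_measureClass (hμ : μ ∈ measureClass t) :
    IsProbabilityMeasure μ := by
  obtain ⟨ν, hν, rfl⟩ := hμ
  exact Measure.isProbabilityMeasure_map Measurable.of_discrete.aemeasurable

lemma IsLocalBase.fiberShift_dH (ht : IsLocalBase ℓ G t) (hℓ : 1 ≤ ℓ) (hμ : μ ∈ measureClass t)
    (j : Fin n) : FiberShift (fun θ ↦ ∀ σ, dH G σ (σ * θ) ≤ (min (2 * ℓ - 1) n : ℕ))
      (pointMass μ) (Ioi j) j :=
  (ht.fiberShift hμ j).mono fun θ ⟨i, k, hθ⟩ σ ↦ by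
    rw [dH_mul_right, hθ]
    exact mod_cast le_min (ht.deg_baseShift_le hℓ i j k) (deg_le_card _)

lemma IsLocalBase.fiberShift_dT (ht : IsLocalBase ℓ G t) (hμ : μ ∈ measureClass t) (j : Fin n) :
    FiberShift (fun θ ↦ ∀ σ, dT ℓ G σ (σ * θ) ≤ (2 : ℕ)) (pointMass μ) (Ioi j) j :=
  (ht.fiberShift hμ j).mono fun θ ⟨i, k, hθ⟩ σ ↦ by
    obtain ⟨g₁, g₂, hg₁, hg₂, hprod⟩ := ht.exists_baseShift_eq_mul i j k
    simpa [hθ, hprod] using dT_mul_prod_le σ (l := [g₁, g₂]) (by simp [hg₁, hg₂])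

theorem IsLocalBase.thatEntropyIneq (ht : IsLocalBase ℓ G t) (hℓ : 1 ≤ ℓ)
    (hμ : μ ∈ measureClass t) [G.Normal] (hinv : ∀ σ : G, μ {σ} = μ {σ⁻¹})
    (hconj : ∀ (σ τ : G) (s : Equiv.Perm (Fin n)),
      (τ : Equiv.Perm (Fin n)) = s⁻¹ * (σ : Equiv.Perm (Fin n)) * s → μ {σ} = μ {τ}) :
    ThatEntropyIneq (8 * (ℓ - 1) ^ 2 + 2) μ := by
  have := isProbabilityMeasure_of_mem_measureClass hμ
  have hdeg (j : Fin n) : FiberShift (fun θ : G ↦ deg (θ : Equiv.Perm (Fin n)) ≤ 2 * (ℓ - 1) + 1)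
      (pointMass μ) (Ioi j) j :=
    (ht.fiberShift hμ j).mono fun θ ⟨i, k, hθ⟩ ↦ hθ ▸ (ht.deg_baseShift_le hℓ i j k).trans (by lia)
  have hconj' (s : Equiv.Perm (Fin n)) (σ : G) :
      pointMass μ (MulAut.conjNormal s σ) = pointMass μ σ :=
    pointMass_congr (hconj _ _ s (by rw [MulAut.conjNormal_apply]; group))
  have hconst : 8 * (ℓ - 1) ^ 2 + 2 = 2 * (2 * (ℓ - 1)) ^ 2 + 2 := by ring
  rw [hconst]
  refine thatEntropyIneq_of_fiberShift (fun J j hj ↦ .of_normal hdeg hconj' (fun s θ hθ ↦ ?_) hj)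
    hinv
  rwa [MulAut.conjNormal_apply, deg_conj]

instance isProbabilityMeasure_uniformLaw : IsProbabilityMeasure (uniformLaw G) :=
  isProbabilityMeasure_uniformOn Set.finite_univ Set.univ_nonempty

lemma uniformLaw_singleton_eq (σ τ : G) : uniformLaw G {σ} = uniformLaw G {τ} := by
  have := Fintype.ofFinite G
  simp only [uniformLaw, uniformOn_univ, Measure.count_singleton]

lemma IsLocal.fiberShift_uniformLaw (hG : IsLocal ℓ G) (J : Finset (Fin n)) (j : Fin n) :
    FiberShift (fun θ : G ↦ deg (θ : Equiv.Perm (Fin n)) ≤ ℓ) (pointMass (uniformLaw G)) J j :=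
  hG.fiberShift (fun σ τ ↦ pointMass_congr (uniformLaw_singleton_eq σ τ)) J j

lemma IsLocal.fiberShift_dH (hG : IsLocal ℓ G) (j : Fin n) :
    FiberShift (fun θ ↦ ∀ σ, dH G σ (σ * θ) ≤ ℓ) (pointMass (uniformLaw G)) (Ioi j) j :=
  (hG.fiberShift_uniformLaw _ j).mono fun θ hθ σ ↦ by
    rw [dH_mul_right]
    exact mod_cast hθ

lemma IsLocal.fiberShift_dT (hG : IsLocal ℓ G) (j : Fin n) :
    FiberShift (fun θ ↦ ∀ σ, dT ℓ G σ (σ * θ) ≤ (1 : ℕ)) (pointMass (uniformLaw G)) (Ioi j) j :=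
  (hG.fiberShift_uniformLaw _ j).mono fun θ hθ σ ↦ by
    simpa using dT_mul_prod_le σ (l := [θ]) (by simpa using hθ)

theorem IsLocal.thatEntropyIneq (hG : IsLocal ℓ G) :
    ThatEntropyIneq (2 * (ℓ - 1) ^ 2 + 2) (uniformLaw G) :=
  thatEntropyIneq_of_fiberShift (fun J j _ ↦ (hG.fiberShift_uniformLaw J j).mono
    fun _ hθ ↦ hθ.trans le_tsub_add) fun _ ↦ uniformLaw_singleton_eq _ _

end Measures

end PermTransport

end

open PermTransport in
theorem theorem1p3 {n ℓ : ℕ} (hℓ : 2 ≤ ℓ) (G : Subgroup (Equiv.Perm (Fin n))) :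
    -- measures of the class attached to a local base
    (∀ t : (j : Fin n) → PermTransport.orb G j → G, PermTransport.IsLocalBase ℓ G t →
      ∀ μ ∈ PermTransport.measureClass t,
        PermTransport.W₁EntropyIneq (PermTransport.dH G) (min (2 * ℓ - 1) n) μ ∧
        PermTransport.W₁EntropyIneq (PermTransport.dT ℓ G) 2 μ ∧
        PermTransport.TtildeEntropyIneq (PermTransport.dH G) (min (2 * ℓ - 1) n) μ ∧
        PermTransport.TtildeEntropyIneq (PermTransport.dT ℓ G) 2 μ ∧
        (G.Normal →
          (∀ σ : G, μ {σ} = μ {σ⁻¹}) →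
          (∀ (σ τ : G) (s : Equiv.Perm (Fin n)),
            (τ : Equiv.Perm (Fin n)) = s⁻¹ * (σ : Equiv.Perm (Fin n)) * s → μ {σ} = μ {τ}) →
          PermTransport.ThatEntropyIneq (8 * (ℓ - 1) ^ 2 + 2) μ)) ∧
    -- the uniform law of a local group
    (PermTransport.IsLocal ℓ G →
      PermTransport.W₁EntropyIneq (PermTransport.dH G) ℓ (PermTransport.uniformLaw G) ∧
      PermTransport.W₁EntropyIneq (PermTransport.dT ℓ G) 1 (PermTransport.uniformLaw G) ∧
      PermTransport.TtildeEntropyIneq (PermTransport.dH G) ℓ (PermTransport.uniformLaw G) ∧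
      PermTransport.TtildeEntropyIneq (PermTransport.dT ℓ G) 1 (PermTransport.uniformLaw G) ∧
      PermTransport.ThatEntropyIneq (2 * (ℓ - 1) ^ 2 + 2) (PermTransport.uniformLaw G)) := by
  refine ⟨fun t ht μ hμ ↦ ?_, fun hG ↦ ?_⟩
  · have := isProbabilityMeasure_of_mem_measureClass hμ
    have hdH := ht.fiberShift_dH (by lia) hμ
    have hdT := ht.fiberShift_dT hμ
    exact ⟨w₁EntropyIneq_of_fiberShift dH_self dH_triangle hdH,
      w₁EntropyIneq_of_fiberShift dT_self dT_triangle hdT,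
      ttildeEntropyIneq_of_fiberShift dH_self dH_triangle hdH,
      ttildeEntropyIneq_of_fiberShift dT_self dT_triangle hdT,
      fun _ hinv hconj ↦ ht.thatEntropyIneq (by lia) hμ hinv hconj⟩
  · have hdH := hG.fiberShift_dH
    have hdT := hG.fiberShift_dT
    exact ⟨w₁EntropyIneq_of_fiberShift dH_self dH_triangle hdH,
      w₁EntropyIneq_of_fiberShift dT_self dT_triangle hdT,
      ttildeEntropyIneq_of_fiberShift dH_self dH_triangle hdH,
      ttildeEntropyIneq_of_fiberShift dT_self dT_triangle hdT, hG.thatEntropyIneq⟩
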